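/- For a finite group $G$ let $c(G)$ be the number of cyclic subgroups of $G$ and let $\alpha(G)=c(G)/|G|$. Write $C_n$ for the cyclic group of order $n$ and $D_8$ for the dihedral group of order $8$. Let $X$ be a finite group with $\alpha(X)>3/4$. Then there are an integer $m\ge 0$ and a group $G$ such that $X\cong C_2^m\times G$, $\alpha(X)=\alpha(G)$, $G$ does not have $C_2$ as a direct factor, and either $G$ is trivial (in which case $\alpha(X)=1$) or one of the following occurs. 1. $G\cong A\rtimes\langle\varepsilon\rangle$, where $\langle\varepsilon\rangle\cong C_2$ acts on $A$ by inversion, and there is an integer $n\ge 1$ such that either $A=C_3^n$ and $\alpha(G)=\frac{3\cdot 3^n+1}{4\cdot 3^n}$, or $A=C_4^n$ and $\alpha(G)=\frac{3\cdot 2^n+1}{4\cdot 2^n}$. 2. $G\cong D_8\times D_8$ and $\alpha(G)=25/32$. 3. There is an integer $r\ge 1$ such that $G\cong D_8^r/N$, where $N=\{(a_1,\ldots,a_r)\in Z(D_8)^r : a_1\cdots a_r=1\}$, and $\alpha(G)=\frac{3\cdot 2^r+1}{4\cdot 2^r}$. 4. There is an integer $r\ge 1$ such that $G\cong V\rtimes\langle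 c\rangle$, where $V=\mathbb{F}_2^{2r}$ (written multiplicatively) has a basis $x_1,y_1,\ldots,x_r,y_r$, $c$ has order $2$, $c\,y_i\,c=y_i$ and $c\,x_i\,c=x_iy_i$ for $i=1,\ldots,r$, and $\alpha(G)=\frac{3\cdot 2^r+1}{4\cdot 2^r}$. -/

import Mathlib

universe u

noncomputable section

namespace CyclicRatio

open scoped IsMulCommutative

/-- `c(G)`: the number of cyclic subgroups of `G`. -/
def numCyclic (G : Type*) [Group G] : ℕ :=
  Nat.card {H : Subgroup G // IsCyclic H}

/-- `α(G) = c(G) / |G|`. -/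
def alpha (G : Type*) [Group G] : ℚ :=
  (numCyclic G : ℚ) / (Nat.card G : ℚ)

/-- The cyclic group `C_n`, written multiplicatively. -/
abbrev C (n : ℕ) : Type := Multiplicative (ZMod n)

/-- The direct power `(C_n)^k`. -/
abbrev CPow (n k : ℕ) : Type := Fin k → C n

/-- `G` has a direct factor isomorphic to `C_2`. -/
def HasC2Factor (G : Type*) [Group G] : Prop :=
  ∃ H K : Subgroup G, H.Normal ∧ K.Normal ∧ IsCompl H K ∧ Nonempty (H ≃* C 2)

/-- The homomorphism from `C_2` sending the generator to `g`, where `g * g = 1`. -/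
def involutionHom {M : Type*} [Group M] (g : M) (hg : g * g = 1) : C 2 →* M where
  toFun t := if t = 1 then 1 else g
  map_one' := by simp
  map_mul' s t := by
    have h : ∀ x : C 2, x = 1 ∨ x = Multiplicative.ofAdd 1 := by decide
    have h1 : (Multiplicative.ofAdd (1 : ZMod 2)) ≠ 1 := by decide
    have h2 : Multiplicative.ofAdd (1 : ZMod 2) * Multiplicative.ofAdd 1 = 1 := by decide
    rcases h s with rfl | rfl <;> rcases h t with rfl | rfl <;> simp only [h1, h2, hg, if_true,
      if_false, one_mul, mul_one]

/-- `A ⋊ ⟨ε⟩`, where `⟨ε⟩ = C_2` acts on the abelian group `A` by inversion. -/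
abbrev InvSemidirect (A : Type*) [CommGroup A] : Type _ :=
  A ⋊[involutionHom (MulEquiv.inv A : MulAut A) (by ext; simp)] C 2

/-- The dihedral group of order `8`. -/
abbrev D8 : Type := DihedralGroup 4

/-- `N = {(a_1, …, a_r) ∈ Z(D_8)^r : a_1 ⋯ a_r = 1}` as a subgroup of `(D_8)^r`. The product is
formed in the commutative group `Z(D_8)`. -/
def centralN (r : ℕ) : Subgroup (Fin r → D8) where
  carrier := {a | ∃ z : Fin r → Subgroup.center D8, (∀ i, (z i : D8) = a i) ∧ ∏ i, z i = 1}
  one_mem' := ⟨1, by simp, by simp⟩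
  mul_mem' := by
    rintro a b ⟨z, hz, hz1⟩ ⟨w, hw, hw1⟩
    exact ⟨z * w, fun i => by simp [hz, hw], by simp [Finset.prod_mul_distrib, hz1, hw1]⟩
  inv_mem' := by
    rintro a ⟨z, hz, hz1⟩
    exact ⟨z⁻¹, fun i => by simp [hz], by simp [hz1]⟩

instance centralN_normal (r : ℕ) : (centralN r).Normal where
  conj_mem := by
    rintro a ⟨z, hz, hz1⟩ g
    refine ⟨z, fun i => ?_, hz1⟩
    have h := Subgroup.mem_center_iff.1 (z i).2 (g i)
    simp only [Pi.mul_apply, Pi.inv_apply, ← hz i]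
    rw [h, mul_inv_cancel_right]

/-- The central product of `r` copies of `D_8`, i.e. `(D_8)^r / N`. -/
abbrev CentralProductD8 (r : ℕ) : Type := (Fin r → D8) ⧸ centralN r

/-- `V = (𝔽_2)^{2r}`, written multiplicatively. The pair `(a, b)` stands for the vector
`∑ a_i x_i + ∑ b_i y_i` in the basis `x_1, y_1, …, x_r, y_r`. -/
abbrev V (r : ℕ) : Type := Multiplicative ((Fin r → ZMod 2) × (Fin r → ZMod 2))

/-- The basis vector `x_i`. -/
def V.x {r : ℕ} (i : Fin r) : V r := Multiplicative.ofAdd (Pi.single i 1, 0)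

/-- The basis vector `y_i`. -/
def V.y {r : ℕ} (i : Fin r) : V r := Multiplicative.ofAdd (0, Pi.single i 1)

/-- The automorphism `(a, b) ↦ (a, a + b)` of `V`. -/
def shear (r : ℕ) : MulAut (V r) :=
  AddEquiv.toMultiplicative
    { toFun := fun v => (v.1, v.1 + v.2)
      invFun := fun v => (v.1, v.1 + v.2)
      left_inv := fun v => by ext i <;> simp [← add_assoc, CharTwo.add_self_eq_zero]
      right_inv := fun v => by ext i <;> simp [← add_assoc, CharTwo.add_self_eq_zero]
      map_add' := fun v w => by
        ext i
        · simp
        · simp [add_add_add_comm] }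

theorem shear_x {r : ℕ} (i : Fin r) : shear r (V.x i) = V.x i * V.y i := by
  apply Multiplicative.toAdd.injective
  ext j <;> simp [shear, V.x, V.y]

theorem shear_y {r : ℕ} (i : Fin r) : shear r (V.y i) = V.y i := by
  apply Multiplicative.toAdd.injective
  ext j <;> simp [shear, V.y]

theorem shear_mul_self (r : ℕ) : shear r * shear r = 1 := by
  refine MulEquiv.ext fun v => Multiplicative.toAdd.injective (Prod.ext rfl ?_)
  ext j
  simp [shear, ← add_assoc, CharTwo.add_self_eq_zero]

/-- `V ⋊ ⟨c⟩`, where `c` has order `2`, `c x_i c = x_i y_i` and `c y_i c = y_i` for all `i`. -/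
abbrev ShearSemidirect (r : ℕ) : Type :=
  V r ⋊[involutionHom (shear r) (shear_mul_self r)] C 2

end CyclicRatio

end

/-! ### Cyclic subgroups counted through elements -/

namespace CyclicRatio

/-! An element g contributes 1/φ(|g|) to the number of cyclic subgroups: 1 if g² = 1, and at most
1/2 otherwise. So α(X) > 3/4 forces more than half of the elements of X to satisfy g² = 1, and most
of the work is a structure theorem for such groups (`exists_abelian_or_family`).

Choose t with t² = 1 and a subgroup A inverted by t under conjugation, with |A| maximal. Left
multiplication by t matches the elements inverted by t with the solutions of g² = 1. In the coset of
an inverted x the inverted elements form xC_A(x), and for x outside A maximality makes C_A(x)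
proper. Hence only the coset A itself is more than half full, and the shortfalls of the other cosets
add up to less than |A| (`MaxInverts.sum_deficit_lt`). This makes A normal with X/A elementary
abelian (`MaxInverts.normal`, `MaxInverts.quotient_sq`). If |X : A| > 2, then C_A(x) has index two
in A for all x outside A, except on at most one coset, where the index is four
(`MaxInverts.exceptional`).

Three cases remain. If |X : A| ≤ 2, then unless X is elementary abelian there is an involution t
outside an abelian A of index two. Either A is elementary abelian and t acts on it as a shear, or t
inverts A; then α(X) = (α(A) + 1)/2, so α(A) > 1/2, which leaves only exponents dividing 4 or 6. If
every x outside A acts on A as a transvection, these share an axis or a center. Maximality excludes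
a common axis, and a common center v puts all commutators in {1, v}; splitting off dihedral groups
one by one gives a central product. If there is an exceptional coset, then |X : A| = 4, and two
commuting dihedral groups with different centers give D_8 × D_8.

In the models all orders divide 4 or 6, so α is determined by the number of solutions of g² = 1. A
direct factor C_2 would supply a central involution outside the commutator subgroup, and the models
have none. -/

/-- The number of solutions of `g * g = 1` in `G`. -/
noncomputable def numInvol (G : Type*) [Group G] : ℕ := Nat.card {g : G // g * g = 1}

/-- A cyclic group of order n has φ(n) generators, each weighted 1/φ(n). This turns a count of
subgroups into a sum over elements. -/
theorem sum_generators {G : Type*} [Group G] [Fintype G] [DecidableEq G] (g₀ : G)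
    [DecidablePred fun g : G => Subgroup.zpowers g = Subgroup.zpowers g₀] :
    ∑ g ∈ Finset.univ.filter (fun g : G => Subgroup.zpowers g = Subgroup.zpowers g₀),
      ((orderOf g).totient : ℚ)⁻¹ = 1 := by
  classical
  have hord : ∀ g : G, Subgroup.zpowers g = Subgroup.zpowers g₀ → orderOf g = orderOf g₀ := by
    intro g hg
    rw [← Nat.card_zpowers, ← Nat.card_zpowers, hg]
  have hcard : (Finset.univ.filter
      (fun g : G => Subgroup.zpowers g = Subgroup.zpowers g₀)).card = (orderOf g₀).totient := by
    have hd : orderOf g₀ ∣ Fintype.card (Subgroup.zpowers g₀) := by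
      rw [Fintype.card_zpowers]
    rw [← IsCyclic.card_orderOf_eq_totient hd]
    symm
    refine Finset.card_bij (fun a _ => (a : G)) ?_ ?_ ?_
    · intro a ha
      simp only [Finset.mem_filter, Finset.mem_univ, true_and] at ha ⊢
      apply Subgroup.eq_of_le_of_card_ge
      · exact Subgroup.zpowers_le.2 a.2
      · rw [Nat.card_zpowers, Nat.card_zpowers, Subgroup.orderOf_coe, ha]
    · intro a _ b _ h
      exact Subtype.ext h
    · intro b hb
      simp only [Finset.mem_filter, Finset.mem_univ, true_and] at hb
      refine ⟨⟨b, hb ▸ Subgroup.mem_zpowers b⟩, ?_, rfl⟩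
      simp only [Finset.mem_filter, Finset.mem_univ, true_and]
      rw [Subgroup.orderOf_mk, hord b hb]
  rw [Finset.sum_congr rfl (g := fun _ => ((orderOf g₀).totient : ℚ)⁻¹), Finset.sum_const, hcard,
    nsmul_eq_mul, mul_inv_cancel₀]
  · have := Nat.totient_pos.2 (orderOf_pos g₀)
    positivity
  · intro g hg
    simp only [Finset.mem_filter, Finset.mem_univ, true_and] at hg
    rw [hord g hg]

theorem numCyclic_eq_sum (G : Type*) [Group G] [Fintype G] :
    (numCyclic G : ℚ) = ∑ g : G, ((orderOf g).totient : ℚ)⁻¹ := by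
  classical
  have hmap : ∀ g ∈ (Finset.univ : Finset G), Subgroup.zpowers g ∈
      Finset.univ.filter (fun H : Subgroup G => IsCyclic H) := by
    intro g _
    simp only [Finset.mem_filter, Finset.mem_univ, true_and]
    infer_instance
  rw [← Finset.sum_fiberwise_of_maps_to hmap, numCyclic, Nat.card_eq_fintype_card,
    Fintype.card_subtype, Finset.card_eq_sum_ones, Nat.cast_sum]
  refine Finset.sum_congr rfl fun H hH => ?_
  simp only [Finset.mem_filter, Finset.mem_univ, true_and] at hH
  obtain ⟨g, hg⟩ := (Subgroup.isCyclic_iff_exists_zpowers_eq_top H).1 hH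
  subst hg
  rw [sum_generators g, Nat.cast_one]

theorem alpha_eq_sum (G : Type*) [Group G] [Fintype G] :
    alpha G = (∑ g : G, ((orderOf g).totient : ℚ)⁻¹) / Fintype.card G := by
  rw [alpha, numCyclic_eq_sum, Nat.card_eq_fintype_card]

theorem alpha_congr {G H : Type*} [Group G] [Group H] [Finite G] (e : G ≃* H) :
    alpha G = alpha H := by
  classical
  have : Fintype G := Fintype.ofFinite G
  have : Fintype H := Fintype.ofEquiv G e.toEquiv
  rw [alpha_eq_sum, alpha_eq_sum, Fintype.card_congr e.toEquiv]
  congr 1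
  refine Fintype.sum_equiv e.toEquiv _ _ fun g => ?_
  exact congrArg (fun n : ℕ => ((n.totient : ℚ))⁻¹) (MulEquiv.orderOf_eq e g).symm

/-- For even n the lcm is n, and for odd n one has φ(2n) = φ(n). This is why α does not see direct
factors C_2. -/
theorem totient_lcm_of_dvd_two {d n : ℕ} (hd : d ∣ 2) :
    (Nat.lcm d n).totient = n.totient := by
  rcases (Nat.dvd_prime Nat.prime_two).1 hd with rfl | rfl
  · simp
  · rcases Nat.even_or_odd n with h | h
    · rw [Nat.lcm_eq_right h.two_dvd]
    · have hc : Nat.Coprime 2 n := Nat.coprime_two_left.2 h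
      rw [hc.lcm_eq_mul, Nat.totient_mul hc]
      simp

theorem alpha_prod_of_sq {E G : Type*} [Group E] [Finite E] [Group G] [Finite G]
    (hE : ∀ e : E, e * e = 1) : alpha (E × G) = alpha G := by
  classical
  have : Fintype G := Fintype.ofFinite G
  have : Fintype E := Fintype.ofFinite E
  rw [alpha_eq_sum, alpha_eq_sum, Fintype.sum_prod_type, Fintype.card_prod]
  have h : ∀ (e : E) (g : G), ((orderOf (e, g)).totient : ℚ)⁻¹ = ((orderOf g).totient : ℚ)⁻¹ := by
    intro e g
    rw [Prod.orderOf_mk, totient_lcm_of_dvd_two (orderOf_dvd_of_pow_eq_one _)]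
    rw [pow_two, hE]
  simp only [h, Finset.sum_const, nsmul_eq_mul, Finset.card_univ, Nat.cast_mul]
  rw [mul_div_mul_left]
  exact_mod_cast Fintype.card_ne_zero

theorem cpow_two_mul_self {m : ℕ} (e : CPow 2 m) : e * e = 1 := by
  funext i
  have : ∀ x : C 2, x * x = 1 := by decide
  exact this _

theorem totient_le_one_iff_mul_self {G : Type*} [Group G] [Finite G] (g : G) :
    (orderOf g).totient = 1 ↔ g * g = 1 := by
  rw [← pow_two, ← orderOf_dvd_iff_pow_eq_one, Nat.totient_eq_one_iff,
    Nat.dvd_prime Nat.prime_two]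

theorem numInvol_eq (G : Type*) [Group G] [Fintype G] [DecidableEq G] :
    numInvol G = (Finset.univ.filter fun g : G => g * g = 1).card := by
  rw [numInvol, Nat.card_eq_fintype_card, Fintype.card_subtype]

theorem sum_half_add (G : Type*) [Group G] [Fintype G] [DecidableEq G] :
    ∑ g : G, (if g * g = 1 then (1 : ℚ) else 1 / 2) =
      (Fintype.card G + numInvol G) / 2 := by
  have h : ∀ g : G, (if g * g = 1 then (1 : ℚ) else 1 / 2) =
      1 / 2 + (if g * g = 1 then (1 / 2 : ℚ) else 0) := by
    intro g; split_ifs <;> norm_num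
  simp only [h]
  rw [Finset.sum_add_distrib, ← Finset.sum_filter, Finset.sum_const, Finset.sum_const,
    numInvol_eq, Finset.card_univ]
  simp only [nsmul_eq_mul]
  ring

/-- Weights are 1 on solutions of g² = 1 and at most 1/2 elsewhere, so α(G) is at most the average
of 1 and the proportion of solutions. -/
theorem card_lt_two_mul_numInvol {G : Type*} [Group G] [Finite G] (h : 3 / 4 < alpha G) :
    Nat.card G < 2 * numInvol G := by
  classical
  have : Fintype G := Fintype.ofFinite G
  rw [alpha_eq_sum] at h
  have hle : ∑ g : G, ((orderOf g).totient : ℚ)⁻¹ ≤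
      ∑ g : G, (if g * g = 1 then (1 : ℚ) else 1 / 2) := by
    refine Finset.sum_le_sum fun g _ => ?_
    have hpos := Nat.totient_pos.2 (orderOf_pos g)
    split_ifs with hg
    · rw [(totient_le_one_iff_mul_self g).2 hg]; norm_num
    · have h1 : (orderOf g).totient ≠ 1 := fun h => hg ((totient_le_one_iff_mul_self g).1 h)
      have h2 : (2 : ℚ) ≤ (orderOf g).totient := by
        exact_mod_cast (by omega : 2 ≤ (orderOf g).totient)
      rw [one_div]
      exact inv_anti₀ (by norm_num) h2
  rw [sum_half_add] at hle
  have hpos : (0 : ℚ) < Fintype.card G := by exact_mod_cast Fintype.card_pos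
  rw [lt_div_iff₀ hpos] at h
  rw [Nat.card_eq_fintype_card]
  have : (Fintype.card G : ℚ) < 2 * numInvol G := by linarith
  exact_mod_cast this

/-- The divisors of 4 and 6 have totient 1 or 2, so the bound behind `card_lt_two_mul_numInvol` is
attained. All values of α for the models come from here. -/
theorem alpha_eq_of_orderOf {G : Type*} [Group G] [Finite G]
    (h : ∀ g : G, orderOf g ∣ 4 ∨ orderOf g ∣ 6) :
    alpha G = (Nat.card G + numInvol G) / (2 * Nat.card G) := by
  classical
  have : Fintype G := Fintype.ofFinite G
  rw [alpha_eq_sum, Nat.card_eq_fintype_card, mul_comm 2, ← div_div, div_right_comm,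
    ← sum_half_add]
  congr 1
  refine Finset.sum_congr rfl fun g _ => ?_
  split_ifs with hg
  · rw [(totient_le_one_iff_mul_self g).2 hg]; norm_num
  · have h1 : (orderOf g).totient ≠ 1 := fun h => hg ((totient_le_one_iff_mul_self g).1 h)
    have h2 : (orderOf g).totient = 2 := by
      have hcases : orderOf g ∈ Nat.divisors 4 ∨ orderOf g ∈ Nat.divisors 6 := by
        simpa [Nat.mem_divisors] using h g
      have h4 : ∀ n ∈ Nat.divisors 4, n.totient = 1 ∨ n.totient = 2 := by decide
      have h6 : ∀ n ∈ Nat.divisors 6, n.totient = 1 ∨ n.totient = 2 := by decide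
      rcases hcases with hc | hc
      · exact (h4 _ hc).resolve_left h1
      · exact (h6 _ hc).resolve_left h1
    rw [h2]; norm_num

theorem alpha_eq_one_of_sq {G : Type*} [Group G] [Finite G] (h : ∀ g : G, g * g = 1) :
    alpha G = 1 := by
  rw [alpha_eq_of_orderOf fun g => Or.inl (orderOf_dvd_of_pow_eq_one (by
    rw [show 4 = 2 * 2 from rfl, pow_mul, pow_two g, h g, one_pow]))]
  have : numInvol G = Nat.card G := Nat.card_congr (Equiv.subtypeUnivEquiv h)
  rw [this]
  have : (Nat.card G : ℚ) ≠ 0 := by exact_mod_cast Nat.card_pos.ne'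
  field_simp
  norm_num

end CyclicRatio

/-! ### Maximal inverted subgroups and the coset count -/

namespace CyclicRatio

section Inversion

variable {X : Type*} [Group X]

/-- The element `t` has `t * t = 1` and inverts every element of `A` under conjugation. -/
structure Inverts (t : X) (A : Subgroup X) : Prop where
  sq : t * t = 1
  conj : ∀ a ∈ A, t * a * t = a⁻¹

theorem Inverts.inv_eq {t : X} {A : Subgroup X} (h : Inverts t A) : t⁻¹ = t :=
  inv_eq_of_mul_eq_one_left h.sq

theorem conj_mul_of_sq {t : X} (ht : t * t = 1) (x y : X) :
    t * (x * y) * t = (t * x * t) * (t * y * t) := by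
  have : (t * x * t) * (t * y * t) = t * x * (t * t) * y * t := by group
  rw [this, ht]; group

theorem conj_inv_of_sq {t : X} (ht : t * t = 1) (x : X) :
    t * x⁻¹ * t = (t * x * t)⁻¹ := by
  have h : t⁻¹ = t := inv_eq_of_mul_eq_one_left ht
  rw [mul_inv_rev, mul_inv_rev, h, mul_assoc]

/-- On A inversion agrees with conjugation by t, a homomorphism, and inversion is a homomorphism
only on abelian groups. -/
theorem Inverts.comm {t : X} {A : Subgroup X} (h : Inverts t A) {a b : X} (ha : a ∈ A)
    (hb : b ∈ A) : a * b = b * a := by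
  have h1 := h.conj _ (A.mul_mem (A.inv_mem ha) (A.inv_mem hb))
  rw [conj_mul_of_sq h.sq, h.conj _ (A.inv_mem ha), h.conj _ (A.inv_mem hb)] at h1
  simpa using h1

theorem inverts_closure {t : X} (ht : t * t = 1) {s : Set X}
    (hs : ∀ x ∈ s, t * x * t = x⁻¹) (hc : ∀ x ∈ s, ∀ y ∈ s, x * y = y * x) :
    Inverts t (Subgroup.closure s) := by
  refine ⟨ht, fun a ha => ?_⟩
  have hcc : ∀ x ∈ Subgroup.closure s, ∀ y ∈ Subgroup.closure s, x * y = y * x := by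
    have h1 : s ⊆ (Subgroup.centralizer s : Set X) := fun x hx y hy => hc y hy x hx
    have h2 : Subgroup.closure s ≤ Subgroup.centralizer s := (Subgroup.closure_le _).2 h1
    intro x hx y hy
    have h3 : s ⊆ (Subgroup.centralizer (Subgroup.closure s : Set X) : Set X) := by
      intro z hz w hw
      exact (h2 hw z hz).symm
    exact (((Subgroup.closure_le _).2 h3) hy x hx)
  induction ha using Subgroup.closure_induction with
  | mem x hx => exact hs x hx
  | one => simp [ht]
  | mul x y hx hy ihx ihy =>
    rw [conj_mul_of_sq ht, ihx, ihy, ← mul_inv_rev, hcc x hx y hy]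
  | inv x hx ih => rw [conj_inv_of_sq ht, ih]

theorem Inverts.closure_union {t : X} {B : Subgroup X} (h : Inverts t B) {s : Set X}
    (hs : ∀ x ∈ s, t * x * t = x⁻¹) (hc : ∀ x ∈ s, ∀ y ∈ s, x * y = y * x)
    (hB : ∀ b ∈ B, ∀ x ∈ s, b * x = x * b) :
    Inverts t (Subgroup.closure ((B : Set X) ∪ s)) := by
  refine inverts_closure h.sq ?_ ?_
  · rintro x (hx | hx)
    · exact h.conj x hx
    · exact hs x hx
  · rintro x (hx | hx) y (hy | hy)
    · exact h.comm hx hy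
    · exact hB x hx y hy
    · exact (hB y hy x hx).symm
    · exact hc x hx y hy

/-- The left cosets f i · B are disjoint and lie in M. Index bounds are obtained throughout by
listing cosets in this way. -/
theorem mul_card_le [Finite X] {B M : Subgroup X} (hBM : B ≤ M) {r : ℕ} (f : Fin r → X)
    (hf : ∀ i, f i ∈ M) (hd : ∀ i j, i < j → (f i)⁻¹ * f j ∉ B) :
    r * Nat.card B ≤ Nat.card M := by
  have : Function.Injective (fun p : Fin r × B =>
      (⟨f p.1 * p.2, M.mul_mem (hf p.1) (hBM p.2.2)⟩ : M)) := by
    rintro ⟨i, b⟩ ⟨j, c⟩ h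
    have h1 : f i * b = f j * c := congrArg Subtype.val h
    have hij : i = j := by
      rcases lt_trichotomy i j with h2 | h2 | h2
      · refine absurd ?_ (hd i j h2)
        have : (f i)⁻¹ * f j = b * (c : X)⁻¹ := by
          rw [eq_mul_inv_iff_mul_eq, mul_assoc, ← h1]; group
        rw [this]
        exact B.mul_mem b.2 (B.inv_mem c.2)
      · exact h2
      · refine absurd ?_ (hd j i h2)
        have : (f j)⁻¹ * f i = c * (b : X)⁻¹ := by
          rw [eq_mul_inv_iff_mul_eq, mul_assoc, h1]; group
        rw [this]
        exact B.mul_mem c.2 (B.inv_mem b.2)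
    subst hij
    simp only [mul_right_inj, SetLike.coe_eq_coe] at h1
    rw [h1]
  have h2 := Nat.card_le_card_of_injective _ this
  rwa [Nat.card_prod, Nat.card_eq_fintype_card, Fintype.card_fin] at h2

theorem mul_mem_of_card_lt [Finite X] {B M : Subgroup X} (hBM : B ≤ M)
    (h : Nat.card M < 3 * Nat.card B) {a b : X} (ha : a ∈ M) (hb : b ∈ M) (haB : a ∉ B)
    (hbB : b ∉ B) : a * b ∈ B := by
  by_contra hab
  -- If a * b were outside B, the cosets of 1, a⁻¹ and b would be three different ones.
  refine absurd (mul_card_le hBM ![1, a⁻¹, b] ?_ ?_) (not_le.2 h)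
  · intro i; fin_cases i
    · exact M.one_mem
    · exact M.inv_mem ha
    · exact hb
  · intro i j hij
    fin_cases i <;> fin_cases j <;> simp at hij ⊢ <;> assumption

theorem exists_mem_notMem_of_card_lt [Finite X] {B M : Subgroup X}
    (h : Nat.card B < Nat.card M) : ∃ a ∈ M, a ∉ B := by
  by_contra! hc
  exact absurd (Subgroup.card_le_of_le hc) (not_le.2 h)

theorem two_mul_card_le_of_mem [Finite X] {B M : Subgroup X} (hBM : B ≤ M) {a : X}
    (ha : a ∈ M) (haB : a ∉ B) : 2 * Nat.card B ≤ Nat.card M := by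
  refine mul_card_le hBM ![1, a] ?_ ?_
  · intro i; fin_cases i
    · exact M.one_mem
    · exact ha
  · intro i j hij
    fin_cases i <;> fin_cases j <;> simp at hij ⊢ <;> assumption

/-- The elements of `A` that commute with `x`. -/
def cent (A : Subgroup X) (x : X) : Subgroup X := A ⊓ Subgroup.centralizer {x}

theorem mem_cent {A : Subgroup X} {x a : X} : a ∈ cent A x ↔ a ∈ A ∧ a * x = x * a := by
  rw [cent, Subgroup.mem_inf, Subgroup.mem_centralizer_singleton_iff]

theorem cent_le (A : Subgroup X) (x : X) : cent A x ≤ A := inf_le_left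

theorem Inverts.mono {t : X} {A B : Subgroup X} (h : Inverts t A) (hB : B ≤ A) : Inverts t B :=
  ⟨h.sq, fun a ha => h.conj a (hB ha)⟩

/-- `A` is inverted by `t`, and no subgroup inverted by an element is larger than `A`. -/
structure MaxInverts (t : X) (A : Subgroup X) : Prop extends Inverts t A where
  max : ∀ (u : X) (B : Subgroup X), Inverts u B → Nat.card B ≤ Nat.card A

theorem exists_maxInverts (X : Type*) [Group X] [Finite X] :
    ∃ (t : X) (A : Subgroup X), MaxInverts t A := by
  have : Nonempty {p : X × Subgroup X // Inverts p.1 p.2} := ⟨⟨(1, ⊥), by simp, by simp⟩⟩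
  obtain ⟨p, hp⟩ := Finite.exists_max
    (fun p : {p : X × Subgroup X // Inverts p.1 p.2} => Nat.card p.1.2)
  exact ⟨p.1.1, p.1.2, p.2, fun u B h => hp ⟨(u, B), h⟩⟩

/-- The condition t * x * t = x⁻¹ says exactly that (t * x)² = 1. -/
theorem card_inverted (t : X) :
    Nat.card {x : X // t * x * t = x⁻¹} = numInvol X := by
  refine Nat.card_congr (Equiv.subtypeEquiv (Equiv.mulLeft t) fun x => ?_)
  rw [Equiv.coe_mulLeft, eq_inv_iff_mul_eq_one, ← mul_assoc]

variable {t : X} {A : Subgroup X}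

/-- Inside the coset `x A` of an element `x` inverted by `t`, the elements inverted by `t` are
those of `x C_A(x)`. -/
theorem Inverts.conj_mul_iff (h : Inverts t A) {x : X} (hx : t * x * t = x⁻¹) {a : X}
    (ha : a ∈ A) : t * (x * a) * t = (x * a)⁻¹ ↔ a ∈ cent A x := by
  rw [conj_mul_of_sq h.sq, hx, h.conj a ha, mem_cent, ← mul_inv_rev, inv_inj]
  simp [ha]

theorem Inverts.card_coset (h : Inverts t A) {x : X} (hx : t * x * t = x⁻¹) :
    Nat.card {s : X // t * s * t = s⁻¹ ∧ x⁻¹ * s ∈ A} = Nat.card (cent A x) := by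
  refine Nat.card_congr (Equiv.subtypeEquiv (Equiv.mulLeft x⁻¹) fun s => ?_)
  rw [Equiv.coe_mulLeft]
  constructor
  · rintro ⟨h1, h2⟩
    rw [← h.conj_mul_iff hx h2]
    simpa using h1
  · intro h1
    refine ⟨?_, cent_le A x h1⟩
    rw [← h.conj_mul_iff hx (cent_le A x h1)] at h1
    simpa using h1

/-- The number of elements inverted by `t` in a coset of `A`. -/
noncomputable def cosetCount (t : X) (A : Subgroup X) (c : X ⧸ A) : ℕ :=
  Nat.card {s : X // t * s * t = s⁻¹ ∧ (s : X ⧸ A) = c}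

theorem Inverts.cosetCount_eq (h : Inverts t A) {x : X} (hx : t * x * t = x⁻¹) :
    cosetCount t A x = Nat.card (cent A x) := by
  rw [← h.card_coset hx, cosetCount]
  refine Nat.card_congr (Equiv.subtypeEquivRight fun s => and_congr_right fun _ => ?_)
  rw [eq_comm, QuotientGroup.eq]

theorem exists_of_cosetCount_ne_zero {c : X ⧸ A} (h : cosetCount t A c ≠ 0) :
    ∃ s : X, t * s * t = s⁻¹ ∧ (s : X ⧸ A) = c := by
  by_contra hc
  refine h ?_
  rw [cosetCount]
  have : IsEmpty {s : X // t * s * t = s⁻¹ ∧ (s : X ⧸ A) = c} := ⟨fun s => hc ⟨s.1, s.2⟩⟩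
  exact Nat.card_of_isEmpty

theorem Inverts.sum_cosetCount [Finite X] [Fintype (X ⧸ A)] (h : Inverts t A) :
    ∑ c : X ⧸ A, cosetCount t A c = numInvol X := by
  classical
  have : Fintype X := Fintype.ofFinite X
  rw [← card_inverted t, Nat.card_eq_fintype_card, Fintype.card_subtype,
    Finset.card_eq_sum_card_fiberwise (f := fun s : X => (s : X ⧸ A)) (t := Finset.univ)
      (fun _ _ => Finset.mem_coe.2 (Finset.mem_univ _))]
  refine Finset.sum_congr rfl fun c _ => ?_
  rw [cosetCount, Nat.card_eq_fintype_card, Fintype.card_subtype, Finset.filter_filter]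

theorem cosetCount_one (h : Inverts t A) : cosetCount t A ((1 : X) : X ⧸ A) = Nat.card A := by
  rw [h.cosetCount_eq (by simp [h.sq])]
  congr 1
  have : cent A 1 = A := by ext a; simp [mem_cent]
  rw [this]

/-- Otherwise A and x together would generate a larger subgroup inverted by t. -/
theorem MaxInverts.mem_of_commute [Finite X] (h : MaxInverts t A) {x : X} (hx : t * x * t = x⁻¹)
    (hc : ∀ a ∈ A, a * x = x * a) : x ∈ A := by
  by_contra hxA
  have h1 := h.max t _ (h.toInverts.closure_union (s := {x}) (by simpa using hx)
    (by simp) (by simpa using hc))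
  have h2 : A ≤ Subgroup.closure ((A : Set X) ∪ {x}) :=
    fun a ha => Subgroup.subset_closure (Or.inl ha)
  have h3 := two_mul_card_le_of_mem h2 (Subgroup.subset_closure (Or.inr rfl)) hxA
  have h4 : 0 < Nat.card A := Nat.card_pos
  omega

theorem MaxInverts.two_mul_card_cent_le [Finite X] (h : MaxInverts t A) {x : X}
    (hx : t * x * t = x⁻¹) (hxA : x ∉ A) : 2 * Nat.card (cent A x) ≤ Nat.card A := by
  by_cases hc : ∀ a ∈ A, a * x = x * a
  · exact absurd (h.mem_of_commute hx hc) hxA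
  · push Not at hc
    obtain ⟨a, ha, hax⟩ := hc
    exact two_mul_card_le_of_mem (cent_le A x) ha fun h' => hax (mem_cent.1 h').2

theorem MaxInverts.two_mul_cosetCount_le [Finite X] (h : MaxInverts t A) {c : X ⧸ A}
    (hc : c ≠ ((1 : X) : X ⧸ A)) : 2 * cosetCount t A c ≤ Nat.card A := by
  by_cases h0 : cosetCount t A c = 0
  · omega
  · obtain ⟨s, hs, rfl⟩ := exists_of_cosetCount_ne_zero h0
    rw [h.toInverts.cosetCount_eq hs]
    refine h.two_mul_card_cent_le hs fun hsA => hc ?_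
    rw [eq_comm, QuotientGroup.eq]
    simpa using hsA

theorem card_eq_mul [Finite X] [Fintype (X ⧸ A)] :
    Nat.card X = Fintype.card (X ⧸ A) * Nat.card A := by
  rw [Subgroup.card_eq_card_quotient_mul_card_subgroup A, Nat.card_eq_fintype_card]

/-- Call |A| - 2 · `cosetCount` the deficit of a coset. The deficits sum to |X| - 2 · `numInvol X`,
which is negative. The coset A has deficit -|A| and all the others are nonnegative, so no family of
other cosets can reach |A|. Every later restriction on the action on A rests on this. -/
theorem MaxInverts.sum_deficit_lt [Finite X] (h : MaxInverts t A)
    (hX : Nat.card X < 2 * numInvol X) (T : Finset (X ⧸ A))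
    (hT : ((1 : X) : X ⧸ A) ∉ T) :
    ∑ c ∈ T, ((Nat.card A : ℤ) - 2 * cosetCount t A c) < Nat.card A := by
  classical
  have : Fintype (X ⧸ A) := Fintype.ofFinite _
  have h1 : ∑ c ∈ T, ((Nat.card A : ℤ) - 2 * cosetCount t A c) ≤
      ∑ c ∈ Finset.univ.erase ((1 : X) : X ⧸ A), ((Nat.card A : ℤ) - 2 * cosetCount t A c) := by
    refine Finset.sum_le_sum_of_subset_of_nonneg (fun c hc => ?_) fun c hc _ => ?_
    · exact Finset.mem_erase.2 ⟨fun h => hT (h ▸ hc), Finset.mem_univ _⟩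
    · have := h.two_mul_cosetCount_le (Finset.ne_of_mem_erase hc)
      omega
  have h2 := Finset.add_sum_erase Finset.univ
    (fun c => (Nat.card A : ℤ) - 2 * cosetCount t A c) (Finset.mem_univ ((1 : X) : X ⧸ A))
  have h3 := h.toInverts.sum_cosetCount
  have h4 : ∑ c : X ⧸ A, ((Nat.card A : ℤ) - 2 * cosetCount t A c) =
      Fintype.card (X ⧸ A) * Nat.card A - 2 * numInvol X := by
    rw [Finset.sum_sub_distrib, ← Finset.mul_sum, Finset.sum_const,
      Finset.card_univ, nsmul_eq_mul, ← Nat.cast_sum, h3]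
  rw [cosetCount_one h.toInverts, h4] at h2
  rw [card_eq_mul (A := A)] at hX
  have hX' : (Fintype.card (X ⧸ A) : ℤ) * Nat.card A < 2 * numInvol X := by exact_mod_cast hX
  linarith

/-- A coset without inverted elements would have deficit |A| by itself. -/
theorem MaxInverts.exists_inverted [Finite X] (h : MaxInverts t A)
    (hX : Nat.card X < 2 * numInvol X) (x : X) : ∃ s : X, t * s * t = s⁻¹ ∧ x⁻¹ * s ∈ A := by
  by_cases hx : x ∈ A
  · exact ⟨1, by simp [h.sq], by simpa using hx⟩
  have h1 := h.sum_deficit_lt hX {(x : X ⧸ A)} (by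
    rw [Finset.mem_singleton, QuotientGroup.eq]; simpa using hx)
  rw [Finset.sum_singleton] at h1
  obtain ⟨s, hs, hsx⟩ := exists_of_cosetCount_ne_zero (t := t) (c := (x : X ⧸ A)) (by omega)
  exact ⟨s, hs, QuotientGroup.eq.1 hsx.symm⟩

/-- Two distinct nontrivial cosets. -/
theorem MaxInverts.two_cosets [Finite X] (h : MaxInverts t A)
    (hX : Nat.card X < 2 * numInvol X) {x y : X} (hx : t * x * t = x⁻¹) (hy : t * y * t = y⁻¹)
    (hxA : x ∉ A) (hyA : y ∉ A) (hxy : x⁻¹ * y ∉ A) :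
    Nat.card A < 2 * (Nat.card (cent A x) + Nat.card (cent A y)) := by
  classical
  have h1 := h.sum_deficit_lt hX {(x : X ⧸ A), (y : X ⧸ A)} (by
    simp only [Finset.mem_insert, Finset.mem_singleton, QuotientGroup.eq, inv_one, one_mul]
    tauto)
  rw [Finset.sum_pair (by rwa [Ne, QuotientGroup.eq]), h.toInverts.cosetCount_eq hx,
    h.toInverts.cosetCount_eq hy] at h1
  omega

/-- Three distinct nontrivial cosets. -/
theorem MaxInverts.three_cosets [Finite X] (h : MaxInverts t A)
    (hX : Nat.card X < 2 * numInvol X) {x y z : X} (hx : t * x * t = x⁻¹)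
    (hy : t * y * t = y⁻¹) (hz : t * z * t = z⁻¹)
    (hxA : x ∉ A) (hyA : y ∉ A) (hzA : z ∉ A) (hxy : x⁻¹ * y ∉ A) (hxz : x⁻¹ * z ∉ A)
    (hyz : y⁻¹ * z ∉ A) :
    Nat.card A < Nat.card (cent A x) + Nat.card (cent A y) + Nat.card (cent A z) := by
  classical
  have h1 := h.sum_deficit_lt hX {(x : X ⧸ A), (y : X ⧸ A), (z : X ⧸ A)} (by
    simp only [Finset.mem_insert, Finset.mem_singleton, QuotientGroup.eq, inv_one, one_mul]
    tauto)
  rw [Finset.sum_insert (by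
      simp only [Finset.mem_insert, Finset.mem_singleton, QuotientGroup.eq]; tauto),
    Finset.sum_pair (by rwa [Ne, QuotientGroup.eq]), h.toInverts.cosetCount_eq hx,
    h.toInverts.cosetCount_eq hy, h.toInverts.cosetCount_eq hz] at h1
  omega

/-- An element `g` inverted by `u` that centralizes a subgroup `B` of half the maximal order
inverted by `u` has its square in `B`. -/
theorem MaxInverts.mul_self_mem [Finite X] (h : MaxInverts t A) {u : X} {B : Subgroup X}
    (hB : Inverts u B) (hcard : Nat.card A < 3 * Nat.card B) {g : X} (hg : u * g * u = g⁻¹)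
    (hc : ∀ b ∈ B, b * g = g * b) : g * g ∈ B := by
  by_cases hgB : g ∈ B
  · exact B.mul_mem hgB hgB
  have h1 := h.max u _ (hB.closure_union (s := {g}) (by simpa using hg)
    (by simp) (by simpa using hc))
  have h2 : B ≤ Subgroup.closure ((B : Set X) ∪ {g}) :=
    fun a ha => Subgroup.subset_closure (Or.inl ha)
  have h3 : g ∈ Subgroup.closure ((B : Set X) ∪ {g}) := Subgroup.subset_closure (Or.inr rfl)
  -- The subgroup generated by B and g is inverted by u, so its order is at most |A| < 3|B| and B
  -- has index at most two in it.
  exact mul_mem_of_card_lt h2 (by omega) h3 h3 hgB hgB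

/-- Besides t, the element x * t also squares to 1 and inverts B = C_A(x). For a in A it inverts a *
x, which centralizes B, so (a * x)² lies in B by `MaxInverts.mul_self_mem`. Then x a x⁻¹ = a⁻¹ (a
x)² x⁻² lies in A. -/
theorem MaxInverts.half_normalizes [Finite X] (h : MaxInverts t A) {x : X}
    (hx : t * x * t = x⁻¹) (hcard : 2 * Nat.card (cent A x) = Nat.card A) :
    x * x ∈ cent A x ∧ ∀ a ∈ A, x * a * x⁻¹ ∈ A := by
  have hpos : 0 < Nat.card (cent A x) := Nat.card_pos
  have hB : Inverts t (cent A x) := h.toInverts.mono (cent_le A x)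
  have hxx : x * x ∈ cent A x :=
    h.mul_self_mem hB (by omega) hx fun b hb => (mem_cent.1 hb).2
  refine ⟨hxx, fun a ha => ?_⟩
  have hti := h.toInverts.inv_eq
  have htx : t * x = x⁻¹ * t := by
    rw [← hx, mul_assoc, h.sq, mul_one]
  have hta : t * a = a⁻¹ * t := by
    rw [← h.conj a ha, mul_assoc, h.sq, mul_one]
  have hxt : x * t * (x * t) = 1 := by
    rw [mul_assoc, ← mul_assoc t x t, hx, mul_inv_cancel]
  have hu : Inverts (x * t) (cent A x) := by
    refine ⟨hxt, fun b hb => ?_⟩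
    have hb' := (mem_cent.1 ((cent A x).inv_mem hb)).2
    calc x * t * b * (x * t) = x * (t * b * t) * (t * x * t) := by
          have : x * (t * b * t) * (t * x * t) = x * t * b * (t * t) * x * t := by group
          rw [this, h.sq]; group
      _ = b⁻¹ := by rw [hx, h.conj b (cent_le A x hb), ← hb', mul_inv_cancel_right]
  have hax : x * t * (a * x) * (x * t) = (a * x)⁻¹ := by
    have hcomm := h.toInverts.comm (A.inv_mem ha) (A.inv_mem (cent_le A x hxx))
    calc x * t * (a * x) * (x * t) = x * (t * (a * x * x) * t) := by group
      _ = x * (a⁻¹ * (x * x)⁻¹) := by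
          rw [mul_assoc a x x, conj_mul_of_sq h.sq, h.conj a ha, h.conj _ (cent_le A x hxx)]
      _ = (a * x)⁻¹ := by rw [hcomm]; group
  have h2 : a * x * (a * x) ∈ cent A x := by
    refine h.mul_self_mem hu (by omega) hax fun b hb => ?_
    rw [← mul_assoc, h.toInverts.comm (cent_le A x hb) ha, mul_assoc, (mem_cent.1 hb).2, mul_assoc]
  have h3 : x * a * x⁻¹ = a⁻¹ * (a * x * (a * x)) * (x * x)⁻¹ := by group
  rw [h3]
  exact A.mul_mem (A.mul_mem (A.inv_mem ha) (cent_le A x h2)) (A.inv_mem (cent_le A x hxx))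

end Inversion

end CyclicRatio

/-! ### Normality of A and the index of centralizers -/

namespace CyclicRatio

section Normality

variable {X : Type*} [Group X] {t : X} {A : Subgroup X}

theorem Inverts.pow_mem_of_card_eq [Finite X] (h : Inverts t A) {B : Subgroup X} (hB : B ≤ A)
    {m : ℕ} (hm : Nat.card A = m * Nat.card B) {a : X} (ha : a ∈ A) : a ^ m ∈ B := by
  have : (B.subgroupOf A).Normal := ⟨fun n hn g => by
    have : g * n * g⁻¹ = n := by
      apply Subtype.ext
      simp [h.comm g.2 n.2]
    rwa [this]⟩
  have h1 := (B.subgroupOf A).index_mul_card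
  rw [Nat.card_congr (Subgroup.subgroupOfEquivOfLe hB).toEquiv, hm] at h1
  have h2 := Nat.eq_of_mul_eq_mul_right Nat.card_pos h1
  have h3 := (B.subgroupOf A).pow_index_mem ⟨a, ha⟩
  rw [h2] at h3
  exact h3

/-- Since A is abelian, multiplying x by elements of A does not affect which elements of A commute
with it. Centralizers in A are thus attached to cosets. -/
theorem Inverts.cent_mul_left (h : Inverts t A) {a : X} (ha : a ∈ A) (x : X) :
    cent A (a * x) = cent A x := by
  ext b
  rw [mem_cent, mem_cent]
  refine and_congr_right fun hb => ?_
  rw [← mul_assoc, h.comm hb ha, mul_assoc, mul_assoc, mul_right_inj]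

theorem Inverts.cent_mul_right (h : Inverts t A) {a : X} (ha : a ∈ A) (x : X) :
    cent A (x * a) = cent A x := by
  ext b
  rw [mem_cent, mem_cent]
  refine and_congr_right fun hb => ?_
  rw [mul_assoc, ← h.comm hb ha, ← mul_assoc, ← mul_assoc, mul_left_inj]

theorem cent_inv (A : Subgroup X) (x : X) : cent A x⁻¹ = cent A x := by
  ext b
  rw [mem_cent, mem_cent]
  refine and_congr_right fun hb => ?_
  exact ⟨fun h => (Commute.inv_right_iff.1 h), fun h => (Commute.inv_right h)⟩

theorem cent_inf_le (A : Subgroup X) (x y : X) : cent A x ⊓ cent A y ≤ cent A (x * y) := by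
  rintro b ⟨hx, hy⟩
  have hx := mem_cent.1 hx
  exact mem_cent.2 ⟨hx.1, Commute.mul_right hx.2 (mem_cent.1 hy).2⟩

theorem card_cent_dvd (A : Subgroup X) (x : X) : Nat.card (cent A x) ∣ Nat.card A :=
  Subgroup.card_dvd_of_le (cent_le A x)

theorem conj_inv_of_conj {x : X} (hx : t * x * t = x⁻¹) (ht : t * t = 1) :
    t * x⁻¹ * t = (x⁻¹)⁻¹ := by
  rw [conj_inv_of_sq ht, hx]

/-- When x⁻¹ a x is not in A, the element a x a lies in a coset other than xA but has the same
centralizer in A. An x that fails to normalize A thus produces several poorly filled cosets. -/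
theorem Inverts.palindrome (h : Inverts t A) {a x : X} (ha : a ∈ A) (hx : t * x * t = x⁻¹) :
    t * (a * x * a) * t = (a * x * a)⁻¹ := by
  rw [conj_mul_of_sq h.sq, conj_mul_of_sq h.sq, hx, h.conj a ha]; group

/-- If x⁻¹ a x is outside A, the cosets of x and a x a force |A| < 4|C_A(x)|, so C_A(x) has index 2
or 3. Index 2 is excluded by `MaxInverts.half_normalizes`. For index 3 the cube a³ commutes with x,
so x⁻¹ a² x is outside A as well, and the three cosets of x, a x a and a² x a² give |A| < 3|C_A(x)|.
-/
theorem MaxInverts.inverted_normalizes [Finite X] (h : MaxInverts t A)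
    (hX : Nat.card X < 2 * numInvol X) {x : X} (hx : t * x * t = x⁻¹) {a : X} (ha : a ∈ A) :
    x⁻¹ * a * x ∈ A := by
  by_contra hax
  have key : ∀ b ∈ A, b * x * b * (x⁻¹ * b * x * b)⁻¹ = x := fun b _ => by group
  have hxA : x ∉ A := fun hxA => hax (A.mul_mem (A.mul_mem (A.inv_mem hxA) ha) hxA)
  have hn : ∀ b ∈ A, x⁻¹ * b * x ∉ A → x⁻¹ * (b * x * b) ∉ A := by
    intro b hb hbx hc
    refine hbx ?_
    have := A.mul_mem hc (A.inv_mem hb)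
    simpa [mul_assoc] using this
  have hnA : ∀ b ∈ A, b * x * b ∉ A := by
    intro b hb hc
    refine hxA ?_
    have := A.mul_mem (A.mul_mem (A.inv_mem hb) hc) (A.inv_mem hb)
    simpa [mul_assoc] using this
  have hc : ∀ b ∈ A, cent A (b * x * b) = cent A x := fun b hb => by
    rw [h.cent_mul_right hb, h.cent_mul_left hb]
  have h2 := h.two_mul_card_cent_le hx hxA
  have h4 := h.two_cosets hX hx (h.palindrome ha hx) hxA (hnA a ha) (hn a ha hax)
  rw [hc a ha] at h4
  obtain ⟨q, hq⟩ := card_cent_dvd A x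
  have hpos : 0 < Nat.card (cent A x) := Nat.card_pos
  have hq4 : q < 4 := by
    by_contra hq4
    have := Nat.mul_le_mul_left (Nat.card (cent A x)) (not_lt.1 hq4)
    omega
  have hq2 : 2 ≤ q := by
    by_contra hq2
    have := Nat.mul_le_mul_left (Nat.card (cent A x)) (Nat.le_of_lt_succ (not_le.1 hq2))
    omega
  obtain rfl | rfl : q = 2 ∨ q = 3 := by omega
  · have := (h.half_normalizes (conj_inv_of_conj hx h.sq) (by rw [cent_inv]; omega)).2 a ha
    rw [inv_inv] at this
    exact hax this
  · have haa := A.mul_mem ha ha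
    by_cases hsq : x⁻¹ * (a * a) * x ∈ A
    · have h3 := h.toInverts.pow_mem_of_card_eq (cent_le A x) (by rw [hq, mul_comm]) ha
      refine hax ?_
      have h5 : x⁻¹ * a * x = a ^ 3 * (x⁻¹ * (a * a) * x)⁻¹ := by
        have h6 : x⁻¹ * a ^ 3 * x = a ^ 3 := by
          rw [mul_assoc, (mem_cent.1 h3).2, inv_mul_cancel_left]
        calc x⁻¹ * a * x = (x⁻¹ * a ^ 3 * x) * (x⁻¹ * (a * a) * x)⁻¹ := by
              simp only [pow_succ, pow_zero, one_mul]; group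
          _ = _ := by rw [h6]
      rw [h5]
      exact A.mul_mem (cent_le A x h3) (A.inv_mem hsq)
    · have h5 := h.three_cosets hX hx (h.palindrome ha hx) (h.palindrome haa hx) hxA
        (hnA a ha) (hnA _ haa) (hn a ha hax) (hn _ haa hsq) (by
          intro hc'
          refine hax ?_
          have := A.mul_mem (A.mul_mem ha hc') (A.inv_mem haa)
          have h6 : a * ((a * x * a)⁻¹ * (a * a * x * (a * a))) * (a * a)⁻¹ = x⁻¹ * a * x := by
            group
          rwa [h6] at this)
      rw [hc a ha, hc _ haa] at h5
      omega

theorem MaxInverts.normal [Finite X] (h : MaxInverts t A)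
    (hX : Nat.card X < 2 * numInvol X) : A.Normal := by
  refine ⟨fun a ha x => ?_⟩
  obtain ⟨s, hs, hxs⟩ := h.exists_inverted hX x⁻¹
  rw [inv_inv] at hxs
  have h1 := h.inverted_normalizes hX hs ha
  have h2 := A.mul_mem (A.mul_mem hxs h1) (A.inv_mem hxs)
  have h3 : x * s * (s⁻¹ * a * s) * (x * s)⁻¹ = x * a * x⁻¹ := by group
  rwa [h3] at h2

theorem MaxInverts.mem_of_commute' [Finite X] (h : MaxInverts t A)
    (hX : Nat.card X < 2 * numInvol X) {x : X} (hc : ∀ a ∈ A, a * x = x * a) : x ∈ A := by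
  obtain ⟨s, hs, hxs⟩ := h.exists_inverted hX x
  have h1 : s ∈ A := h.mem_of_commute hs fun a ha => by
    obtain ⟨b, hb, rfl⟩ : ∃ b ∈ A, s = x * b := ⟨x⁻¹ * s, hxs, by group⟩
    rw [← mul_assoc, hc a ha, mul_assoc, h.comm ha hb, mul_assoc]
  have h2 := A.mul_mem h1 (A.inv_mem hxs)
  simpa using h2

/-- Every coset has an inverted representative, so t inverts all of X/A. Hence X/A is abelian,
conjugation in it is trivial, and inversion is the identity: X/A is an elementary abelian 2-group.
-/
theorem MaxInverts.quotient_conj [Finite X] (h : MaxInverts t A)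
    (hX : Nat.card X < 2 * numInvol X) [A.Normal] (x : X ⧸ A) :
    (t : X ⧸ A) * x * (t : X ⧸ A) = x⁻¹ := by
  obtain ⟨x, rfl⟩ := QuotientGroup.mk_surjective x
  obtain ⟨s, hs, hxs⟩ := h.exists_inverted hX x
  rw [QuotientGroup.eq.2 hxs]
  exact congrArg _ hs

theorem MaxInverts.quotient_comm [Finite X] (h : MaxInverts t A)
    (hX : Nat.card X < 2 * numInvol X) [A.Normal] (x y : X ⧸ A) : x * y = y * x := by
  have ht : (t : X ⧸ A) * (t : X ⧸ A) = 1 := congrArg (QuotientGroup.mk (s := A)) h.sq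
  have h1 := h.quotient_conj hX (x⁻¹ * y⁻¹)
  rw [conj_mul_of_sq ht, h.quotient_conj hX, h.quotient_conj hX] at h1
  simpa using h1

theorem MaxInverts.quotient_sq [Finite X] (h : MaxInverts t A)
    (hX : Nat.card X < 2 * numInvol X) [A.Normal] (x : X ⧸ A) : x * x = 1 := by
  have ht : (t : X ⧸ A) * (t : X ⧸ A) = 1 := congrArg (QuotientGroup.mk (s := A)) h.sq
  have h1 := h.quotient_conj hX x
  rw [h.quotient_comm hX, ← mul_assoc, ht, one_mul] at h1
  nth_rw 1 [h1]
  simp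

theorem MaxInverts.mul_self_mem_normal [Finite X] (h : MaxInverts t A)
    (hX : Nat.card X < 2 * numInvol X) (x : X) : x * x ∈ A := by
  have := h.normal hX
  rw [← QuotientGroup.eq_one_iff]
  exact h.quotient_sq hX x

theorem MaxInverts.commutator_mem [Finite X] (h : MaxInverts t A)
    (hX : Nat.card X < 2 * numInvol X) (x y : X) : x * y * x⁻¹ * y⁻¹ ∈ A := by
  have := h.normal hX
  rw [← QuotientGroup.eq_one_iff]
  have h1 := h.quotient_comm hX (x : X ⧸ A) y
  change (x : X ⧸ A) * y * (x : X ⧸ A)⁻¹ * (y : X ⧸ A)⁻¹ = 1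
  rw [h1]; group

/-- Membership in `A` of a product of two factors does not depend on the order or on inverses. -/
theorem MaxInverts.inv_mul_mem_iff [Finite X] (h : MaxInverts t A)
    (hX : Nat.card X < 2 * numInvol X) (x y : X) : x⁻¹ * y ∈ A ↔ x * y ∈ A := by
  have h1 := h.mul_self_mem_normal hX x
  have hn := h.normal hX
  constructor
  · intro h2
    have := A.mul_mem h1 h2
    simpa [mul_assoc] using this
  · intro h2
    have := A.mul_mem (A.inv_mem h1) h2
    simpa [mul_assoc] using this

theorem MaxInverts.exists_eq [Finite X] (h : MaxInverts t A)
    (hX : Nat.card X < 2 * numInvol X) (x : X) : ∃ a ∈ A, t * (x * a) * t = (x * a)⁻¹ := by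
  obtain ⟨s, hs, hxs⟩ := h.exists_inverted hX x
  exact ⟨x⁻¹ * s, hxs, by simpa using hs⟩

theorem MaxInverts.two_mul_card_cent_le' [Finite X] (h : MaxInverts t A)
    (hX : Nat.card X < 2 * numInvol X) {x : X} (hxA : x ∉ A) :
    2 * Nat.card (cent A x) ≤ Nat.card A := by
  obtain ⟨a, ha, hs⟩ := h.exists_eq hX x
  have h1 := h.two_mul_card_cent_le hs fun h' => hxA (by
    simpa using A.mul_mem h' (A.inv_mem ha))
  rwa [h.cent_mul_right ha] at h1

theorem MaxInverts.two_cosets' [Finite X] (h : MaxInverts t A)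
    (hX : Nat.card X < 2 * numInvol X) {x y : X}
    (hxA : x ∉ A) (hyA : y ∉ A) (hxy : x⁻¹ * y ∉ A) :
    Nat.card A < 2 * (Nat.card (cent A x) + Nat.card (cent A y)) := by
  have hn := h.normal hX
  obtain ⟨a, ha, hs⟩ := h.exists_eq hX x
  obtain ⟨b, hb, hs'⟩ := h.exists_eq hX y
  have hQ : ∀ x y a b : X, a ∈ A → b ∈ A → (x * a)⁻¹ * (y * b) ∈ A → x⁻¹ * y ∈ A := by
    intro x y a b ha hb hc
    rw [← QuotientGroup.eq] at hc ⊢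
    rwa [QuotientGroup.mk_mul_of_mem _ ha, QuotientGroup.mk_mul_of_mem _ hb] at hc
  have hA : ∀ x a : X, a ∈ A → x ∉ A → x * a ∉ A := fun x a ha hx h' => hx (by
    simpa using A.mul_mem h' (A.inv_mem ha))
  have h1 := h.two_cosets hX hs hs' (hA _ _ ha hxA) (hA _ _ hb hyA)
    fun hc => hxy (hQ _ _ _ _ ha hb hc)
  rwa [h.cent_mul_right ha, h.cent_mul_right hb] at h1

theorem MaxInverts.three_cosets' [Finite X] (h : MaxInverts t A)
    (hX : Nat.card X < 2 * numInvol X) {x y z : X}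
    (hxA : x ∉ A) (hyA : y ∉ A) (hzA : z ∉ A) (hxy : x⁻¹ * y ∉ A) (hxz : x⁻¹ * z ∉ A)
    (hyz : y⁻¹ * z ∉ A) :
    Nat.card A < Nat.card (cent A x) + Nat.card (cent A y) + Nat.card (cent A z) := by
  have hn := h.normal hX
  obtain ⟨a, ha, hs⟩ := h.exists_eq hX x
  obtain ⟨b, hb, hs'⟩ := h.exists_eq hX y
  obtain ⟨c, hc, hs''⟩ := h.exists_eq hX z
  have hQ : ∀ x y a b : X, a ∈ A → b ∈ A → (x * a)⁻¹ * (y * b) ∈ A → x⁻¹ * y ∈ A := by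
    intro x y a b ha hb hc
    rw [← QuotientGroup.eq] at hc ⊢
    rwa [QuotientGroup.mk_mul_of_mem _ ha, QuotientGroup.mk_mul_of_mem _ hb] at hc
  have hA : ∀ x a : X, a ∈ A → x ∉ A → x * a ∉ A := fun x a ha hx h' => hx (by
    simpa using A.mul_mem h' (A.inv_mem ha))
  have h1 := h.three_cosets hX hs hs' hs'' (hA _ _ ha hxA) (hA _ _ hb hyA) (hA _ _ hc hzA)
    (fun hc => hxy (hQ _ _ _ _ ha hb hc)) (fun h' => hxz (hQ _ _ _ _ ha hc h'))
    (fun h' => hyz (hQ _ _ _ _ hb hc h'))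
  rwa [h.cent_mul_right ha, h.cent_mul_right hb, h.cent_mul_right hc] at h1

theorem card_inf_of_half [Finite X] {B C : Subgroup X} (hB : B ≤ A) (hC : C ≤ A)
    (h : 2 * Nat.card B = Nat.card A) :
    Nat.card C = 1 * Nat.card (C ⊓ B : Subgroup X) ∨
      Nat.card C = 2 * Nat.card (C ⊓ B : Subgroup X) := by
  by_cases hCB : C ≤ B
  · left; rw [inf_eq_left.2 hCB, one_mul]
  · right
    obtain ⟨c, hc, hcB⟩ := SetLike.not_le_iff_exists.1 hCB
    refine le_antisymm ?_ (two_mul_card_le_of_mem inf_le_left hc fun h' => hcB h'.2)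
    by_contra! hlt
    have h3 : B.relIndex C ≤ B.relIndex A :=
      Subgroup.relIndex_le_of_le_right hC
        (Nat.pos_of_dvd_of_pos (B.relIndex_dvd_card A) Nat.card_pos).ne'
    have h4 : B.relIndex A * Nat.card B = Nat.card A := by
      rw [← Subgroup.relIndex_bot_left B, mul_comm, Subgroup.relIndex_mul_relIndex _ _ _ bot_le hB,
        Subgroup.relIndex_bot_left]
    have h5 : B.relIndex C * Nat.card (C ⊓ B : Subgroup X) = Nat.card C := by
      rw [← Subgroup.inf_relIndex_left, ← Subgroup.relIndex_bot_left (C ⊓ B), mul_comm,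
        Subgroup.relIndex_mul_relIndex _ _ _ bot_le inf_le_left, Subgroup.relIndex_bot_left]
    rw [← h] at h4
    have h6 := Nat.eq_of_mul_eq_mul_right Nat.card_pos h4
    rw [h6] at h3
    have := Nat.mul_le_mul_right (Nat.card (C ⊓ B : Subgroup X)) h3
    omega

/-- Any two of C_A(x), C_A(u), C_A(xu) have the same intersection D. With d = |D| and |C_A(u)| = dl,
index two leaves orders d or 2d for the other two, and the two-coset inequality gives dl < |C_A(x)|
+ |C_A(xu)|. Apart from the asserted case l = 2 with orders d and 2d, only l = 3 with orders 2d and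
2d resists pure counting. -/
theorem MaxInverts.exceptional_of_half [Finite X] (h : MaxInverts t A)
    (hX : Nat.card X < 2 * numInvol X) {x u : X} (hx : x ∉ A) (hu : u ∉ A) (hxu : x * u ∉ A)
    (hxc : 2 * Nat.card (cent A x) ≠ Nat.card A) (huc : 2 * Nat.card (cent A u) = Nat.card A) :
    4 * Nat.card (cent A x) = Nat.card A ∧ 2 * Nat.card (cent A (x * u)) = Nat.card A := by
  have hn := h.normal hX
  have hD : cent A (x * u) ⊓ cent A u = cent A x ⊓ cent A u := by
    refine le_antisymm (le_inf ?_ inf_le_right) (le_inf (cent_inf_le A x u) inf_le_right)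
    rw [← cent_inv A u]
    refine (cent_inf_le A (x * u) u⁻¹).trans_eq ?_
    rw [mul_inv_cancel_right]
  have hD' : cent A x ⊓ cent A (x * u) = cent A x ⊓ cent A u := by
    refine le_antisymm (le_inf inf_le_left ?_) (le_inf inf_le_left (cent_inf_le A x u))
    rw [← cent_inv A x]
    refine (cent_inf_le A x⁻¹ (x * u)).trans_eq ?_
    rw [inv_mul_cancel_left]
  have h1 := card_inf_of_half (cent_le A u) (cent_le A x) huc
  have h2 := card_inf_of_half (cent_le A u) (cent_le A (x * u)) huc
  rw [hD] at h2
  obtain ⟨l, hl⟩ := Subgroup.card_dvd_of_le (inf_le_right : cent A x ⊓ cent A u ≤ cent A u)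
  have hlt := h.two_cosets' hX hx hxu (by
    intro h'; rw [inv_mul_cancel_left] at h'; exact hu h')
  have hle := h.two_mul_card_cent_le' hX hx
  have hdpos : 0 < Nat.card (cent A x ⊓ cent A u : Subgroup X) := Nat.card_pos
  set d := Nat.card (cent A x ⊓ cent A u : Subgroup X) with hd
  have hmul : ∀ i j : ℕ, i ≤ j → i * d ≤ j * d := fun i j hij => Nat.mul_le_mul_right d hij
  rcases h1 with h1 | h1
  · obtain rfl | rfl | hl3 : l = 0 ∨ l = 1 ∨ 2 ≤ l := by omega
    · omega
    · omega
    rcases h2 with h2 | h2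
    · have := hmul 2 l hl3
      rw [mul_comm] at hl
      omega
    · by_cases hl4 : 3 ≤ l
      · have := hmul 3 l hl4
        rw [mul_comm] at hl
        omega
      · obtain rfl : l = 2 := by omega
        omega
  · exfalso
    obtain rfl | rfl | rfl | rfl | hl4 : l = 0 ∨ l = 1 ∨ l = 2 ∨ l = 3 ∨ 4 ≤ l := by omega
    · omega
    · omega
    · omega
    -- Here C_A(xu) has index 3 in A. For a in C_A(x) outside D, the cube a³ lies in C_A(xu) and a²
    -- lies in D, so a lies in C_A(x) ∩ C_A(xu) = D, a contradiction.
    · have h2 : Nat.card (cent A (x * u)) = 2 * d := by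
        rcases h2 with h2 | h2 <;> omega
      obtain ⟨a, ha, had⟩ : ∃ a ∈ cent A x, a ∉ cent A x ⊓ cent A u :=
        exists_mem_notMem_of_card_lt (by omega)
      have h3 := h.toInverts.pow_mem_of_card_eq (cent_le A (x * u)) (m := 3) (by omega)
        (cent_le A x ha)
      have h4 := mul_mem_of_card_lt (inf_le_left : cent A x ⊓ cent A u ≤ cent A x) (by omega) ha ha
        had had
      refine had ?_
      rw [← hD'] at h4 ⊢
      refine ⟨ha, ?_⟩
      have h5 := (cent A (x * u)).mul_mem h3 ((cent A (x * u)).inv_mem h4.2)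
      simpa [pow_succ, mul_assoc] using h5
    · have := hmul 4 l hl4
      rw [mul_comm] at hl
      rcases h2 with h2 | h2 <;> omega

/-- If the centralizer in `A` of an element `x` outside `A` does not have index `2`, it has index
`4`, and the elements outside `A ∪ x A` have centralizers of index `2`. -/
theorem MaxInverts.exceptional [Finite X] (h : MaxInverts t A)
    (hX : Nat.card X < 2 * numInvol X) {x u : X} (hx : x ∉ A) (hu : u ∉ A) (hxu : x * u ∉ A)
    (hxc : 2 * Nat.card (cent A x) ≠ Nat.card A) :
    4 * Nat.card (cent A x) = Nat.card A ∧ 2 * Nat.card (cent A u) = Nat.card A ∧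
      2 * Nat.card (cent A (x * u)) = Nat.card A := by
  have hn := h.normal hX
  by_cases huc : 2 * Nat.card (cent A u) = Nat.card A
  · have := h.exceptional_of_half hX hx hu hxu hxc huc
    tauto
  have hxx := h.mul_self_mem_normal hX x
  by_cases huc' : 2 * Nat.card (cent A (x * u)) = Nat.card A
  · have h1 := h.exceptional_of_half hX hx hxu (fun h' => hu (by
      have := A.mul_mem (A.inv_mem hxx) h'
      simpa [mul_assoc] using this)) hxc huc'
    rw [← mul_assoc, h.cent_mul_left hxx] at h1
    tauto
  exfalso
  have h3 := h.three_cosets' hX hx hu hxu (by rwa [h.inv_mul_mem_iff hX])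
    (by rwa [inv_mul_cancel_left]) (by
      rw [h.inv_mul_mem_iff hX]
      intro h'
      have h4 := A.mul_mem (h.commutator_mem hX u x) (hn.conj_mem _ h' (u * x * (x * u)⁻¹)⁻¹)
      have h5 := hn.conj_mem _ h' u⁻¹
      have h6 := A.mul_mem h5 (A.inv_mem (h.mul_self_mem_normal hX u))
      refine hx ?_
      simpa [mul_assoc] using h6)
  -- None of the three centralizers has index two, so each has order at most |A|/3, against the
  -- three-coset inequality.
  have hthird : ∀ y, y ∉ A → 2 * Nat.card (cent A y) ≠ Nat.card A →
      3 * Nat.card (cent A y) ≤ Nat.card A := by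
    intro y hy hyc
    have h2 := h.two_mul_card_cent_le' hX hy
    obtain ⟨q, hq⟩ := card_cent_dvd A y
    have hq3 : 3 ≤ q := by
      by_contra hq3
      obtain rfl | rfl | rfl : q = 0 ∨ q = 1 ∨ q = 2 := by omega
      all_goals
        have : 0 < Nat.card A := Nat.card_pos
        omega
    have := Nat.mul_le_mul_left (Nat.card (cent A y)) hq3
    omega
  have h1 := hthird x hx hxc
  have h2 := hthird u hu huc
  have h4 := hthird _ hxu huc'
  omega

end Normality

end CyclicRatio

/-! ### Transvections on A -/

namespace CyclicRatio

section Transvections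

variable {X : Type*} [Group X] {t : X} {A : Subgroup X}

/-- Conjugation by `x` fixes the elements of `cent A x` and multiplies the other elements of `A`
by the involution `v`. -/
structure IsTransvection (A : Subgroup X) (x v : X) : Prop where
  mem : v ∈ A
  ne_one : v ≠ 1
  sq : v * v = 1
  conj : ∀ a ∈ A, a ∉ cent A x → x * a * x⁻¹ = v * a
  half : 2 * Nat.card (cent A x) = Nat.card A

theorem conj_of_mem_cent {x a : X} (ha : a ∈ cent A x) : x * a * x⁻¹ = a := by
  rw [← (mem_cent.1 ha).2, mul_inv_cancel_right]

theorem mem_cent_of_conj {x a : X} (ha : a ∈ A) (h : x * a * x⁻¹ = a) : a ∈ cent A x :=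
  mem_cent.2 ⟨ha, (mul_inv_eq_iff_eq_mul.1 h).symm⟩

/-- Two elements of A outside C_A(x) differ by an element fixed by x, so their commutators with x
agree. The common value squares to 1 because squares of elements of A lie in the index-two subgroup
C_A(x). -/
theorem MaxInverts.exists_isTransvection [Finite X] (h : MaxInverts t A)
    (hX : Nat.card X < 2 * numInvol X) {x : X} (hx : 2 * Nat.card (cent A x) = Nat.card A) :
    ∃ v, IsTransvection A x v := by
  have hn := h.normal hX
  have hpos : 0 < Nat.card (cent A x) := Nat.card_pos
  obtain ⟨a, ha, hax⟩ := exists_mem_notMem_of_card_lt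
    (show Nat.card (cent A x) < Nat.card A by omega)
  have hv : x * a * x⁻¹ * a⁻¹ ∈ A := A.mul_mem (hn.conj_mem a ha x) (A.inv_mem ha)
  refine ⟨x * a * x⁻¹ * a⁻¹, hv, ?_, ?_, ?_, hx⟩
  · intro h1
    exact hax (mem_cent_of_conj ha (mul_inv_eq_one.1 h1))
  · have h1 : a * a ∈ cent A x := mul_mem_of_card_lt (cent_le A x) (by omega) ha ha hax hax
    have h2 := conj_of_mem_cent h1
    have h3 : x * (a * a) * x⁻¹ = (x * a * x⁻¹) * (x * a * x⁻¹) := by group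
    rw [h3] at h2
    have h4 := h.comm (A.inv_mem ha) (hn.conj_mem a ha x)
    calc x * a * x⁻¹ * a⁻¹ * (x * a * x⁻¹ * a⁻¹)
        = x * a * x⁻¹ * (a⁻¹ * (x * a * x⁻¹)) * a⁻¹ := by group
      _ = (x * a * x⁻¹ * (x * a * x⁻¹)) * a⁻¹ * a⁻¹ := by rw [h4]; group
      _ = 1 := by rw [h2]; group
  · intro b hb hbx
    have h1 : b⁻¹ * a ∈ cent A x := mul_mem_of_card_lt (cent_le A x) (by omega) (A.inv_mem hb) ha
      (fun h' => hbx (by simpa using (cent A x).inv_mem h')) hax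
    have h2 := conj_of_mem_cent h1
    have h3 : x * a * x⁻¹ = x * b * x⁻¹ * (x * (b⁻¹ * a) * x⁻¹) := by group
    rw [h3, h2]
    group

theorem IsTransvection.mul_left (h : Inverts t A) {x v a : X} (hv : IsTransvection A x v)
    (ha : a ∈ A) (hn : A.Normal) : IsTransvection A (a * x) v := by
  refine ⟨hv.mem, hv.ne_one, hv.sq, fun b hb hbx => ?_, ?_⟩
  · rw [h.cent_mul_left ha] at hbx
    have h1 := hv.conj b hb hbx
    have h2 := h.comm ha (hn.conj_mem b hb x)
    calc a * x * b * (a * x)⁻¹ = a * (x * b * x⁻¹) * a⁻¹ := by group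
      _ = v * b := by rw [h2, mul_inv_cancel_right, h1]
  · rw [h.cent_mul_left ha, hv.half]

theorem IsTransvection.apply_self {x v : X} (hv : IsTransvection A x v) :
    v ∈ cent A x := by
  by_contra hc
  have h1 := hv.conj v hv.mem hc
  rw [hv.sq, mul_inv_eq_one] at h1
  exact hv.ne_one (by simpa using h1)

theorem IsTransvection.conj_or {x v : X} (hv : IsTransvection A x v) {a : X} (ha : a ∈ A) :
    x * a * x⁻¹ = a ∨ x * a * x⁻¹ = v * a := by
  by_cases hc : a ∈ cent A x
  · exact Or.inl (conj_of_mem_cent hc)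
  · exact Or.inr (hv.conj a ha hc)

theorem exists_mem_notMem_of_ne [Finite X] {B C : Subgroup X} (h : Nat.card B = Nat.card C)
    (hne : B ≠ C) : ∃ a ∈ B, a ∉ C := by
  by_contra! hc
  exact hne (Subgroup.eq_of_le_of_card_ge hc h.ge)

/-- If the product of two transvections is a transvection, then they have the same axis or the
same center. -/
theorem IsTransvection.mul [Finite X] {x y v w u : X} (hv : IsTransvection A x v)
    (hw : IsTransvection A y w) (hu : IsTransvection A (x * y) u) :
    cent A x = cent A y ∨ v = w := by
  by_contra! hc
  obtain ⟨hne, hvw⟩ := hc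
  have hcard : Nat.card (cent A x) = Nat.card (cent A y) := by
    have := hv.half
    have := hw.half
    omega
  obtain ⟨b, hbx, hby⟩ := exists_mem_notMem_of_ne hcard hne
  obtain ⟨a, hay, hax⟩ := exists_mem_notMem_of_ne hcard.symm hne.symm
  -- The element a is moved by x only and b by y only. The value of the product at a gives u = v;
  -- its value at b then forces w = 1 or v = w in each case.
  have hxy : ∀ c, x * y * c * (x * y)⁻¹ = x * (y * c * y⁻¹) * x⁻¹ := fun c => by group
  have hb := cent_le A x hbx
  have ha := cent_le A y hay
  have h1 := hxy a
  rw [conj_of_mem_cent hay, hv.conj a ha hax] at h1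
  have huv : u = v := by
    rcases hu.conj_or ha with h2 | h2
    · rw [h2] at h1
      exact absurd (by simpa using h1.symm) hv.ne_one
    · rw [h2] at h1
      exact mul_right_cancel h1
  have h3 := hxy b
  have h4 : x * (w * b) * x⁻¹ = (x * w * x⁻¹) * (x * b * x⁻¹) := by group
  rw [hw.conj b hb hby, h4, conj_of_mem_cent hbx] at h3
  rcases hu.conj_or hb with h2 | h2 <;> rcases hv.conj_or hw.mem with h5 | h5 <;>
    rw [h2, h5] at h3
  · exact hw.ne_one (by simpa using h3.symm)
  · rw [right_eq_mul] at h3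
    exact hvw ((eq_inv_of_mul_eq_one_left h3).trans (inv_eq_of_mul_eq_one_left hw.sq))
  · exact hvw (huv.symm.trans (mul_right_cancel h3))
  · rw [huv] at h3
    exact hw.ne_one (by simpa using (mul_right_cancel h3).symm)

theorem card_eq_relIndex_mul {B : Subgroup X} (hB : B ≤ A) :
    Nat.card A = B.relIndex A * Nat.card B := by
  rw [← Subgroup.relIndex_bot_left B, mul_comm, Subgroup.relIndex_mul_relIndex _ _ _ bot_le hB,
    Subgroup.relIndex_bot_left]

/-- Two moved elements are both multiplied by v, so their quotient is fixed. -/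
theorem Inverts.card_le_two_mul_cent [Finite X] (hA : Inverts t A) {x v : X} (hv : v ∈ A)
    (h : ∀ a ∈ A, x * a * x⁻¹ = a ∨ x * a * x⁻¹ = v * a) : Nat.card A ≤ 2 * Nat.card (cent A x) := by
  rw [card_eq_relIndex_mul (cent_le A x)]
  refine Nat.mul_le_mul_right _ (Nat.le_of_dvd two_pos ?_)
  rw [Subgroup.relIndex_dvd_two_iff]
  by_cases hc : ∃ a ∈ A, x * a * x⁻¹ ≠ a
  · obtain ⟨a, ha, hax⟩ := hc
    have hax := (h a ha).resolve_left hax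
    refine ⟨a⁻¹, A.inv_mem ha, fun b hb => ?_⟩
    rcases h b hb with h1 | h1
    · exact Or.inr (mem_cent_of_conj hb h1)
    · left
      refine mem_cent_of_conj (A.mul_mem hb (A.inv_mem ha)) ?_
      have h2 : x * (b * a⁻¹) * x⁻¹ = (x * b * x⁻¹) * (x * a * x⁻¹)⁻¹ := by group
      rw [h2, h1, hax]
      have h3 := hA.comm hv (A.mul_mem hb (A.inv_mem ha))
      calc v * b * (v * a)⁻¹ = v * (b * a⁻¹) * v⁻¹ := by group
        _ = b * a⁻¹ := by rw [h3, mul_inv_cancel_right]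
  · push Not at hc
    exact ⟨1, A.one_mem, fun b hb => Or.inr (mem_cent_of_conj hb (hc b hb))⟩

theorem MaxInverts.mul_mem_iff [Finite X] (h : MaxInverts t A)
    (hX : Nat.card X < 2 * numInvol X) [A.Normal] (x y : X) :
    x * y ∈ A ↔ (x : X ⧸ A) = y := by
  rw [← h.inv_mul_mem_iff hX, QuotientGroup.eq]

theorem MaxInverts.cent_congr [Finite X] (h : MaxInverts t A)
    (hX : Nat.card X < 2 * numInvol X) {x y : X} (hxy : x * y ∈ A) : cent A x = cent A y := by
  rw [← h.inv_mul_mem_iff hX] at hxy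
  rw [← h.cent_mul_right hxy, mul_inv_cancel_left]

theorem MaxInverts.isTransvection_congr [Finite X] (h : MaxInverts t A)
    (hX : Nat.card X < 2 * numInvol X) {x y v : X} (hxy : x * y ∈ A)
    (hv : IsTransvection A x v) : IsTransvection A y v := by
  have h1 := A.mul_mem (A.inv_mem hxy) (h.mul_self_mem_normal hX x)
  have hn := h.normal hX
  have h2 := hn.conj_mem _ ((h.inv_mul_mem_iff hX x y).2 hxy) x
  rw [mul_inv_cancel_left] at h2
  have h3 := hv.mul_left h.toInverts h2 hn
  rwa [inv_mul_cancel_right] at h3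

/-- By `IsTransvection.mul` any two of the transvections share an axis or a center. If x and y have
different axes, they share a center, and a z with another center would have the axis of x and also
that of y. -/
theorem MaxInverts.same_axis_or_center [Finite X] (h : MaxInverts t A)
    (hX : Nat.card X < 2 * numInvol X)
    (hall : ∀ x ∉ A, 2 * Nat.card (cent A x) = Nat.card A) :
    (∀ x ∉ A, ∀ y ∉ A, cent A x = cent A y) ∨ ∃ v, ∀ x ∉ A, IsTransvection A x v := by
  by_cases hc : ∀ x ∉ A, ∀ y ∉ A, cent A x = cent A y
  · exact Or.inl hc
  push Not at hc
  obtain ⟨x, hx, y, hy, hxy⟩ := hc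
  choose! v hv using fun x (hx : x ∉ A) => h.exists_isTransvection hX (hall x hx)
  have key : ∀ x ∉ A, ∀ y ∉ A, cent A x = cent A y ∨ v x = v y := by
    intro x hx y hy
    by_cases hxy : x * y ∈ A
    · exact Or.inl (h.cent_congr hX hxy)
    · exact (hv x hx).mul (hv y hy) (hv _ hxy)
  refine Or.inr ⟨v x, fun z hz => ?_⟩
  have hvxy := (key x hx y hy).resolve_left hxy
  have hvz : v z = v x := by
    by_contra hvz
    have h1 := (key z hz x hx).resolve_right hvz
    have h2 := (key z hz y hy).resolve_right (hvxy ▸ hvz)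
    exact hxy (h1.symm.trans h2)
  rw [← hvz]
  exact hv z hz

theorem MaxInverts.half_of_exceptional [Finite X] (h : MaxInverts t A)
    (hX : Nat.card X < 2 * numInvol X) [A.Normal] {x u : X} (hx : x ∉ A)
    (hxc : 2 * Nat.card (cent A x) ≠ Nat.card A) (hu : u ∉ A) (hux : (u : X ⧸ A) ≠ x) :
    2 * Nat.card (cent A u) = Nat.card A :=
  (h.exceptional hX hx hu (fun hc => hux ((h.mul_mem_iff hX x u).1 hc).symm) hxc).2.1

/-- If u and x * u had the same axis or the same center, their quotient x would fix at least half of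
A, whereas C_A(x) has index four. -/
theorem MaxInverts.cent_ne_of_exceptional [Finite X] (h : MaxInverts t A)
    (hX : Nat.card X < 2 * numInvol X) [A.Normal] {x u v w : X} (hx : x ∉ A)
    (hxc : 2 * Nat.card (cent A x) ≠ Nat.card A) (hu : u ∉ A) (hux : (u : X ⧸ A) ≠ x)
    (hv : IsTransvection A u v) (hw : IsTransvection A (x * u) w) :
    cent A u ≠ cent A (x * u) ∧ v ≠ w := by
  have hxu : x * u ∉ A := fun hc => hux ((h.mul_mem_iff hX x u).1 hc).symm
  obtain ⟨h4, -, -⟩ := h.exceptional hX hx hu hxu hxc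
  have hpos : 0 < Nat.card A := Nat.card_pos
  constructor
  · intro hc
    have h1 := cent_inf_le A (x * u) u⁻¹
    rw [cent_inv, ← hc, inf_idem, mul_inv_cancel_right] at h1
    have := Subgroup.card_le_of_le h1
    have := hv.half
    omega
  · rintro rfl
    have h1 : ∀ a ∈ A, x * a * x⁻¹ = a ∨ x * a * x⁻¹ = v * a := by
      intro a ha
      have hua : u⁻¹ * a * u ∈ A := by
        have := (inferInstance : A.Normal).conj_mem a ha u⁻¹
        rwa [inv_inv] at this
      have h2 : x * a * x⁻¹ = (x * u) * (u⁻¹ * a * u) * (x * u)⁻¹ := by group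
      have h3 : u * (u⁻¹ * a * u) * u⁻¹ = a := by group
      rw [h2]
      rcases hv.conj_or hua with h5 | h5 <;> rcases hw.conj_or hua with h6 | h6 <;> rw [h6] <;>
        rw [h3] at h5
      · exact Or.inl h5.symm
      · exact Or.inr (by rw [← h5])
      · right
        generalize u⁻¹ * a * u = b at h5 ⊢
        rw [h5, ← mul_assoc, hv.sq, one_mul]
      · exact Or.inl h5.symm
    have := h.toInverts.card_le_two_mul_cent hv.mem h1
    omega

/-- Having the same axis, y and u multiply to a transvection with that axis and center v v'. The
axis differs from that of u', so `hyu'` makes the center v', whence v = 1. -/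
theorem IsTransvection.not_crossing [Finite X] {u u' y v v' : X}
    (hu : IsTransvection A u v) (hy : IsTransvection A y v')
    (hne : cent A u ≠ cent A u') (huy : cent A u = cent A y)
    (hyu : 2 * Nat.card (cent A (y * u)) = Nat.card A)
    (hyu' : ∀ w, IsTransvection A (y * u) w → cent A (y * u) = cent A u' ∨ w = v')
    (hex : ∃ w, IsTransvection A (y * u) w) : False := by
  obtain ⟨w, hw⟩ := hex
  have hcent : cent A (y * u) = cent A u := by
    symm
    refine Subgroup.eq_of_le_of_card_ge ?_ ?_
    · refine le_trans ?_ (cent_inf_le A y u)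
      rw [← huy, inf_idem]
    · have := hu.half
      omega
  have hwv := (hyu' w hw).resolve_left (hcent ▸ hne)
  have hpos : 0 < Nat.card (cent A u) := Nat.card_pos
  have hh := hu.half
  obtain ⟨a, ha, hau⟩ := exists_mem_notMem_of_card_lt
    (show Nat.card (cent A u) < Nat.card A by omega)
  have h1 := hw.conj a ha (hcent ▸ hau)
  have hvy := hu.apply_self
  rw [huy] at hvy
  have h2 : y * u * a * (y * u)⁻¹ = (y * v * y⁻¹) * (y * a * y⁻¹) := by
    have : y * u * a * (y * u)⁻¹ = y * (u * a * u⁻¹) * y⁻¹ := by group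
    rw [this, hu.conj a ha hau]; group
  rw [h2, conj_of_mem_cent hvy, hy.conj a ha (huy ▸ hau), hwv] at h1
  exact hu.ne_one (by simpa using h1)

/-- If some element outside `A` does not act on `A` as a transvection, then `A` has index `4`. -/
theorem MaxInverts.quotient_of_exceptional [Finite X] (h : MaxInverts t A)
    (hX : Nat.card X < 2 * numInvol X) [A.Normal] {x u : X} (hx : x ∉ A)
    (hxc : 2 * Nat.card (cent A x) ≠ Nat.card A) (hu : u ∉ A) (hux : (u : X ⧸ A) ≠ x)
    (y : X ⧸ A) : y = 1 ∨ y = x ∨ y = u ∨ y = x * u := by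
  by_contra! hc
  obtain ⟨y, rfl⟩ := QuotientGroup.mk_surjective y
  obtain ⟨hy1, hyx, hyu, hyxu⟩ := hc
  have hone : ∀ z : X, z ∉ A ↔ (z : X ⧸ A) ≠ 1 := fun z => (QuotientGroup.eq_one_iff z).not.symm
  have hsq := h.quotient_sq hX
  have hcomm := h.quotient_comm hX
  have hcan : ∀ a b c : X ⧸ A, a * b = c ↔ b = a * c := by
    intro a b c
    constructor
    · rintro rfl; rw [← mul_assoc, hsq, one_mul]
    · rintro rfl; rw [← mul_assoc, hsq, one_mul]
  rw [hone] at hx hu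
  have hhalf : ∀ z : X, (z : X ⧸ A) ≠ 1 → (z : X ⧸ A) ≠ x → 2 * Nat.card (cent A z) = Nat.card A :=
    fun z h1 h2 => h.half_of_exceptional hX ((hone x).2 hx) hxc ((hone z).2 h1) h2
  have hex : ∀ z : X, (z : X ⧸ A) ≠ 1 → (z : X ⧸ A) ≠ x → ∃ v, IsTransvection A z v :=
    fun z h1 h2 => h.exists_isTransvection hX (hhalf z h1 h2)
  have hxu1 : ((x * u : X) : X ⧸ A) ≠ 1 := fun hc => hux (by
    have := (hcan x u 1).1 hc
    rwa [mul_one] at this)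
  have hxux : ((x * u : X) : X ⧸ A) ≠ x := fun hc => hu (by
    have := (hcan x u x).1 hc
    rwa [hsq] at this)
  have huy1 : ((u * y : X) : X ⧸ A) ≠ 1 := fun hc => hyu (by
    have := (hcan u y 1).1 hc
    rwa [mul_one] at this)
  have huyx : ((u * y : X) : X ⧸ A) ≠ x := fun hc => hyxu (by
    have := (hcan u y x).1 hc
    rwa [hcomm u x] at this)
  have hyx1 : ((y * x : X) : X ⧸ A) ≠ 1 := fun hc => hyx (by
    have := (hcan y x 1).1 hc
    rw [mul_one] at this
    exact this.symm)
  have hyxx : ((y * x : X) : X ⧸ A) ≠ x := fun hc => hy1 (by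
    have h1 : (y : X ⧸ A) * x = x := hc
    simpa using h1)
  have e1 : ((x * u * y : X) : X ⧸ A) = x * (u * y) := by
    rw [QuotientGroup.mk_mul, QuotientGroup.mk_mul, mul_assoc]
  have e2 : ((y * u : X) : X ⧸ A) = u * y := by
    rw [QuotientGroup.mk_mul, hcomm]
  have e3 : ((y * (x * u) : X) : X ⧸ A) = x * (u * y) := by
    rw [QuotientGroup.mk_mul, QuotientGroup.mk_mul, hcomm, mul_assoc]
  have hxuy1 : (x : X ⧸ A) * (u * y) ≠ 1 := fun hc => huyx (by
    have := (hcan _ _ _).1 hc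
    rw [mul_one] at this
    exact this)
  have hxuyx : (x : X ⧸ A) * (u * y) ≠ x := fun hc => huy1 (by
    have := (hcan _ _ _).1 hc
    rw [hsq] at this
    exact this)
  obtain ⟨v, hv⟩ := hex u hu hux
  obtain ⟨v', hv'⟩ := hex (x * u) hxu1 hxux
  obtain ⟨w, hw⟩ := hex y hy1 hyx
  obtain ⟨w₁, hw₁⟩ := hex (u * y) huy1 huyx
  obtain ⟨w₂, hw₂⟩ := hex (x * u * y) (e1 ▸ hxuy1) (e1 ▸ hxuyx)
  obtain ⟨hne, hvne⟩ := h.cent_ne_of_exceptional hX ((hone x).2 hx) hxc ((hone u).2 hu) hux hv hv'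
  have key : ∀ p q : X, (q : X ⧸ A) * p = y * x →
      ∀ a b, IsTransvection A p a → IsTransvection A q b → cent A p = cent A q ∨ a = b := by
    intro p q hpq a b ha hb
    obtain ⟨c, hc⟩ := hex (p * q) (by
      rw [QuotientGroup.mk_mul, hcomm, hpq]; exact hyx1) (by
      rw [QuotientGroup.mk_mul, hcomm, hpq]; exact hyxx)
    exact ha.mul hb hc
  -- A fifth coset yA shares an axis or a center with u, and likewise with x * u. Two axes or two
  -- centers would identify those of u and x * u; the mixed cases are excluded by
  -- `IsTransvection.not_crossing`.
  rcases hv.mul hw hw₁ with h1 | h1 <;> rcases hv'.mul hw hw₂ with h2 | h2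
  · exact hne (h1.trans h2.symm)
  · subst h2
    refine hv.not_crossing hw hne h1 (hhalf _ (e2 ▸ huy1) (e2 ▸ huyx)) (fun z hz => ?_)
      (hex _ (e2 ▸ huy1) (e2 ▸ huyx))
    refine key _ _ ?_ z _ hz hv'
    rw [QuotientGroup.mk_mul, QuotientGroup.mk_mul, hcomm y u, mul_assoc, ← mul_assoc (u : X ⧸ A),
      hsq, one_mul, hcomm]
  · subst h1
    refine hv'.not_crossing hw hne.symm h2 (hhalf _ (e3 ▸ hxuy1) (e3 ▸ hxuyx)) (fun z hz => ?_)
      (hex _ (e3 ▸ hxuy1) (e3 ▸ hxuyx))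
    refine key _ _ ?_ z _ hz hv
    rw [QuotientGroup.mk_mul, QuotientGroup.mk_mul, hcomm (x : X ⧸ A) u, ← mul_assoc,
      hcomm (u : X ⧸ A), mul_assoc (y : X ⧸ A), ← mul_assoc (u : X ⧸ A), hcomm (u : X ⧸ A) u,
      mul_assoc, ← mul_assoc (u : X ⧸ A), hsq, one_mul]
  · exact hvne (h1.trans h2.symm)

end Transvections
end CyclicRatio

/-! ### Exchanging A, and the case of a common center -/

namespace CyclicRatio

section Cases

variable {X : Type*} [Group X] {t : X} {A : Subgroup X}

/-- Every element outside `A` acts on `A` as a transvection exactly when the number of involutions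
is as large as possible. -/
theorem MaxInverts.all_half_iff [Finite X] (h : MaxInverts t A)
    (hX : Nat.card X < 2 * numInvol X) :
    (∀ x ∉ A, 2 * Nat.card (cent A x) = Nat.card A) ↔
      2 * numInvol X = Nat.card X + Nat.card A := by
  classical
  have : Fintype (X ⧸ A) := Fintype.ofFinite _
  have h2 := Finset.add_sum_erase Finset.univ
    (fun c => (Nat.card A : ℤ) - 2 * cosetCount t A c) (Finset.mem_univ ((1 : X) : X ⧸ A))
  have h4 : ∑ c : X ⧸ A, ((Nat.card A : ℤ) - 2 * cosetCount t A c) =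
      Nat.card X - 2 * numInvol X := by
    rw [Finset.sum_sub_distrib, ← Finset.mul_sum, Finset.sum_const, card_eq_mul (A := A),
      Finset.card_univ, nsmul_eq_mul, ← Nat.cast_sum, h.toInverts.sum_cosetCount, Nat.cast_mul]
  rw [cosetCount_one h.toInverts, h4] at h2
  have h5 : (∑ c ∈ Finset.univ.erase ((1 : X) : X ⧸ A),
      ((Nat.card A : ℤ) - 2 * cosetCount t A c) = 0) ↔
      2 * numInvol X = Nat.card X + Nat.card A := by omega
  rw [← h5, Finset.sum_eq_zero_iff_of_nonneg]
  · constructor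
    · intro hx c hc
      obtain ⟨x, rfl⟩ := QuotientGroup.mk_surjective c
      have hxA : x ∉ A := fun hxA => Finset.ne_of_mem_erase hc (by
        rw [eq_comm, QuotientGroup.eq]; simpa using hxA)
      obtain ⟨a, ha, hs⟩ := h.exists_eq hX x
      have h6 := hx x hxA
      rw [← QuotientGroup.mk_mul_of_mem x ha, h.toInverts.cosetCount_eq hs, h.cent_mul_right ha]
      omega
    · intro hc x hx
      obtain ⟨a, ha, hs⟩ := h.exists_eq hX x
      have h6 := hc (x : X ⧸ A) (Finset.mem_erase.2 ⟨fun h' => hx (by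
        rw [eq_comm, QuotientGroup.eq] at h'; simpa using h'), Finset.mem_univ _⟩)
      rw [← QuotientGroup.mk_mul_of_mem x ha, h.toInverts.cosetCount_eq hs,
        h.cent_mul_right ha] at h6
      omega
  · intro c hc
    have := h.two_mul_cosetCount_le (Finset.ne_of_mem_erase hc)
    omega

/-- Exchanging `A` for `C_A(x) ⟨x⟩`. -/
def exchangeWith (A : Subgroup X) (x : X) : Subgroup X :=
  Subgroup.closure ((cent A x : Set X) ∪ {x})

theorem cent_le_exchangeWith (A : Subgroup X) (x : X) : cent A x ≤ exchangeWith A x :=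
  fun _ ha => Subgroup.subset_closure (Or.inl ha)

theorem mem_exchangeWith (A : Subgroup X) (x : X) : x ∈ exchangeWith A x :=
  Subgroup.subset_closure (Or.inr rfl)

theorem Inverts.exchange {u : X} {x : X} (h : Inverts u (cent A x)) (hx : u * x * u = x⁻¹) :
    Inverts u (exchangeWith A x) :=
  h.closure_union (s := {x}) (by simpa using hx) (by simp)
    (fun b hb y hy => by rw [Set.mem_singleton_iff.1 hy]; exact (mem_cent.1 hb).2)

/-- The exchanged subgroup properly contains C_A(x), hence has order at least |A|, and maximality
gives equality. As `MaxInverts.all_half_iff` sees only the order of A, whether all centralizers have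
index two carries over. -/
theorem MaxInverts.exchange_of_inverts [Finite X] (h : MaxInverts t A) {u x : X} (hxA : x ∉ A)
    (hc : 2 * Nat.card (cent A x) = Nat.card A) (hu : Inverts u (exchangeWith A x)) :
    MaxInverts u (exchangeWith A x) ∧ Nat.card (exchangeWith A x) = Nat.card A := by
  have h1 := h.max _ _ hu
  have h2 := two_mul_card_le_of_mem (cent_le_exchangeWith A x) (mem_exchangeWith A x)
    fun h' => hxA (cent_le A x h')
  have h3 : Nat.card (exchangeWith A x) = Nat.card A := by omega
  exact ⟨⟨hu, fun v B hB => h3 ▸ h.max v B hB⟩, h3⟩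

theorem MaxInverts.exchange [Finite X] (h : MaxInverts t A) {x : X} (hx : t * x * t = x⁻¹)
    (hxA : x ∉ A) (hc : 2 * Nat.card (cent A x) = Nat.card A) :
    MaxInverts t (exchangeWith A x) ∧ Nat.card (exchangeWith A x) = Nat.card A :=
  h.exchange_of_inverts hxA hc ((h.toInverts.mono (cent_le A x)).exchange hx)

/-- If t lies in A, it both inverts and centralizes A, so A is elementary abelian and is inverted by
1. Otherwise the same happens for C_A(t)⟨t⟩, which t centralizes. -/
theorem MaxInverts.exists_one [Finite X] (h : MaxInverts t A)
    (ht : t ∉ A → 2 * Nat.card (cent A t) = Nat.card A) :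
    ∃ B : Subgroup X, MaxInverts 1 B ∧ Nat.card B = Nat.card A := by
  have hone : ∀ B : Subgroup X, (∀ b ∈ B, t * b * t = b⁻¹) → (∀ b ∈ B, b * t = t * b) →
      Inverts 1 B := fun B h1 h2 => ⟨one_mul 1, fun b hb => by
    rw [one_mul, mul_one, ← h1 b hb, ← h2 b hb, mul_assoc, h.sq, mul_one]⟩
  by_cases htA : t ∈ A
  · exact ⟨A, ⟨hone A h.conj fun b hb => h.comm hb htA, h.max⟩, rfl⟩
  · have h1 : Inverts 1 (exchangeWith A t) := by
      refine (hone _ (fun b hb => h.conj b (cent_le A t hb)) fun b hb => (mem_cent.1 hb).2).exchange ?_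
      rw [one_mul, mul_one, h.inv_eq]
    exact ⟨_, h.exchange_of_inverts htA (ht htA) h1⟩

theorem exists_independent [Finite X] (hA : 2 * Nat.card A < Nat.card X) :
    ∃ x y, x ∉ A ∧ y ∉ A ∧ x * y ∉ A := by
  have hpos : 0 < Nat.card A := Nat.card_pos
  by_contra! hc
  have h1 : A.index ∣ 2 := by
    rw [Subgroup.index_dvd_two_iff]
    by_cases hA : ∃ x, x ∉ A
    · obtain ⟨x, hx⟩ := hA
      exact ⟨x, fun b => or_iff_not_imp_right.2 fun hb => hc b x hb hx⟩
    · push Not at hA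
      exact ⟨1, fun b => Or.inr (hA b)⟩
  have h2 := A.index_mul_card
  have h3 := Nat.mul_le_mul_right (Nat.card A) (Nat.le_of_dvd two_pos h1)
  omega

/-- B, p and q would generate a subgroup inverted by u containing the four cosets of 1, p, q and p *
q, of order at least 4|B| > |A|. -/
theorem MaxInverts.four_cosets [Finite X] (h : MaxInverts t A) {B : Subgroup X}
    (hcard : 2 * Nat.card B = Nat.card A) {u p q : X} (hu : Inverts u B)
    (hp : u * p * u = p⁻¹) (hq : u * q * u = q⁻¹) (hpq : p * q = q * p)
    (hpB : ∀ b ∈ B, b * p = p * b) (hqB : ∀ b ∈ B, b * q = q * b)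
    (hpA : p ∉ B) (hqA : q ∉ B) (hpqA : p⁻¹ * q ∉ B) (hpqA' : p * q ∉ B) : False := by
  have h1 := h.max u _ (hu.closure_union (s := {p, q}) (by rintro x (rfl | rfl) <;> assumption)
    (by rintro x (rfl | rfl) y (rfl | rfl) <;> simp [hpq])
    (by rintro b hb x (rfl | rfl); exacts [hpB b hb, hqB b hb]))
  have hp' : p ∈ Subgroup.closure ((B : Set X) ∪ {p, q}) := Subgroup.subset_closure (by simp)
  have hq' : q ∈ Subgroup.closure ((B : Set X) ∪ {p, q}) := Subgroup.subset_closure (by simp)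
  have h2 := mul_card_le (B := B) (M := Subgroup.closure ((B : Set X) ∪ {p, q}))
    (fun b hb => Subgroup.subset_closure (Or.inl hb)) ![1, p, q, p * q] (by
      intro i; fin_cases i
      · exact Subgroup.one_mem _
      · exact hp'
      · exact hq'
      · exact Subgroup.mul_mem _ hp' hq') (by
      intro i j hij
      fin_cases i <;> fin_cases j <;> simp at hij ⊢ <;> try assumption
      rw [hpq, inv_mul_cancel_left]; exact hpA)
  have hpos : 0 < Nat.card B := Nat.card_pos
  omega

/-- The elements outside `A` cannot all have the same centralizer in `A`. -/
theorem MaxInverts.not_same_axis [Finite X] (h : MaxInverts 1 A)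
    (hX : Nat.card X < 2 * numInvol X) (hA : 2 * Nat.card A < Nat.card X)
    (hall : ∀ x ∉ A, 2 * Nat.card (cent A x) = Nat.card A) :
    ¬ ∀ x ∉ A, ∀ y ∉ A, cent A x = cent A y := by
  intro hax
  have hn := h.normal hX
  have hsq : ∀ x : X, 1 * x * 1 = x⁻¹ → x * x = 1 := fun x hx => by
    rw [one_mul, mul_one] at hx
    exact mul_eq_one_iff_eq_inv.2 hx
  have hsq' : ∀ x : X, x * x = 1 → 1 * x * 1 = x⁻¹ := fun x hx => by
    rw [one_mul, mul_one]
    exact mul_eq_one_iff_eq_inv.1 hx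
  obtain ⟨x₀, y₀, hx₀, hy₀, hxy₀⟩ := exists_independent hA
  obtain ⟨a₀, ha₀, hx'⟩ := h.exists_eq hX x₀
  obtain ⟨b₀, hb₀, hy'⟩ := h.exists_eq hX y₀
  obtain ⟨x, hx⟩ : ∃ x, x = x₀ * a₀ := ⟨_, rfl⟩
  obtain ⟨y, hy⟩ : ∃ y, y = y₀ * b₀ := ⟨_, rfl⟩
  rw [← hx] at hx'
  rw [← hy] at hy'
  have hxA : x ∉ A := fun hc => hx₀ (by rwa [hx, A.mul_mem_cancel_right ha₀] at hc)
  have hyA : y ∉ A := fun hc => hy₀ (by rwa [hy, A.mul_mem_cancel_right hb₀] at hc)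
  have hxyA : x * y ∉ A := fun hc => hxy₀ (by
    have h1 : x * y = x₀ * y₀ * (y₀⁻¹ * a₀ * y₀ * b₀) := by rw [hx, hy]; group
    rwa [h1, A.mul_mem_cancel_right] at hc
    refine A.mul_mem ?_ hb₀
    have := hn.conj_mem a₀ ha₀ y₀⁻¹
    rwa [inv_inv] at this)
  have hxx := hsq x hx'
  have hyy := hsq y hy'
  have hcent : ∀ b ∈ cent A x, ∀ z, b * z = z * b := by
    intro b hb z
    by_cases hz : z ∈ A
    · exact h.comm (cent_le A x hb) hz
    · rw [hax x hxA z hz] at hb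
      exact (mem_cent.1 hb).2
  have hBx : Inverts 1 (cent A x) := h.toInverts.mono (cent_le A x)
  have hnot : ∀ z, z ∉ A → z ∉ cent A x := fun z hz hc => hz (cent_le A x hc)
  have hxi := inv_eq_of_mul_eq_one_left hxx
  have hyi := inv_eq_of_mul_eq_one_left hyy
  -- A common axis C_A(x) is central in X. If x and y commuted, they would enlarge it beyond the
  -- maximal order.
  have hncomm : x * y ≠ y * x := fun hc =>
    h.four_cosets (hall x hxA) hBx hx' hy' hc (fun b hb => hcent b hb x)
      (fun b hb => hcent b hb y) (hnot _ hxA) (hnot _ hyA) (by rw [hxi]; exact hnot _ hxyA)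
      (hnot _ hxyA)
  obtain ⟨a, ha, hxya⟩ := h.exists_eq hX (x * y)
  have hxya := hsq _ hxya
  have haa := hsq a (h.conj a ha)
  have hai := inv_eq_of_mul_eq_one_left haa
  have hrev : x * y * a = a * (y * x) := by
    have := mul_eq_one_iff_eq_inv.1 hxya
    rw [mul_inv_rev, mul_inv_rev, hai, hxi, hyi] at this
    exact this
  have haB : a ∉ cent A x := fun hc => hncomm (by
    rw [← hcent a hc, mul_right_inj] at hrev
    exact hrev)
  obtain ⟨v, hv⟩ := h.exists_isTransvection hX (hall x hxA)
  obtain ⟨w, hw⟩ := h.exists_isTransvection hX (hall y hyA)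
  have hvc := hcent v hv.apply_self
  have hwc := hcent w (by rw [hax x hxA y hyA]; exact hw.apply_self)
  have hxa : x * a = v * a * x := by
    rw [← hv.conj a ha haB, inv_mul_cancel_right]
  have hya : y * a = w * a * y := by
    rw [← hw.conj a ha (by rw [← hax x hxA y hyA]; exact haB), inv_mul_cancel_right]
  -- The involution x * y * a forces the commutator of x and y to be w * v, the product of the
  -- commutators with a, and these cancel here.
  have hcomm : x * y * (y * a) = y * a * (x * y) := by
    have h1 : x * y * (y * a) = x * a := by
      rw [mul_assoc, ← mul_assoc y, hyy, one_mul]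
    have h2 : y * x = w * (v * (x * y)) := by
      refine mul_left_cancel (a := a) ?_
      calc a * (y * x) = x * (w * (a * y)) := by rw [← hrev, mul_assoc, hya, mul_assoc]
        _ = w * (x * a * y) := by rw [← mul_assoc x w, ← hwc x]; simp only [mul_assoc]
        _ = w * a * (v * (x * y)) := by rw [hxa, hvc a]; simp only [mul_assoc]
        _ = a * (w * (v * (x * y))) := by rw [hwc a, mul_assoc]
    calc x * y * (y * a) = v * a * x := by rw [h1, hxa]
      _ = w * (w * (v * a)) * x * (y * y) := by
        rw [← mul_assoc w w, hw.sq, hyy, one_mul, mul_one]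
      _ = w * a * (w * (v * (x * y))) * y := by
        have h3 : w * (w * (v * a)) = w * a * (w * v) := by
          rw [hvc a, mul_assoc w a, ← mul_assoc w a v, hwc a, mul_assoc a w]
        rw [h3]; simp only [mul_assoc]
      _ = y * a * (x * y) := by rw [← h2, hya]; simp only [mul_assoc]
  -- The involution y now plays the role of t: it inverts C_A(x), x * y and y * a.
  refine h.four_cosets (u := y) (p := x * y) (q := y * a) (hall x hxA)
    ⟨hyy, fun b hb => ?_⟩ ?_ ?_ hcomm (fun b hb => hcent b hb _) (fun b hb => hcent b hb _)
    (hnot _ hxyA) (hnot _ ?_) (hnot _ ?_) (hnot _ ?_)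
  · rw [← hcent b hb y, mul_assoc, hyy, mul_one, eq_inv_iff_mul_eq_one]
    exact hsq b (h.conj b (cent_le A x hb))
  · rw [mul_inv_rev, hxi, hyi, mul_assoc, mul_assoc, hyy, mul_one]
  · rw [mul_inv_rev, hai, hyi, ← mul_assoc, hyy, one_mul]
  · rwa [A.mul_mem_cancel_right ha]
  · intro hc
    have h1 := hn.conj_mem _ ((A.mul_mem_cancel_right ha).1 (by rwa [← mul_assoc] at hc)) y
    refine hxA ((A.inv_mem_iff).1 ?_)
    have h2 : y * ((x * y)⁻¹ * y) * y⁻¹ = x⁻¹ := by group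
    rwa [h2] at h1
  · rw [mul_assoc, ← mul_assoc y, hyy, one_mul, A.mul_mem_cancel_right ha]
    exact hxA

/-- All squares and commutators lie in the central subgroup `{1, v}`. -/
structure IsExtraspecial (v : X) : Prop where
  ne_one : v ≠ 1
  sq : v * v = 1
  central : ∀ z, v * z = z * v
  conj : ∀ g z : X, g * z * g⁻¹ = z ∨ g * z * g⁻¹ = v * z

/-- With a common axis excluded, all transvections have one center v, which is central, and
commutators with elements of A lie in {1, v}. For an inverted x outside A, exchange A for C_A(x)⟨x⟩,
which contains x. The center obtained there is again v, as an element of C_A(x) moved by some y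
outside A shows. Any z is an inverted element times an element of A. -/
theorem MaxInverts.isExtraspecial [Finite X] (h : MaxInverts 1 A)
    (hX : Nat.card X < 2 * numInvol X) (hA : 2 * Nat.card A < Nat.card X)
    (hall : ∀ x ∉ A, 2 * Nat.card (cent A x) = Nat.card A) :
    ∃ v : X, IsExtraspecial v := by
  have hn := h.normal hX
  have hnot := h.not_same_axis hX hA hall
  obtain ⟨v, hv⟩ := (h.same_axis_or_center hX hall).resolve_left hnot
  obtain ⟨x₀, -, hx₀, -, -⟩ := exists_independent hA
  have hcen : ∀ z, v * z = z * v := by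
    intro z
    by_cases hz : z ∈ A
    · exact h.comm (hv _ hx₀).mem hz
    · exact (mem_cent.1 (hv z hz).apply_self).2
  have hconjA : ∀ g, ∀ a ∈ A, g * a * g⁻¹ = a ∨ g * a * g⁻¹ = v * a := by
    intro g a ha
    by_cases hg : g ∈ A
    · exact Or.inl (by rw [h.comm hg ha, mul_inv_cancel_right])
    · exact (hv g hg).conj_or ha
  have hconjS : ∀ g s, 1 * s * 1 = s⁻¹ → g * s * g⁻¹ = s ∨ g * s * g⁻¹ = v * s := by
    intro g x hx
    by_cases hxA : x ∈ A
    · exact hconjA g x hxA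
    obtain ⟨hM, hcard⟩ := h.exchange hx hxA (hall x hxA)
    have hall' := (hM.all_half_iff hX).2 (by rw [hcard]; exact (h.all_half_iff hX).1 hall)
    obtain ⟨w, hw⟩ := (hM.same_axis_or_center hX hall').resolve_left
      (hM.not_same_axis hX (by omega) hall')
    obtain ⟨y, hy, hxy⟩ : ∃ y ∉ A, cent A x ≠ cent A y := by
      by_contra! hc
      exact hnot fun z hz y hy => (hc z hz).symm.trans (hc y hy)
    have hxyc : Nat.card (cent A x) = Nat.card (cent A y) := by
      have := hall x hxA
      have := hall y hy
      omega
    obtain ⟨b, hbx, hby⟩ := exists_mem_notMem_of_ne hxyc hxy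
    have hbA := cent_le A x hbx
    have hbE := cent_le_exchangeWith A x hbx
    have hyE : y ∉ exchangeWith A x := fun hc => hby (mem_cent.2 ⟨hbA, hM.comm hbE hc⟩)
    have hbE' : b ∉ cent (exchangeWith A x) y := fun hc => hby (mem_cent.2 ⟨hbA, (mem_cent.1 hc).2⟩)
    have hvw : v = w := by
      have h1 := (hv y hy).conj b hbA hby
      rw [(hw y hyE).conj b hbE hbE'] at h1
      exact (mul_right_cancel h1).symm
    by_cases hg : g ∈ exchangeWith A x
    · exact Or.inl (by rw [hM.comm hg (mem_exchangeWith A x), mul_inv_cancel_right])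
    · rw [hvw]
      exact (hw g hg).conj_or (mem_exchangeWith A x)
  refine ⟨v, (hv _ hx₀).ne_one, (hv _ hx₀).sq, hcen, fun g z => ?_⟩
  obtain ⟨a, ha, hza⟩ := h.exists_eq hX z
  have h1 : g * z * g⁻¹ = g * (z * a) * g⁻¹ * (g * a * g⁻¹)⁻¹ := by group
  have hvi := inv_eq_of_mul_eq_one_left (hv _ hx₀).sq
  rw [h1]
  rcases hconjS g _ hza with h2 | h2 <;> rcases hconjA g a ha with h3 | h3 <;> rw [h2, h3]
  · left; group
  · right
    rw [mul_inv_rev, hvi, ← mul_assoc, mul_inv_cancel_right, hcen]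
  · right; group
  · left
    rw [mul_inv_rev, hvi, hcen]
    calc z * a * v * (a⁻¹ * v) = z * a * (v * a⁻¹) * v := by group
      _ = z * (v * v) := by rw [hcen]; group
      _ = z := by rw [(hv _ hx₀).sq, mul_one]

end Cases
end CyclicRatio

/-! ### The exceptional case: two commuting dihedral groups -/

namespace CyclicRatio

section Families

variable {X : Type*} [Group X] {t : X} {A : Subgroup X}

/-- Commuting pairs of involutions, each generating a dihedral group of order `8` with centre
generated by `v i`, which together with an elementary abelian centre generate the group. -/
structure DihedralFamily {r : ℕ} (d e v : Fin r → X) : Prop where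
  d_sq : ∀ i, d i * d i = 1
  e_sq : ∀ i, e i * e i = 1
  v_sq : ∀ i, v i * v i = 1
  v_ne : ∀ i, v i ≠ 1
  v_central : ∀ i z, v i * z = z * v i
  rel : ∀ i, e i * d i = v i * (d i * e i)
  comm : ∀ i j, i ≠ j → Commute (d i) (d j) ∧ Commute (d i) (e j) ∧ Commute (e i) (e j)
  gen : ∀ H : Subgroup X, Subgroup.center X ≤ H → (∀ i, d i ∈ H ∧ e i ∈ H) → H = ⊤
  center_sq : ∀ z ∈ Subgroup.center X, z * z = 1

theorem MaxInverts.center_sq [Finite X] (h : MaxInverts t A)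
    (hX : Nat.card X < 2 * numInvol X) {z : X} (hz : z ∈ Subgroup.center X) : z * z = 1 := by
  rw [Subgroup.mem_center_iff] at hz
  have hzA := h.mem_of_commute' hX fun a _ => hz a
  have h1 := h.conj z hzA
  rw [hz t, mul_assoc, h.sq, mul_one] at h1
  exact mul_eq_one_iff_eq_inv.2 h1

/-- Two elements with commutator `v`, both inverted by conjugation with one of the products `P` of
them: either they can be replaced by two involutions, or they generate a quaternion group. -/
theorem exists_involutions {a y v P : X} (hv : v * v = 1) (hvc : ∀ z, v * z = z * v)
    (hya : y * a = v * (a * y)) (hP : P = 1 ∨ P = a ∨ P = y ∨ P = y * a)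
    (hPa : P * a * P⁻¹ = a⁻¹) (hPy : P * y * P⁻¹ = y⁻¹) :
    (P * P = 1 ∧ ∃ d e : X, d * d = 1 ∧ e * e = 1 ∧ e * d = v * (d * e) ∧
      ∀ H : Subgroup X, d ∈ H ∧ e ∈ H ↔ a ∈ H ∧ y ∈ H) ∨ P * P = v := by
  have hay : a * y = v * (y * a) := by rw [hya, ← mul_assoc, hv, one_mul]
  have hsq : ∀ z : X, z = z⁻¹ → z * z = 1 := fun z hz => mul_eq_one_iff_eq_inv.2 hz
  have hayay : a * y * (a * y) = v * (a * a * (y * y)) := by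
    calc a * y * (a * y) = a * (y * a) * y := by group
      _ = (a * v) * (a * y) * y := by rw [hya]; group
      _ = v * (a * a * (y * y)) := by rw [← hvc]; group
  -- Conjugation by P changes a and y only by powers of v, so equating it with inversion determines
  -- a² and y². For P = a one gets y² = v and takes the pair a, a * y; P = y is symmetric. For P = y
  -- * a both squares are v, the quaternion case.
  rcases hP with rfl | rfl | rfl | rfl
  · left
    simp only [one_mul, inv_one, mul_one] at hPa hPy
    exact ⟨one_mul 1, a, y, hsq a hPa, hsq y hPy, hya, fun H => Iff.rfl⟩
  · left
    have h1 : P * P = 1 := hsq P (by simpa using hPa)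
    have h2 : y * y = v := by
      rw [hay, ← mul_assoc, mul_inv_cancel_right] at hPy
      rw [eq_inv_iff_mul_eq_one, mul_assoc] at hPy
      rw [eq_comm, ← inv_eq_of_mul_eq_one_left hv]
      exact inv_eq_of_mul_eq_one_right hPy
    refine ⟨h1, P, P * y, h1, ?_, ?_, fun H => and_congr_right fun hH => H.mul_mem_cancel_left hH⟩
    · rw [hayay, h1, h2, one_mul, hv]
    · rw [mul_assoc, hya, ← mul_assoc, ← hvc, mul_assoc]
  · left
    have h1 : P * P = 1 := hsq P (by simpa using hPy)
    have h2 : a * a = v := by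
      rw [hya, ← mul_assoc, mul_inv_cancel_right] at hPa
      rw [eq_inv_iff_mul_eq_one, mul_assoc] at hPa
      rw [eq_comm, ← inv_eq_of_mul_eq_one_left hv]
      exact inv_eq_of_mul_eq_one_right hPa
    refine ⟨h1, a * P, P, ?_, h1, ?_, fun H => ?_⟩
    · rw [hayay, h1, h2, mul_one, hv]
    · rw [← mul_assoc, hya, mul_assoc]
    · constructor
      · rintro ⟨hH, hH'⟩
        exact ⟨(H.mul_mem_cancel_right hH').1 hH, hH'⟩
      · rintro ⟨hH, hH'⟩
        exact ⟨H.mul_mem hH hH', hH'⟩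
  · right
    have h1 : a * a = v := by
      have h3 : y * a * a * (y * a)⁻¹ = v * a := by
        have h4 : y * a * a * (y * a)⁻¹ = y * a * y⁻¹ := by group
        rw [h4, hya]; group
      rw [h3, eq_inv_iff_mul_eq_one, mul_assoc] at hPa
      rw [eq_comm, ← inv_eq_of_mul_eq_one_left hv]
      exact inv_eq_of_mul_eq_one_right hPa
    have h2 : y * y = v := by
      have h3 : y * a * y * (y * a)⁻¹ = v * y := by
        rw [mul_assoc y a y, hay, hvc y]; group
      rw [h3, eq_inv_iff_mul_eq_one, mul_assoc] at hPy
      rw [eq_comm, ← inv_eq_of_mul_eq_one_left hv]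
      exact inv_eq_of_mul_eq_one_right hPy
    calc y * a * (y * a) = y * (a * y) * a := by group
      _ = y * v * (y * a) * a := by rw [hay]; group
      _ = v * (y * y * (a * a)) := by rw [← hvc]; group
      _ = v := by rw [h1, h2, hv, mul_one]

/-- Two elements outside `A` generating `X` modulo `A`, whose product is exceptional. -/
structure ExceptionalData (t : X) (A : Subgroup X) (x₁ x₂ a₁ a₂ v₁ v₂ : X) : Prop where
  x₁_conj : t * x₁ * t = x₁⁻¹
  x₂_conj : t * x₂ * t = x₂⁻¹
  x₁_notMem : x₁ ∉ A
  x₂_notMem : x₂ ∉ A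
  tr₁ : IsTransvection A x₁ v₁
  tr₂ : IsTransvection A x₂ v₂
  ne : v₁ ≠ v₂
  a₁_mem : a₁ ∈ cent A x₂
  a₁_notMem : a₁ ∉ cent A x₁
  a₂_mem : a₂ ∈ cent A x₁
  a₂_notMem : a₂ ∉ cent A x₂
  gen : ∀ g : X, ∃ p, (p = 1 ∨ p = x₁ ∨ p = x₂ ∨ p = x₁ * x₂) ∧ ∃ a ∈ A, g = p * a

/-- For exceptional x and any u outside A ∪ xA, the elements x₁ and x₂ are inverted representatives
of uA and xuA. Their axes are different subgroups of the same order, which provides a₁ and a₂. -/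
theorem MaxInverts.exists_exceptionalData [Finite X] (h : MaxInverts t A)
    (hX : Nat.card X < 2 * numInvol X) (hA : 2 * Nat.card A < Nat.card X)
    (hex : ¬ ∀ x ∉ A, 2 * Nat.card (cent A x) = Nat.card A) :
    ∃ x₁ x₂ a₁ a₂ v₁ v₂, ExceptionalData t A x₁ x₂ a₁ a₂ v₁ v₂ := by
  have hn := h.normal hX
  push Not at hex
  obtain ⟨x, hx, hxc⟩ := hex
  obtain ⟨u, hu, hux⟩ : ∃ u, u ∉ A ∧ (u : X ⧸ A) ≠ x := by
    obtain ⟨p, q, hp, hq, hpq⟩ := exists_independent hA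
    by_cases hpx : (p : X ⧸ A) = x
    · refine ⟨q, hq, fun hqx => hpq ?_⟩
      rw [h.mul_mem_iff hX, hpx, hqx]
    · exact ⟨p, hp, hpx⟩
  obtain ⟨a, ha, hua⟩ := h.exists_eq hX u
  obtain ⟨b, hb, hxub⟩ := h.exists_eq hX (x * u)
  have hxu : x * u ∉ A := fun hc => hux ((h.mul_mem_iff hX x u).1 hc).symm
  obtain ⟨-, hc₁, hc₂⟩ := h.exceptional hX hx hu hxu hxc
  obtain ⟨v₁, hv₁⟩ := h.exists_isTransvection hX hc₁
  obtain ⟨v₂, hv₂⟩ := h.exists_isTransvection hX hc₂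
  obtain ⟨hne, hvne⟩ := h.cent_ne_of_exceptional hX hx hxc hu hux hv₁ hv₂
  obtain ⟨a₂, ha₂, ha₂'⟩ := exists_mem_notMem_of_ne (by omega) hne
  obtain ⟨a₁, ha₁, ha₁'⟩ := exists_mem_notMem_of_ne (by omega) hne.symm
  have hsq := h.quotient_sq hX
  have hcomm := h.quotient_comm hX
  have hnm : ∀ z c : X, c ∈ A → z ∉ A → z * c ∉ A := fun z c hc hz hzc =>
    hz ((A.mul_mem_cancel_right hc).1 hzc)
  have hcongr : ∀ z c : X, c ∈ A → z * (z * c) ∈ A := fun z c hc => by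
    rw [← mul_assoc]
    exact A.mul_mem (h.mul_self_mem_normal hX z) hc
  have hq₁ : ((u * a : X) : X ⧸ A) = u := QuotientGroup.mk_mul_of_mem u ha
  have hq₂ : ((x * u * b : X) : X ⧸ A) = x * u := QuotientGroup.mk_mul_of_mem (x * u) hb
  refine ⟨u * a, x * u * b, a₁, a₂, v₁, v₂, hua, hxub, hnm _ _ ha hu, hnm _ _ hb hxu,
    h.isTransvection_congr hX (hcongr _ _ ha) hv₁, h.isTransvection_congr hX (hcongr _ _ hb) hv₂,
    hvne, ?_, ?_, ?_, ?_, fun g => ?_⟩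
  · rwa [h.cent_mul_right hb]
  · rwa [h.cent_mul_right ha]
  · rwa [h.cent_mul_right ha]
  · rwa [h.cent_mul_right hb]
  · have key : ∀ p : X, (g : X ⧸ A) = p → ∃ a ∈ A, g = p * a := fun p hp =>
      ⟨p⁻¹ * g, QuotientGroup.eq.1 hp.symm, by group⟩
    rcases h.quotient_of_exceptional hX hx hxc hu hux g with h1 | h1 | h1 | h1
    · exact ⟨_, Or.inl rfl, key 1 h1⟩
    · refine ⟨_, Or.inr (Or.inr (Or.inr rfl)), key _ ?_⟩
      rw [QuotientGroup.mk_mul, hq₁, hq₂, h1, hcomm (u : X ⧸ A), mul_assoc, hsq, mul_one]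
    · exact ⟨_, Or.inr (Or.inl rfl), key _ (h1.trans hq₁.symm)⟩
    · exact ⟨_, Or.inr (Or.inr (Or.inl rfl)), key _ (h1.trans hq₂.symm)⟩

section Exceptional

variable {x₁ x₂ a₁ a₂ v₁ v₂ : X}

theorem ExceptionalData.symm [Finite X] (h : MaxInverts t A) (hX : Nat.card X < 2 * numInvol X)
    (D : ExceptionalData t A x₁ x₂ a₁ a₂ v₁ v₂) : ExceptionalData t A x₂ x₁ a₂ a₁ v₂ v₁ := by
  refine ⟨D.x₂_conj, D.x₁_conj, D.x₂_notMem, D.x₁_notMem, D.tr₂, D.tr₁, D.ne.symm, D.a₂_mem,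
    D.a₂_notMem, D.a₁_mem, D.a₁_notMem, fun g => ?_⟩
  obtain ⟨p, hp, a, ha, rfl⟩ := D.gen g
  rcases hp with rfl | rfl | rfl | rfl
  · exact ⟨1, by simp, a, ha, rfl⟩
  · exact ⟨_, Or.inr (Or.inr (Or.inl rfl)), a, ha, rfl⟩
  · exact ⟨_, Or.inr (Or.inl rfl), a, ha, rfl⟩
  · refine ⟨_, Or.inr (Or.inr (Or.inr rfl)), _,
      A.mul_mem (h.commutator_mem hX x₁⁻¹ x₂⁻¹) ha, ?_⟩
    group

theorem ExceptionalData.mem_center (h : Inverts t A) (D : ExceptionalData t A x₁ x₂ a₁ a₂ v₁ v₂)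
    {z : X} (h₁ : z ∈ cent A x₁) (h₂ : z ∈ cent A x₂) (g : X) : z * g = g * z := by
  obtain ⟨p, hp, a, ha, rfl⟩ := D.gen g
  have hza : Commute z a := h.comm (cent_le _ _ h₁) ha
  have hz₁ : Commute z x₁ := (mem_cent.1 h₁).2
  have hz₂ : Commute z x₂ := (mem_cent.1 h₂).2
  rcases hp with rfl | rfl | rfl | rfl
  · rw [one_mul, hza.eq]
  · exact hz₁.mul_right hza
  · exact hz₂.mul_right hza
  · exact (hz₁.mul_right hz₂).mul_right hza

/-- v₁ is the commutator of x₁ and a₁. Conjugation by x₂ fixes a₁ and multiplies x₁ by an element of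
the abelian group A, which does not change that commutator. -/
theorem ExceptionalData.v₁_mem [Finite X] (h : MaxInverts t A) (hX : Nat.card X < 2 * numInvol X)
    (D : ExceptionalData t A x₁ x₂ a₁ a₂ v₁ v₂) : v₁ ∈ cent A x₂ := by
  have hn := h.normal hX
  refine mem_cent_of_conj D.tr₁.mem ?_
  have ha₁ := cent_le _ _ D.a₁_mem
  have h1 := D.tr₁.conj a₁ ha₁ D.a₁_notMem
  have h2 : v₁ = x₁ * a₁ * x₁⁻¹ * a₁⁻¹ := by rw [h1, mul_inv_cancel_right]
  have h3 := h.commutator_mem hX x₂ x₁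
  have h4 := h.comm h3 (hn.conj_mem a₁ ha₁ x₁)
  have h5 : x₂ * (x₁ * a₁ * x₁⁻¹ * a₁⁻¹) * x₂⁻¹ =
      (x₂ * x₁ * x₂⁻¹ * x₁⁻¹) * (x₁ * (x₂ * a₁ * x₂⁻¹) * x₁⁻¹) * (x₂ * x₁ * x₂⁻¹ * x₁⁻¹)⁻¹ *
        (x₂ * a₁ * x₂⁻¹)⁻¹ := by group
  rw [conj_of_mem_cent D.a₁_mem, h4, mul_inv_cancel_right] at h5
  rw [h2]
  exact h5

theorem rel_mul_right {p q q' c c' : X} (hc' : ∀ z, c' * z = z * c') (h : p * q = c * (q * p))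
    (h' : p * q' = c' * (q' * p)) : p * (q * q') = c * c' * (q * q' * p) := by
  calc p * (q * q') = c * (q * (p * q')) := by rw [← mul_assoc, h]; group
    _ = c * (c' * q * (q' * p)) := by rw [h', hc' q]; group
    _ = c * c' * (q * q' * p) := by group

theorem rel_mul_left {p p' q c c' : X} (hc' : ∀ z, c' * z = z * c') (h : p * q = c * (q * p))
    (h' : p' * q = c' * (q * p')) : p * p' * q = c * c' * (q * (p * p')) := by
  calc p * p' * q = c' * (p * q) * p' := by rw [mul_assoc, h', ← mul_assoc, ← hc' p]; group
    _ = c * c' * (q * (p * p')) := by rw [h, ← mul_assoc c', hc' c]; group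

theorem ExceptionalData.v₁_central [Finite X] (h : MaxInverts t A)
    (hX : Nat.card X < 2 * numInvol X) (D : ExceptionalData t A x₁ x₂ a₁ a₂ v₁ v₂) (z : X) :
    v₁ * z = z * v₁ :=
  D.mem_center h.toInverts D.tr₁.apply_self (D.v₁_mem h hX) z

theorem ExceptionalData.rel [Finite X] (D : ExceptionalData t A x₁ x₂ a₁ a₂ v₁ v₂) :
    x₁ * a₁ = v₁ * (a₁ * x₁) := by
  rw [← mul_assoc, ← D.tr₁.conj a₁ (cent_le _ _ D.a₁_mem) D.a₁_notMem, inv_mul_cancel_right]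

/-- Exchange A for E = C_A(x₁)⟨x₁⟩, which contains x₁ and a₂. One of x₂, a₁ * x₂ avoids the
exceptional coset of E, so it acts on E as a transvection; its value at a₂ shows that the center is
v₂. So it changes x₁ at most by v₂, and a₁ accounts for a further v₁. -/
theorem ExceptionalData.commutator [Finite X] (h : MaxInverts t A)
    (hX : Nat.card X < 2 * numInvol X)
    (hex : ¬ ∀ x ∉ A, 2 * Nat.card (cent A x) = Nat.card A)
    (D : ExceptionalData t A x₁ x₂ a₁ a₂ v₁ v₂) :
    ∃ c, (c = 1 ∨ c = v₁ ∨ c = v₂ ∨ c = v₁ * v₂) ∧ x₂ * x₁ = c * (x₁ * x₂) := by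
  obtain ⟨hM, hcard⟩ := h.exchange D.x₁_conj D.x₁_notMem D.tr₁.half
  have hex' := mt (hM.all_half_iff hX).1 (by rw [hcard]; exact mt (h.all_half_iff hX).2 hex)
  push Not at hex'
  obtain ⟨z, hz, hzc⟩ := hex'
  have hnE := hM.normal hX
  have hv₂ := (D.symm h hX).v₁_central h hX
  have ha₁A := cent_le _ _ D.a₁_mem
  have ha₂E := cent_le_exchangeWith A x₁ D.a₂_mem
  have ha₂A := cent_le _ _ D.a₂_mem
  have ha₁₂ := h.comm ha₁A ha₂A
  have h22 := D.tr₂.conj a₂ ha₂A D.a₂_notMem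
  have hx₂E : x₂ ∉ exchangeWith A x₁ := fun hc =>
    D.a₂_notMem (mem_cent.2 ⟨ha₂A, hM.comm ha₂E hc⟩)
  have ha₁E : a₁ ∉ exchangeWith A x₁ := fun hc =>
    D.a₁_notMem (mem_cent.2 ⟨ha₁A, hM.comm hc (mem_exchangeWith A x₁)⟩)
  have hax₂ : a₁ * x₂ * a₂ * (a₁ * x₂)⁻¹ = v₂ * a₂ := by
    have : a₁ * x₂ * a₂ * (a₁ * x₂)⁻¹ = a₁ * (x₂ * a₂ * x₂⁻¹) * a₁⁻¹ := by group
    rw [this, h22, ← mul_assoc, ← hv₂, mul_assoc v₂, ha₁₂]; group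
  have hax₂E : a₁ * x₂ ∉ exchangeWith A x₁ := fun hc => by
    have h1 := hM.comm hc ha₂E
    rw [h1, mul_inv_cancel_right, right_eq_mul] at hax₂
    exact D.tr₂.ne_one hax₂
  have key : ∀ y : X, y ∉ exchangeWith A x₁ → y * a₂ * y⁻¹ = v₂ * a₂ →
      (y : X ⧸ exchangeWith A x₁) ≠ z → y * x₁ * y⁻¹ = x₁ ∨ y * x₁ * y⁻¹ = v₂ * x₁ := by
    intro y hy hya hyz
    obtain ⟨w, hw⟩ := hM.exists_isTransvection hX (hM.half_of_exceptional hX hz hzc hy hyz)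
    have hwv : w = v₂ := by
      rcases hw.conj_or ha₂E with h1 | h1
      · rw [h1, right_eq_mul] at hya
        exact absurd hya D.tr₂.ne_one
      · rw [h1] at hya
        exact mul_right_cancel hya
    rw [← hwv]
    exact hw.conj_or (mem_exchangeWith A x₁)
  by_cases hxz : (x₂ : X ⧸ exchangeWith A x₁) = z
  · have haz : ((a₁ * x₂ : X) : X ⧸ exchangeWith A x₁) ≠ z := by
      rw [← hxz, QuotientGroup.mk_mul]
      intro hc
      rw [mul_eq_right] at hc
      exact ha₁E ((QuotientGroup.eq_one_iff a₁).1 hc)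
    have h1 : x₂ * x₁ = a₁⁻¹ * (a₁ * x₂ * x₁ * (a₁ * x₂)⁻¹) * a₁ * x₂ := by group
    have h2 : a₁⁻¹ * x₁ * a₁ = v₁ * x₁ := by
      rw [mul_assoc, D.rel, D.v₁_central h hX, ← mul_assoc, inv_mul_cancel_left,
        D.v₁_central h hX]
    rcases key _ hax₂E hax₂ haz with h3 | h3
    · exact ⟨v₁, by simp, by rw [h1, h3, h2, mul_assoc]⟩
    · refine ⟨v₁ * v₂, by simp, ?_⟩
      have h4 : a₁⁻¹ * (v₂ * x₁) * a₁ = v₂ * (a₁⁻¹ * x₁ * a₁) := by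
        rw [← mul_assoc, ← hv₂]; group
      rw [h1, h3, h4, h2, ← mul_assoc v₂, hv₂ v₁]; group
  · rcases key x₂ hx₂E h22 hxz with h1 | h1
    · exact ⟨1, by simp, by rw [one_mul, ← mul_inv_eq_iff_eq_mul, h1]⟩
    · exact ⟨v₂, by simp, by rw [← mul_assoc, ← mul_inv_eq_iff_eq_mul, h1]⟩

theorem ExceptionalData.mul_right [Finite X] (h : MaxInverts t A)
    (hX : Nat.card X < 2 * numInvol X) (D : ExceptionalData t A x₁ x₂ a₁ a₂ v₁ v₂) {b : X}
    (hb : b ∈ cent A x₁) : ExceptionalData t A (x₁ * b) x₂ a₁ a₂ v₁ v₂ := by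
  have hn := h.normal hX
  have hbA := cent_le _ _ hb
  refine ⟨(h.conj_mul_iff D.x₁_conj hbA).2 hb, D.x₂_conj,
    fun hc => D.x₁_notMem ((A.mul_mem_cancel_right hbA).1 hc), D.x₂_notMem,
    h.isTransvection_congr hX ?_ D.tr₁, D.tr₂, D.ne, D.a₁_mem, ?_, ?_, D.a₂_notMem, fun g => ?_⟩
  · rw [← mul_assoc]
    exact A.mul_mem (h.mul_self_mem_normal hX x₁) hbA
  · rw [h.cent_mul_right hbA]; exact D.a₁_notMem
  · rw [h.cent_mul_right hbA]; exact D.a₂_mem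
  · obtain ⟨p, hp, a, ha, rfl⟩ := D.gen g
    rcases hp with rfl | rfl | rfl | rfl
    · exact ⟨1, by simp, a, ha, rfl⟩
    · exact ⟨_, Or.inr (Or.inl rfl), b⁻¹ * a, A.mul_mem (A.inv_mem hbA) ha, by group⟩
    · exact ⟨_, Or.inr (Or.inr (Or.inl rfl)), a, ha, rfl⟩
    · exact ⟨_, Or.inr (Or.inr (Or.inr rfl)), x₂⁻¹ * b⁻¹ * x₂⁻¹⁻¹ * a,
        A.mul_mem (hn.conj_mem _ (A.inv_mem hbA) _) ha, by group⟩

/-- The pairs can be adjusted so as to commute with each other. -/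
theorem ExceptionalData.exists_commuting [Finite X] (h : MaxInverts t A)
    (hX : Nat.card X < 2 * numInvol X)
    (hex : ¬ ∀ x ∉ A, 2 * Nat.card (cent A x) = Nat.card A)
    (D : ExceptionalData t A x₁ x₂ a₁ a₂ v₁ v₂) :
    ∃ y₁ y₂, ExceptionalData t A y₁ y₂ a₁ a₂ v₁ v₂ ∧ y₂ * y₁ = y₁ * y₂ := by
  -- Replacing x₁ by x₁ * a₂ changes the commutator by v₂, and replacing x₂ by x₂ * a₁ changes it by
  -- v₁.
  have key : ∀ y₁, ExceptionalData t A y₁ x₂ a₁ a₂ v₁ v₂ →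
      (x₂ * y₁ = 1 * (y₁ * x₂) ∨ x₂ * y₁ = v₁ * (y₁ * x₂)) →
      ∃ y₁ y₂, ExceptionalData t A y₁ y₂ a₁ a₂ v₁ v₂ ∧ y₂ * y₁ = y₁ * y₂ := by
    rintro y₁ D (h1 | h1)
    · exact ⟨y₁, x₂, D, by rw [h1, one_mul]⟩
    · refine ⟨y₁, x₂ * a₁, ((D.symm h hX).mul_right h hX D.a₁_mem).symm h hX, ?_⟩
      have h2 : a₁ * y₁ = v₁ * (y₁ * a₁) := by
        rw [D.rel, ← mul_assoc, D.tr₁.sq, one_mul]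
      rw [rel_mul_left (D.v₁_central h hX) h1 h2, D.tr₁.sq, one_mul]
  obtain ⟨c, hc, hcr⟩ := D.commutator h hX hex
  have h2 := (D.symm h hX).rel
  have h3 := rel_mul_right ((D.symm h hX).v₁_central h hX) hcr h2
  have h4 := D.mul_right h hX D.a₂_mem
  rcases hc with rfl | rfl | rfl | rfl
  · exact key _ D (Or.inl hcr)
  · exact key _ D (Or.inr hcr)
  · exact key _ h4 (Or.inl (by rw [h3, D.tr₂.sq]))
  · exact key _ h4 (Or.inr (by rw [h3, mul_assoc v₁, D.tr₂.sq, mul_one]))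

/-- Decomposition of `A`. -/
theorem ExceptionalData.mem_normal_form [Finite X]
    (D : ExceptionalData t A x₁ x₂ a₁ a₂ v₁ v₂) {a : X} (ha : a ∈ A) :
    ∃ p₁ p₂ z, (p₁ = 1 ∨ p₁ = a₁) ∧ (p₂ = 1 ∨ p₂ = a₂) ∧ z ∈ cent A x₁ ⊓ cent A x₂ ∧
      a = p₁ * p₂ * z := by
  have ha₁ := cent_le _ _ D.a₁_mem
  have ha₂ := cent_le _ _ D.a₂_mem
  have hpos : 0 < Nat.card A := Nat.card_pos
  have hh₁ := D.tr₁.half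
  have hh₂ := D.tr₂.half
  obtain ⟨p₁, hp₁, hp₁'⟩ : ∃ p₁, (p₁ = 1 ∨ p₁ = a₁) ∧ p₁⁻¹ * a ∈ cent A x₁ := by
    by_cases hc : a ∈ cent A x₁
    · exact ⟨1, Or.inl rfl, by simpa using hc⟩
    · exact ⟨a₁, Or.inr rfl, mul_mem_of_card_lt (cent_le A x₁) (by omega) (A.inv_mem ha₁) ha
        (fun h' => D.a₁_notMem (by simpa using inv_mem h')) hc⟩
  have hp₁₂ : p₁ ∈ cent A x₂ := by
    rcases hp₁ with rfl | rfl
    · exact one_mem _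
    · exact D.a₁_mem
  obtain ⟨p₂, hp₂, hp₂'⟩ : ∃ p₂, (p₂ = 1 ∨ p₂ = a₂) ∧ p₂⁻¹ * (p₁⁻¹ * a) ∈ cent A x₂ := by
    by_cases hc : p₁⁻¹ * a ∈ cent A x₂
    · exact ⟨1, Or.inl rfl, by simpa using hc⟩
    · exact ⟨a₂, Or.inr rfl, mul_mem_of_card_lt (cent_le A x₂) (by omega) (A.inv_mem ha₂)
        (cent_le A x₁ hp₁') (fun h' => D.a₂_notMem (by simpa using inv_mem h')) hc⟩
  have hp₂₁ : p₂ ∈ cent A x₁ := by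
    rcases hp₂ with rfl | rfl
    · exact one_mem _
    · exact D.a₂_mem
  exact ⟨p₁, p₂, p₂⁻¹ * (p₁⁻¹ * a), hp₁, hp₂, 
    ⟨Subgroup.mul_mem _ (Subgroup.inv_mem _ hp₂₁) hp₁', hp₂'⟩, by group⟩

/-- Write t = P₁ P₂ z with z central and P_i a product of members of the i-th pair. The pairs
commute with each other, so P_i inverts the i-th pair and `exists_involutions` applies. In the
quaternion case P_i² = v_i; but t² = 1 gives P₁² P₂² = 1, and v₁, v₂ are distinct involutions, so
neither pair is quaternion. -/
theorem ExceptionalData.exists_family [Finite X] (h : MaxInverts t A)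
    (hX : Nat.card X < 2 * numInvol X) (D : ExceptionalData t A x₁ x₂ a₁ a₂ v₁ v₂)
    (hD : x₂ * x₁ = x₁ * x₂) :
    ∃ d e v : Fin 2 → X, DihedralFamily d e v ∧ v 0 ≠ v 1 := by
  have hv₁ := D.v₁_central h hX
  have hv₂ := (D.symm h hX).v₁_central h hX
  have ha₁ := cent_le _ _ D.a₁_mem
  have ha₂ := cent_le _ _ D.a₂_mem
  have c12 : Commute a₁ a₂ := h.comm ha₁ ha₂
  have ca₁x₂ : Commute a₁ x₂ := (mem_cent.1 D.a₁_mem).2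
  have ca₂x₁ : Commute a₂ x₁ := (mem_cent.1 D.a₂_mem).2
  have cxx : Commute x₁ x₂ := hD.symm
  have hti := h.inv_eq
  have hcz : ∀ z ∈ cent A x₁ ⊓ cent A x₂, z ∈ Subgroup.center X := fun z hz =>
    Subgroup.mem_center_iff.2 fun g => (D.mem_center h.toInverts hz.1 hz.2 g).symm
  obtain ⟨P₁, P₂, z, hP₁, hP₂, hz, ht⟩ : ∃ P₁ P₂ z,
      (P₁ = 1 ∨ P₁ = a₁ ∨ P₁ = x₁ ∨ P₁ = x₁ * a₁) ∧
      (P₂ = 1 ∨ P₂ = a₂ ∨ P₂ = x₂ ∨ P₂ = x₂ * a₂) ∧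
      (z ∈ Subgroup.center X) ∧ t = P₁ * P₂ * z := by
    obtain ⟨p, hp, a, ha, hta⟩ := D.gen t
    obtain ⟨q₁, q₂, z, hq₁, hq₂, hz, rfl⟩ := D.mem_normal_form ha
    obtain ⟨p₁, p₂, hp₁, hp₂, rfl⟩ : ∃ p₁ p₂, (p₁ = 1 ∨ p₁ = x₁) ∧ (p₂ = 1 ∨ p₂ = x₂) ∧
        p = p₁ * p₂ := by
      rcases hp with rfl | rfl | rfl | rfl
      · exact ⟨1, 1, by simp⟩
      · exact ⟨p, 1, by simp⟩
      · exact ⟨1, p, by simp⟩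
      · exact ⟨x₁, x₂, by simp⟩
    have hc : p₂ * q₁ = q₁ * p₂ := by
      rcases hp₂ with rfl | rfl <;> rcases hq₁ with rfl | rfl <;> simp [ca₁x₂.eq]
    refine ⟨p₁ * q₁, p₂ * q₂, z, ?_, ?_, hcz z hz, ?_⟩
    · rcases hp₁ with rfl | rfl <;> rcases hq₁ with rfl | rfl <;> simp
    · rcases hp₂ with rfl | rfl <;> rcases hq₂ with rfl | rfl <;> simp
    · calc t = p₁ * (p₂ * q₁) * q₂ * z := by rw [hta]; group
        _ = _ := by rw [hc]; group
  have hcP₂ : ∀ g, Commute a₂ g → Commute x₂ g → Commute P₂ g := by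
    rintro g h1 h2
    rcases hP₂ with rfl | rfl | rfl | rfl
    · exact Commute.one_left g
    · exact h1
    · exact h2
    · exact h2.mul_left h1
  have hcP₁ : ∀ g, Commute a₁ g → Commute x₁ g → Commute P₁ g := by
    rintro g h1 h2
    rcases hP₁ with rfl | rfl | rfl | rfl
    · exact Commute.one_left g
    · exact h1
    · exact h2
    · exact h2.mul_left h1
  have hcP : Commute P₁ P₂ :=
    hcP₁ P₂ (hcP₂ a₁ c12.symm ca₁x₂.symm).symm (hcP₂ x₁ ca₂x₁ cxx.symm).symm
  have hzc : ∀ g, Commute z g := fun g => (Subgroup.mem_center_iff.1 hz g).symm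
  have htP : ∀ g, t * g * t = P₁ * P₂ * g * (P₁ * P₂)⁻¹ := by
    intro g
    nth_rw 2 [← hti]
    rw [ht, mul_assoc _ z g, (hzc g).eq]
    group
  have h₁ : ∀ g, Commute P₂ g → t * g * t = P₁ * g * P₁⁻¹ := by
    intro g hg
    rw [htP, mul_assoc P₁, hg.eq]; group
  have h₂ : ∀ g, Commute P₁ g → t * g * t = P₂ * g * P₂⁻¹ := by
    intro g hg
    rw [htP, hcP.eq, mul_assoc P₂, hg.eq]; group
  have hzz := h.center_sq hX hz
  have htt : P₁ * P₁ * (P₂ * P₂) = 1 := by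
    have h1 : P₁ * P₂ * z * (P₁ * P₂ * z) = P₁ * P₁ * (P₂ * P₂) * (z * z) := by
      have e1 : P₁ * P₂ * z * (P₁ * P₂ * z) = P₁ * P₂ * (z * (P₁ * P₂)) * z := by group
      rw [e1, (hzc _).eq]
      have e2 : P₁ * P₂ * (P₁ * P₂ * z) * z = P₁ * (P₂ * P₁) * P₂ * (z * z) := by group
      rw [e2, ← hcP.eq]; group
    rw [hzz, mul_one, ← ht, h.sq] at h1
    exact h1.symm
  have k₁ := exists_involutions D.tr₁.sq hv₁ D.rel hP₁
    (by rw [← h₁ _ (hcP₂ a₁ c12.symm ca₁x₂.symm), h.conj _ ha₁])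
    (by rw [← h₁ _ (hcP₂ x₁ ca₂x₁ cxx.symm), D.x₁_conj])
  have k₂ := exists_involutions D.tr₂.sq hv₂ (D.symm h hX).rel hP₂
    (by rw [← h₂ _ (hcP₁ a₂ c12 ca₂x₁.symm), h.conj _ ha₂])
    (by rw [← h₂ _ (hcP₁ x₂ ca₁x₂ cxx), D.x₂_conj])
  have hne : ∀ P Q v w : X, P = v → w ≠ 1 → v ≠ 1 → v * v = 1 → v ≠ w → (Q = 1 ∨ Q = w) →
      P * Q ≠ 1 := by
    rintro P Q v w rfl - h1 h2 h3 (rfl | rfl) h4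
    · exact h1 (by simpa using h4)
    · exact h3 (mul_left_cancel (h2.trans h4.symm))
  have k₁' := k₁.resolve_right fun hc => hne _ _ _ _ hc D.tr₂.ne_one D.tr₁.ne_one D.tr₁.sq D.ne
    (k₂.imp And.left id) htt
  rw [k₁'.1, one_mul] at htt
  have k₂' := k₂.resolve_right fun hc => D.tr₂.ne_one (hc.symm.trans htt)
  obtain ⟨-, d₁, e₁, hd₁, he₁, hr₁, hH₁⟩ := k₁'
  obtain ⟨-, d₂, e₂, hd₂, he₂, hr₂, hH₂⟩ := k₂'
  have hcomm : ∀ {a y d e : X}, (∀ H : Subgroup X, d ∈ H ∧ e ∈ H ↔ a ∈ H ∧ y ∈ H) → ∀ {g},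
      Commute a g → Commute y g → Commute d g ∧ Commute e g := by
    intro a y d e hH g h1 h2
    have h3 := (hH (Subgroup.centralizer {g})).2
      ⟨Subgroup.mem_centralizer_singleton_iff.2 h1, Subgroup.mem_centralizer_singleton_iff.2 h2⟩
    exact ⟨Subgroup.mem_centralizer_singleton_iff.1 h3.1,
      Subgroup.mem_centralizer_singleton_iff.1 h3.2⟩
  have e1 := hcomm hH₁ c12 ca₂x₁.symm
  have e2 := hcomm hH₁ ca₁x₂ cxx
  have e3 := hcomm hH₂ e1.1.symm e2.1.symm
  have e4 := hcomm hH₂ e1.2.symm e2.2.symm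
  refine ⟨![d₁, d₂], ![e₁, e₂], ![v₁, v₂], ⟨?_, ?_, ?_, ?_, ?_, ?_, ?_, ?_, ?_⟩, D.ne⟩
  · exact Fin.forall_fin_two.2 ⟨hd₁, hd₂⟩
  · exact Fin.forall_fin_two.2 ⟨he₁, he₂⟩
  · exact Fin.forall_fin_two.2 ⟨D.tr₁.sq, D.tr₂.sq⟩
  · exact Fin.forall_fin_two.2 ⟨D.tr₁.ne_one, D.tr₂.ne_one⟩
  · exact Fin.forall_fin_two.2 ⟨hv₁, hv₂⟩
  · exact Fin.forall_fin_two.2 ⟨hr₁, hr₂⟩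
  · refine Fin.forall_fin_two.2 ⟨Fin.forall_fin_two.2 ⟨fun h => absurd rfl h, fun _ => ?_⟩,
      Fin.forall_fin_two.2 ⟨fun _ => ?_, fun h => absurd rfl h⟩⟩
    · exact ⟨e3.1.symm, e3.2.symm, e4.2.symm⟩
    · exact ⟨e3.1, e4.1, e4.2⟩
  · intro H hH hde
    obtain ⟨hde₁, hde₂⟩ := Fin.forall_fin_two.1 hde
    obtain ⟨m₁, m₂⟩ := (hH₁ H).1 hde₁
    obtain ⟨m₃, m₄⟩ := (hH₂ H).1 hde₂
    rw [Subgroup.eq_top_iff']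
    intro g
    obtain ⟨p, hp, a, ha, rfl⟩ := D.gen g
    obtain ⟨q₁, q₂, z, hq₁, hq₂, hz, rfl⟩ := D.mem_normal_form ha
    refine H.mul_mem ?_ (H.mul_mem (H.mul_mem ?_ ?_) (hH (hcz z hz)))
    · rcases hp with rfl | rfl | rfl | rfl
      exacts [H.one_mem, m₂, m₄, H.mul_mem m₂ m₄]
    · rcases hq₁ with rfl | rfl
      exacts [H.one_mem, m₁]
    · rcases hq₂ with rfl | rfl
      exacts [H.one_mem, m₃]
  · exact fun z hz => h.center_sq hX hz

end Exceptional

end Families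
end CyclicRatio

/-! ### Splitting off dihedral groups when commutators lie in {1, v} -/

namespace CyclicRatio

section CentralProduct

variable {X : Type*} [Group X] {A : Subgroup X} {v : X}

theorem IsExtraspecial.rel (hv : IsExtraspecial v) {g z : X} (h : ¬ Commute g z) :
    g * z = v * (z * g) := by
  rcases hv.conj g z with h1 | h1
  · exact absurd (mul_inv_eq_iff_eq_mul.1 h1) h
  · rw [mul_inv_eq_iff_eq_mul] at h1
    rw [h1, mul_assoc]

theorem IsExtraspecial.commute_mul (hv : IsExtraspecial v) {g z z' : X} (h : ¬ Commute g z)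
    (h' : ¬ Commute g z') : Commute g (z * z') := by
  have h1 := rel_mul_right hv.central (hv.rel h) (hv.rel h')
  rw [hv.sq, one_mul] at h1
  exact h1

/-- Induction on |K|. If K is not contained in A, there are an involution x in K outside A and an a
in A ∩ K not commuting with it; the pair is split off and K is replaced by the centralizer of both
in K. The two hypotheses are `MaxInverts.exists_eq` and `MaxInverts.mem_of_commute'` relative to K,
in a form that passes to this centralizer: a correcting element b that fails to commute with x is
replaced by b * a. -/
theorem IsExtraspecial.exists_family_aux [Finite X] (hv : IsExtraspecial v) (hA : Inverts 1 A)
    (n : ℕ) : ∀ K : Subgroup X, Nat.card K = n →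
      (∀ y ∈ K, ∃ a ∈ A, a ∈ K ∧ y * a * (y * a) = 1) →
      (∀ y ∈ K, (∀ a ∈ A, a ∈ K → Commute a y) → y ∈ A) →
      ∃ (r : ℕ) (d e : Fin r → X), (∀ i, d i ∈ K ∧ e i ∈ K) ∧ (∀ i, d i * d i = 1) ∧
        (∀ i, e i * e i = 1) ∧ (∀ i, e i * d i = v * (d i * e i)) ∧
        (∀ i j, i ≠ j → Commute (d i) (d j) ∧ Commute (d i) (e j) ∧ Commute (e i) (e j)) ∧
        ∀ H : Subgroup X, (∀ z ∈ K, (∀ k ∈ K, Commute z k) → z ∈ H) →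
          (∀ i, d i ∈ H ∧ e i ∈ H) → K ≤ H := by
  induction n using Nat.strong_induction_on with
  | _ n ih =>
  intro K hKn hK₁ hK₂
  by_cases hKA : K ≤ A
  · exact ⟨0, Fin.elim0, Fin.elim0, fun i => i.elim0, fun i => i.elim0, fun i => i.elim0,
      fun i => i.elim0, fun i => i.elim0, fun H hH _ z hz =>
        hH z hz fun k hk => hA.comm (hKA hz) (hKA hk)⟩
  obtain ⟨y, hyK, hyA⟩ := SetLike.not_le_iff_exists.1 hKA
  obtain ⟨b, hbA, hbK, hx⟩ := hK₁ y hyK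
  obtain ⟨x, rfl⟩ : ∃ x, x = y * b := ⟨_, rfl⟩
  have hxK : y * b ∈ K := K.mul_mem hyK hbK
  have hxA : y * b ∉ A := fun hc => hyA ((A.mul_mem_cancel_right hbA).1 hc)
  generalize y * b = x at hx hxK hxA
  obtain ⟨a, haA, haK, hax⟩ : ∃ a ∈ A, a ∈ K ∧ ¬ Commute a x := by
    by_contra! hc
    exact hxA (hK₂ x hxK hc)
  have hxa : ¬ Commute x a := fun hc => hax hc.symm
  have haa : a * a = 1 := by
    have := hA.conj a haA
    rw [one_mul, mul_one] at this
    exact mul_eq_one_iff_eq_inv.2 this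
  have hAc : ∀ {p q}, p ∈ A → q ∈ A → Commute p q := fun hp hq => hA.comm hp hq
  obtain ⟨K', hK'⟩ : ∃ K' : Subgroup X, ∀ z, z ∈ K' ↔ z ∈ K ∧ Commute z a ∧ Commute z x :=
    ⟨K ⊓ (Subgroup.centralizer {a} ⊓ Subgroup.centralizer {x}), fun z => by
      simp only [Subgroup.mem_inf, Subgroup.mem_centralizer_singleton_iff]; rfl⟩
  have hlt : Nat.card K' < n := by
    rw [← hKn]
    refine lt_of_le_of_ne (Subgroup.card_le_of_le fun z hz => ((hK' z).1 hz).1) fun hc => ?_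
    have h1 : K' = K := Subgroup.eq_of_le_of_card_ge (fun z hz => ((hK' z).1 hz).1) hc.ge
    rw [← h1, hK'] at haK
    exact hax haK.2.2
  obtain ⟨r, d, e, hde, hd, he, hr, hc, hg⟩ := ih _ hlt K' rfl (by
    intro y hy
    obtain ⟨hyK, hya, hyx⟩ := (hK' y).1 hy
    obtain ⟨b, hbA, hbK, hyb⟩ := hK₁ y hyK
    by_cases hbx : Commute b x
    · exact ⟨b, hbA, (hK' b).2 ⟨hbK, hAc hbA haA, hbx⟩, hyb⟩
    · refine ⟨b * a, A.mul_mem hbA haA, (hK' _).2 ⟨K.mul_mem hbK haK,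
        hAc (A.mul_mem hbA haA) haA, (hv.commute_mul (fun h => hbx h.symm) hxa).symm⟩, ?_⟩
      have h1 : Commute (y * b) a := hya.mul_left (hAc hbA haA)
      calc y * (b * a) * (y * (b * a)) = y * b * (a * (y * b)) * a := by group
        _ = y * b * (y * b) * (a * a) := by rw [← h1.eq]; group
        _ = 1 := by rw [hyb, haa, one_mul]) (by
    intro y hy hcy
    obtain ⟨hyK, hya, hyx⟩ := (hK' y).1 hy
    refine hK₂ y hyK fun b hbA hbK => ?_
    by_cases hbx : Commute b x
    · exact hcy b hbA ((hK' b).2 ⟨hbK, hAc hbA haA, hbx⟩)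
    · have h1 := hcy (b * a) (A.mul_mem hbA haA) ((hK' _).2 ⟨K.mul_mem hbK haK,
        hAc (A.mul_mem hbA haA) haA, (hv.commute_mul (fun h => hbx h.symm) hxa).symm⟩)
      have h2 := h1.mul_left hya.symm.inv_left
      rwa [mul_inv_cancel_right] at h2)
  -- Two elements not commuting with g have a product that does. So x repairs commutation with a,
  -- and then a repairs commutation with x.
  have hdec : ∀ k ∈ K, ∃ w, k * w ∈ K' ∧ (w = 1 ∨ w = x ∨ w = a ∨ w = x * a) := by
    intro k hk
    obtain ⟨w, hw, hka⟩ : ∃ w, (w = 1 ∨ w = x) ∧ Commute (k * w) a := by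
      by_cases hka : Commute k a
      · exact ⟨1, Or.inl rfl, by rwa [mul_one]⟩
      · exact ⟨x, Or.inr rfl, (hv.commute_mul (fun h => hka h.symm) hax).symm⟩
    have hwK : k * w ∈ K := by
      rcases hw with rfl | rfl
      · rwa [mul_one]
      · exact K.mul_mem hk hxK
    by_cases hkx : Commute (k * w) x
    · refine ⟨w, (hK' _).2 ⟨hwK, hka, hkx⟩, ?_⟩
      rcases hw with rfl | rfl <;> simp
    · refine ⟨w * a, ?_, ?_⟩
      · rw [← mul_assoc, hK']
        exact ⟨K.mul_mem hwK haK, hka.mul_left (Commute.refl a),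
          (hv.commute_mul (fun h => hkx h.symm) hxa).symm⟩
      · rcases hw with rfl | rfl <;> simp
  have hmem : ∀ i, (Commute (d i) a ∧ Commute (d i) x) ∧ Commute (e i) a ∧ Commute (e i) x :=
    fun i => ⟨((hK' _).1 (hde i).1).2, ((hK' _).1 (hde i).2).2⟩
  refine ⟨r + 1, Fin.cons a d, Fin.cons x e, ?_, ?_, ?_, ?_, ?_, ?_⟩
  · exact Fin.cases ⟨haK, hxK⟩ fun i => ⟨((hK' _).1 (hde i).1).1, ((hK' _).1 (hde i).2).1⟩
  · exact Fin.cases haa hd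
  · exact Fin.cases hx he
  · exact Fin.cases (hv.rel hxa) hr
  · refine Fin.cases (Fin.cases (fun h => absurd rfl h) fun j _ => ?_) fun i =>
      Fin.cases (fun _ => ?_) fun j hij => ?_
    · exact ⟨(hmem j).1.1.symm, (hmem j).2.1.symm, (hmem j).2.2.symm⟩
    · exact ⟨(hmem i).1.1, (hmem i).1.2, (hmem i).2.2⟩
    · exact hc i j fun h => hij (congrArg Fin.succ h)
  · intro H hH hdeH
    have h0 := hdeH 0
    simp only [Fin.cons_zero] at h0
    have hw : ∀ w, (w = 1 ∨ w = x ∨ w = a ∨ w = x * a) → w ∈ H := by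
      rintro w (rfl | rfl | rfl | rfl)
      exacts [H.one_mem, h0.2, h0.1, H.mul_mem h0.2 h0.1]
    have hK'H : K' ≤ H := by
      refine hg H (fun z hz hzc => ?_) fun i => ?_
      · obtain ⟨hzK, hza, hzx⟩ := (hK' z).1 hz
        refine hH z hzK fun k hk => ?_
        obtain ⟨w, hwk, hw⟩ := hdec k hk
        have h1 := hzc _ hwk
        have h2 : Commute z w := by
          rcases hw with rfl | rfl | rfl | rfl
          exacts [Commute.one_right z, hzx, hza, hzx.mul_right hza]
        have h3 := h1.mul_right h2.inv_right
        rwa [mul_inv_cancel_right] at h3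
      · exact hdeH i.succ
    intro k hk
    obtain ⟨w, hwk, hwc⟩ := hdec k hk
    exact (H.mul_mem_cancel_right (hw w hwc)).1 (hK'H hwk)

theorem IsExtraspecial.exists_family [Finite X] (hv : IsExtraspecial v) (hA : MaxInverts 1 A)
    (hX : Nat.card X < 2 * numInvol X) :
    ∃ (r : ℕ) (d e : Fin r → X), DihedralFamily d e fun _ => v := by
  obtain ⟨r, d, e, -, hd, he, hr, hc, hg⟩ := hv.exists_family_aux hA.toInverts _ ⊤ rfl
    (fun y _ => by
      obtain ⟨a, ha, hs⟩ := hA.exists_eq hX y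
      rw [one_mul, mul_one] at hs
      exact ⟨a, ha, Subgroup.mem_top a, mul_eq_one_iff_eq_inv.2 hs⟩)
    (fun y _ h => hA.mem_of_commute' hX fun a ha => h a ha (Subgroup.mem_top a))
  refine ⟨r, d, e, hd, he, fun _ => hv.sq, fun _ => hv.ne_one, fun _ => hv.central, hr, hc,
    fun H hH hde => ?_, fun z hz => hA.center_sq hX hz⟩
  exact top_le_iff.1 (hg H (fun z _ hz => hH (Subgroup.mem_center_iff.2 fun g =>
    (hz g (Subgroup.mem_top g)).symm)) hde)

/-- A group in which more than half of the elements satisfy `g * g = 1`: it has an abelian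
subgroup of index at most two, or is generated by its centre and commuting dihedral groups. -/
theorem exists_abelian_or_family (X : Type*) [Group X] [Finite X]
    (hX : Nat.card X < 2 * numInvol X) :
    (∃ A : Subgroup X, (∀ a ∈ A, ∀ b ∈ A, a * b = b * a) ∧ Nat.card X ≤ 2 * Nat.card A) ∨
    (∃ (v : X) (r : ℕ) (d e : Fin r → X), DihedralFamily d e fun _ => v) ∨
    ∃ d e v : Fin 2 → X, DihedralFamily d e v ∧ v 0 ≠ v 1 := by
  obtain ⟨t, A, h⟩ := exists_maxInverts X
  by_cases hA : Nat.card X ≤ 2 * Nat.card A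
  · exact Or.inl ⟨A, fun a ha b hb => h.comm ha hb, hA⟩
  rw [not_le] at hA
  by_cases hall : ∀ x ∉ A, 2 * Nat.card (cent A x) = Nat.card A
  · right; left
    obtain ⟨B, hB, hBA⟩ := h.exists_one (hall t)
    obtain ⟨v, hv⟩ := hB.isExtraspecial hX (by omega) ((hB.all_half_iff hX).2 (by
      rw [hBA]; exact (h.all_half_iff hX).1 hall))
    exact ⟨v, hv.exists_family hB hX⟩
  · right; right
    obtain ⟨x₁, x₂, a₁, a₂, v₁, v₂, D⟩ := h.exists_exceptionalData hX hA hall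
    obtain ⟨y₁, y₂, D', hD'⟩ := D.exists_commuting h hX hall
    exact D'.exists_family h hX hD'

end CentralProduct
end CyclicRatio

/-! ### From dihedral families to direct and central products -/

namespace CyclicRatio

section ElementaryAbelian

/-- A group in which every element squares to `1` is commutative. -/
abbrev commGroupOfSq {E : Type*} [Group E] (h : ∀ e : E, e * e = 1) : CommGroup E :=
  { (inferInstance : Group E) with
    mul_comm := fun a b => by
      have h1 := mul_eq_one_iff_eq_inv.1 (h (a * b))
      rwa [mul_inv_rev, inv_eq_of_mul_eq_one_left (h a), inv_eq_of_mul_eq_one_left (h b)] at h1 }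

theorem exists_isCompl_of_sq {Z : Type*} [Group Z] (h : ∀ z : Z, z * z = 1)
    (V : Subgroup Z) : ∃ E : Subgroup Z, IsCompl V E := by
  let _ : CommGroup Z := commGroupOfSq h
  let _ : Module (ZMod 2) (Additive Z) := AddCommGroup.zmodModule (n := 2) fun x => by
    rw [two_nsmul]; exact h x
  have : ComplementedLattice (Subgroup Z) :=
    (OrderIso.complementedLattice_iff
      (Subgroup.toAddSubgroup.trans (AddSubgroup.toZModSubmodule 2))).2 inferInstance
  exact exists_isCompl V

theorem exists_equiv_cpow {p : ℕ} [Fact p.Prime] {E : Type*} [CommGroup E] [Finite E]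
    (h : ∀ e : E, e ^ p = 1) : ∃ m, Nonempty (E ≃* CPow p m) := by
  let _ : Module (ZMod p) (Additive E) := AddCommGroup.zmodModule (n := p) h
  have : Module.Finite (ZMod p) (Additive E) := Module.Finite.of_finite
  let b := Module.finBasis (ZMod p) (Additive E)
  exact ⟨_, ⟨{ toFun := fun e i => Multiplicative.ofAdd (b.equivFun (Additive.ofMul e) i)
               invFun := fun f => (b.equivFun.symm fun i => (f i).toAdd).toMul
               left_inv := fun e => by simp
               right_inv := fun f => funext fun i => congrArg Multiplicative.ofAdd
                 (congrFun (b.equivFun.apply_symm_apply fun i => (f i).toAdd) i)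
               map_mul' := fun x y => by ext i; simp }⟩⟩

theorem exists_equiv_cpow_two {E : Type*} [Group E] [Finite E] (h : ∀ e : E, e * e = 1) :
    ∃ m, Nonempty (E ≃* CPow 2 m) := by
  let _ : CommGroup E := commGroupOfSq h
  exact exists_equiv_cpow fun e => by rw [pow_two]; exact h e

theorem exists_complement_center {X : Type*} [Group X] (h : ∀ z ∈ Subgroup.center X, z * z = 1)
    {V : Subgroup X} (hV : V ≤ Subgroup.center X) :
    ∃ E : Subgroup X, E ≤ Subgroup.center X ∧ (∀ z ∈ V, z ∈ E → z = 1) ∧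
      Subgroup.center X ≤ V ⊔ E := by
  obtain ⟨E, hE⟩ := exists_isCompl_of_sq (Z := Subgroup.center X)
    (fun z => Subtype.ext (h z z.2)) (V.subgroupOf (Subgroup.center X))
  refine ⟨E.map (Subgroup.center X).subtype, ?_, ?_, ?_⟩
  · rintro _ ⟨z, -, rfl⟩
    exact z.2
  · rintro _ hz ⟨z, hzE, rfl⟩
    have h1 : z ∈ V.subgroupOf (Subgroup.center X) ⊓ E := ⟨hz, hzE⟩
    rw [hE.inf_eq_bot, Subgroup.mem_bot] at h1
    rw [h1]; rfl
  · have h1 := congrArg (Subgroup.map (Subgroup.center X).subtype) hE.sup_eq_top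
    rw [Subgroup.map_sup, Subgroup.subgroupOf_map_subtype, inf_eq_left.2 hV,
      ← MonoidHom.range_eq_map, Subgroup.range_subtype] at h1
    exact h1.ge

end ElementaryAbelian

section DihedralHom

variable {X : Type*} [Group X]

theorem pow_val_add {ρ : X} (h : ρ ^ 4 = 1) (i j : ZMod 4) :
    ρ ^ (i + j).val = ρ ^ i.val * ρ ^ j.val := by
  rw [ZMod.val_add, ← pow_eq_pow_mod _ h, pow_add]

theorem pow_val_sub {ρ : X} (h : ρ ^ 4 = 1) (i j : ZMod 4) :
    ρ ^ (j - i).val = (ρ ^ i.val)⁻¹ * ρ ^ j.val := by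
  rw [eq_inv_mul_iff_mul_eq, ← pow_val_add h, add_sub_cancel]

/-- The homomorphism from the dihedral group of order `8` given by `d` and `ρ`. -/
def dihedralHom (d ρ : X) (hρ : ρ ^ 4 = 1) (hd : d * d = 1) (hdρ : d * ρ * d⁻¹ = ρ⁻¹) :
    D8 →* X where
  toFun
    | .r i => ρ ^ i.val
    | .sr i => d * ρ ^ i.val
  map_one' := by
    change ρ ^ (0 : ZMod 4).val = 1
    simp
  map_mul' := by
    have hc : ∀ n : ℕ, ρ ^ n * d = d * (ρ ^ n)⁻¹ := fun n => by
      rw [← inv_pow, ← hdρ, conj_pow, ← mul_assoc, ← mul_assoc, hd, one_mul,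
        inv_eq_of_mul_eq_one_left hd]
    rintro (i | i) (j | j)
    · exact pow_val_add hρ i j
    · change d * ρ ^ (j - i).val = ρ ^ i.val * (d * ρ ^ j.val)
      rw [pow_val_sub hρ, ← mul_assoc, ← mul_assoc, hc]
    · change d * ρ ^ (i + j).val = d * ρ ^ i.val * ρ ^ j.val
      rw [pow_val_add hρ, mul_assoc]
    · change ρ ^ (j - i).val = d * ρ ^ i.val * (d * ρ ^ j.val)
      rw [pow_val_sub hρ, mul_assoc d, ← mul_assoc _ d, hc, ← mul_assoc, ← mul_assoc, hd, one_mul]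

end DihedralHom

section Family

variable {X : Type*} [Group X] {r : ℕ} {d e v : Fin r → X}

theorem DihedralFamily.sq (F : DihedralFamily d e v) (i : Fin r) :
    (d i * e i) * (d i * e i) = v i := by
  calc (d i * e i) * (d i * e i) = d i * (e i * d i) * e i := by group
    _ = v i * (d i * d i) * (e i * e i) := by
      rw [F.rel, ← mul_assoc (d i), ← F.v_central]; group
    _ = v i := by rw [F.d_sq, F.e_sq, mul_one, mul_one]

/-- The homomorphisms from the dihedral group of order `8` given by the pairs of the family. -/
def DihedralFamily.hom (F : DihedralFamily d e v) (i : Fin r) : D8 →* X :=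
  dihedralHom (d i) (d i * e i)
    (by rw [show 4 = 2 * 2 from rfl, pow_mul, pow_two (d i * e i), F.sq, pow_two, F.v_sq])
    (F.d_sq i) (by
      rw [mul_inv_rev, inv_eq_of_mul_eq_one_left (F.d_sq i), inv_eq_of_mul_eq_one_left (F.e_sq i),
        ← mul_assoc, F.d_sq, one_mul])

theorem DihedralFamily.hom_sr_zero (F : DihedralFamily d e v) (i : Fin r) :
    F.hom i (.sr 0) = d i := by
  change d i * (d i * e i) ^ (0 : ZMod 4).val = d i
  simp

theorem DihedralFamily.hom_sr_one (F : DihedralFamily d e v) (i : Fin r) :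
    F.hom i (.sr 1) = e i := by
  change d i * (d i * e i) ^ (1 : ZMod 4).val = e i
  rw [show (1 : ZMod 4).val = 1 from rfl, pow_one, ← mul_assoc, F.d_sq, one_mul]

theorem DihedralFamily.hom_r_two (F : DihedralFamily d e v) (i : Fin r) :
    F.hom i (.r 2) = v i := by
  change (d i * e i) ^ (2 : ZMod 4).val = v i
  rw [show (2 : ZMod 4).val = 2 from rfl, pow_two, F.sq]

theorem DihedralFamily.hom_mem (F : DihedralFamily d e v) {H : Subgroup X} {i : Fin r}
    (hd : d i ∈ H) (he : e i ∈ H) (x : D8) : F.hom i x ∈ H := by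
  rcases x with k | k
  · exact H.pow_mem (H.mul_mem hd he) _
  · exact H.mul_mem hd (H.pow_mem (H.mul_mem hd he) _)

theorem DihedralFamily.commute_hom (F : DihedralFamily d e v) {i : Fin r} {g : X}
    (hd : Commute (d i) g) (he : Commute (e i) g) (x : D8) : Commute (F.hom i x) g :=
  Subgroup.mem_centralizer_singleton_iff.1 (F.hom_mem (H := Subgroup.centralizer {g})
    (Subgroup.mem_centralizer_singleton_iff.2 hd) (Subgroup.mem_centralizer_singleton_iff.2 he) x)

theorem DihedralFamily.pairwise_commute (F : DihedralFamily d e v) :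
    Pairwise fun i j => ∀ x y, Commute (F.hom i x) (F.hom j y) := by
  intro i j hij x y
  obtain ⟨h1, h2, h3⟩ := F.comm i j hij
  obtain ⟨-, h4, -⟩ := F.comm j i hij.symm
  refine F.commute_hom ?_ ?_ x
  · exact (F.commute_hom h1.symm h2.symm y).symm
  · exact (F.commute_hom h4 h3.symm y).symm

/-- The homomorphism from the direct power of the dihedral group of order `8`. -/
def DihedralFamily.piHom (F : DihedralFamily d e v) : (Fin r → D8) →* X :=
  MonoidHom.noncommPiCoprod F.hom F.pairwise_commute

theorem DihedralFamily.piHom_mulSingle (F : DihedralFamily d e v) (i : Fin r) (x : D8) :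
    F.piHom (Pi.mulSingle i x) = F.hom i x :=
  MonoidHom.noncommPiCoprod_mulSingle F.hom i x

theorem D8.commutator_eq (x y : D8) : x * y * x⁻¹ * y⁻¹ = 1 ∨ x * y * x⁻¹ * y⁻¹ = .r 2 := by
  decide +revert

theorem D8.eq_of_central (x : D8) (h : ∀ y, x * y * x⁻¹ * y⁻¹ = 1) : x = 1 ∨ x = .r 2 := by
  decide +revert

/-- A noncentral coordinate a i has commutator r 2 with some y, and this maps to v i ≠ 1. -/
theorem DihedralFamily.eq_of_central (F : DihedralFamily d e v) {a : Fin r → D8}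
    (h : F.piHom a ∈ Subgroup.center X) (i : Fin r) : a i = 1 ∨ a i = .r 2 := by
  refine D8.eq_of_central _ fun y => (D8.commutator_eq _ y).resolve_right fun hc => F.v_ne i ?_
  have h1 : a * Pi.mulSingle i y * a⁻¹ * (Pi.mulSingle i y)⁻¹ =
      Pi.mulSingle i (a i * y * (a i)⁻¹ * y⁻¹) := by
    ext1 j
    by_cases hj : j = i
    · subst hj; simp
    · simp [hj]
  have h2 := congrArg F.piHom h1
  rw [F.piHom_mulSingle, hc, F.hom_r_two, map_mul, map_mul, map_mul, map_inv, map_inv,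
    ← Subgroup.mem_center_iff.1 h] at h2
  rw [← h2]; group

/-- E is a complement in the elementary abelian center to the subgroup generated by the v i. An
element of the image of D_8^r lying in E is central, hence a product of v i, hence trivial. -/
theorem DihedralFamily.exists_equiv_aux [Finite X] (F : DihedralFamily d e v) :
    ∃ (m : ℕ) (E : Subgroup X), Nonempty (E ≃* CPow 2 m) ∧ E ≤ Subgroup.center X ∧
      (∀ (a : Fin r → D8) (z : X), z ∈ E → F.piHom a * z = 1 → F.piHom a = 1 ∧ z = 1) ∧
      ∀ x, ∃ a, ∃ z ∈ E, F.piHom a * z = x := by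
  have hV : Subgroup.closure (Set.range v) ≤ Subgroup.center X := by
    rw [Subgroup.closure_le]
    rintro _ ⟨i, rfl⟩
    exact Subgroup.mem_center_iff.2 fun g => (F.v_central i g).symm
  obtain ⟨E, hEc, hVE, hZ⟩ := exists_complement_center F.center_sq hV
  obtain ⟨m, hm⟩ := exists_equiv_cpow_two (E := E)
    fun z => Subtype.ext (F.center_sq z (hEc z.2))
  refine ⟨m, E, hm, hEc, fun a z hz haz => ?_, fun x => ?_⟩
  · have h1 : F.piHom a = z⁻¹ := mul_eq_one_iff_eq_inv.1 haz
    have h2 : F.piHom a ∈ Subgroup.closure (Set.range v) := by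
      have h3 := F.eq_of_central (h1 ▸ inv_mem (hEc hz))
      rw [DihedralFamily.piHom, MonoidHom.noncommPiCoprod_apply]
      refine Subgroup.noncommProd_mem _ _ fun i _ => ?_
      rcases h3 i with h4 | h4 <;> rw [h4]
      · rw [map_one]; exact one_mem _
      · rw [F.hom_r_two]; exact Subgroup.subset_closure ⟨i, rfl⟩
    have h4 := hVE _ h2 (h1 ▸ inv_mem hz)
    rw [h4, one_mul] at haz
    exact ⟨h4, haz⟩
  · have hcomm : ∀ a (z : E), Commute (F.piHom a) (E.subtype z) := fun a z =>
      Subgroup.mem_center_iff.1 (hEc z.2) _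
    have hrange : (F.piHom.noncommCoprod E.subtype hcomm).range = ⊤ := by
      have hd : ∀ i, d i ∈ F.piHom.range ∧ e i ∈ F.piHom.range := fun i =>
        ⟨⟨_, (F.piHom_mulSingle i _).trans (F.hom_sr_zero i)⟩,
          ⟨_, (F.piHom_mulSingle i _).trans (F.hom_sr_one i)⟩⟩
      rw [MonoidHom.noncommCoprod_range, Subgroup.range_subtype]
      refine F.gen _ (hZ.trans (sup_le_sup_right ?_ E)) fun i =>
        ⟨le_sup_left (α := Subgroup X) (hd i).1, le_sup_left (α := Subgroup X) (hd i).2⟩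
      rw [Subgroup.closure_le]
      rintro _ ⟨i, rfl⟩
      exact ⟨_, (F.piHom_mulSingle i _).trans (F.hom_r_two i)⟩
    obtain ⟨⟨a, z⟩, haz⟩ := MonoidHom.range_eq_top.1 hrange x
    exact ⟨a, z, z.2, haz⟩

/-- A group with a family of pairs is a direct product once the kernel of the map from the direct
power is known. -/
theorem DihedralFamily.exists_equiv [Finite X] (F : DihedralFamily d e v)
    (N : Subgroup (Fin r → D8))
    [N.Normal] (hN : ∀ a, F.piHom a = 1 ↔ a ∈ N) :
    ∃ m, Nonempty (X ≃* CPow 2 m × ((Fin r → D8) ⧸ N)) := by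
  obtain ⟨m, E, ⟨e⟩, hEc, hker, hsurj⟩ := F.exists_equiv_aux
  let f : (Fin r → D8) ⧸ N →* X := QuotientGroup.lift N F.piHom fun a ha => (hN a).2 ha
  have hcomm : ∀ a (z : E), Commute (f a) (E.subtype z) := fun a z =>
    Subgroup.mem_center_iff.1 (hEc z.2) _
  have hbij : Function.Bijective (f.noncommCoprod E.subtype hcomm) := by
    constructor
    · rw [injective_iff_map_eq_one]
      rintro ⟨a, z⟩ haz
      obtain ⟨a, rfl⟩ := QuotientGroup.mk_surjective a
      obtain ⟨h1, h2⟩ := hker a z z.2 haz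
      exact Prod.ext ((QuotientGroup.eq_one_iff a).2 ((hN a).1 h1)) (Subtype.ext h2)
    · intro x
      obtain ⟨a, z, hz, rfl⟩ := hsurj x
      exact ⟨(a, ⟨z, hz⟩), rfl⟩
  exact ⟨m, ⟨(MulEquiv.ofBijective _ hbij).symm.trans
    (MulEquiv.prodComm.trans (MulEquiv.prodCongr e (MulEquiv.refl _)))⟩⟩

theorem noncommPiCoprod_comp {H Z : Type*} [Group H] [CommGroup Z] (φ : Fin r → H →* X)
    (hφ : Pairwise fun i j => ∀ x y, Commute (φ i x) (φ j y)) (f : Z →* H) (g : Z →* X)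
    (h : ∀ i x, φ i (f x) = g x) (z : Fin r → Z) :
    MonoidHom.noncommPiCoprod φ hφ (fun i => f (z i)) = g (∏ i, z i) := by
  rw [MonoidHom.noncommPiCoprod_apply, ← Finset.noncommProd_eq_prod]
  exact (Finset.noncommProd_congr rfl (fun i _ => h i (z i)) _).trans
    (Finset.map_noncommProd _ _ _ g).symm

open scoped IsMulCommutative in
-- All the maps `F.hom i` agree on the center of D_8, since each sends r 2 to the same v.
theorem DihedralFamily.piHom_center {v : X} (F : DihedralFamily d e fun _ => v) (i₀ : Fin r)
    (z : Fin r → Subgroup.center D8) :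
    F.piHom (fun i => z i) = F.hom i₀ (∏ i, z i : Subgroup.center D8) := by
  have h : ∀ (i) (z : Subgroup.center D8),
      F.hom i z = ((F.hom i₀).comp (Subgroup.center D8).subtype) z := by
    intro i z
    have h1 : (z : D8) = 1 ∨ (z : D8) = .r 2 := D8.eq_of_central _ fun y => by
      rw [← Subgroup.mem_center_iff.1 z.2 y]; group
    change F.hom i z = F.hom i₀ z
    rcases h1 with h1 | h1 <;> rw [h1]
    · rw [map_one, map_one]
    · rw [F.hom_r_two, F.hom_r_two]
  exact noncommPiCoprod_comp F.hom F.pairwise_commute (Subgroup.center D8).subtype _ h z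

open scoped IsMulCommutative in
-- Elements of the kernel have central coordinates, on which the map is the product followed by
-- `F.hom i₀`; this is injective on the center because v ≠ 1. The index i₀ ensures that r is
-- positive.
theorem DihedralFamily.piHom_eq_one_iff {v : X} (F : DihedralFamily d e fun _ => v) (i₀ : Fin r)
    (a : Fin r → D8) : F.piHom a = 1 ↔ a ∈ centralN r := by
  constructor
  · intro h
    have h1 := F.eq_of_central (a := a) (h ▸ one_mem _)
    have h2 : ∀ i, a i ∈ Subgroup.center D8 := fun i => by
      have h3 : ∀ y : D8, y * .r 2 = .r 2 * y := by decide
      rw [Subgroup.mem_center_iff]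
      rcases h1 i with h4 | h4 <;> rw [h4]
      · simp
      · exact h3
    refine ⟨fun i => ⟨a i, h2 i⟩, fun _ => rfl, ?_⟩
    have h3 := F.piHom_center i₀ fun i => ⟨a i, h2 i⟩
    change F.piHom a = _ at h3
    rw [h] at h3
    generalize (∏ i, (⟨a i, h2 i⟩ : Subgroup.center D8)) = w at h3 ⊢
    have h4 : (w : D8) = 1 ∨ (w : D8) = .r 2 := D8.eq_of_central _ fun y => by
      rw [← Subgroup.mem_center_iff.1 w.2 y]; group
    rcases h4 with h4 | h4
    · exact Subtype.ext h4
    · rw [h4, F.hom_r_two] at h3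
      exact absurd h3.symm (F.v_ne i₀)
  · rintro ⟨z, hz, hz1⟩
    obtain rfl : (fun i => (z i : D8)) = a := funext hz
    rw [F.piHom_center i₀, hz1]
    exact map_one _

theorem DihedralFamily.exists_equiv_centralProduct [Finite X] {v : X}
    (F : DihedralFamily d e fun _ => v) (i₀ : Fin r) :
    ∃ m, Nonempty (X ≃* CPow 2 m × CentralProductD8 r) :=
  F.exists_equiv (centralN r) (F.piHom_eq_one_iff i₀)

theorem DihedralFamily.exists_equiv_prod [Finite X] {d e v : Fin 2 → X}
    (F : DihedralFamily d e v) (hv : v 0 ≠ v 1) :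
    ∃ m, Nonempty (X ≃* CPow 2 m × (D8 × D8)) := by
  obtain ⟨m, ⟨f⟩⟩ := F.exists_equiv ⊥ fun a => by
    rw [Subgroup.mem_bot]
    refine ⟨fun h => ?_, fun h => by rw [h, map_one]⟩
    have h1 := F.eq_of_central (a := a) (h ▸ one_mem _)
    have h2 : a = Pi.mulSingle 0 (a 0) * Pi.mulSingle 1 (a 1) := by
      funext i; fin_cases i <;> simp
    have h3 : F.hom 0 (a 0) * F.hom 1 (a 1) = 1 := by
      rw [← F.piHom_mulSingle, ← F.piHom_mulSingle, ← map_mul, ← h2, h]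
    rcases h1 0 with h4 | h4 <;> rcases h1 1 with h5 | h5 <;> rw [h4, h5] at h3
    · rw [h2, h4, h5]; simp
    · rw [map_one, one_mul, F.hom_r_two] at h3
      exact absurd h3 (F.v_ne 1)
    · rw [map_one, mul_one, F.hom_r_two] at h3
      exact absurd h3 (F.v_ne 0)
    · rw [F.hom_r_two, F.hom_r_two] at h3
      exact absurd (mul_left_cancel ((F.v_sq 0).trans h3.symm)) hv
  exact ⟨m, ⟨f.trans (MulEquiv.prodCongr (MulEquiv.refl _)
    (QuotientGroup.quotientBot.trans
      { piFinTwoEquiv fun _ => D8 with map_mul' := fun _ _ => rfl }))⟩⟩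

end Family
end CyclicRatio

/-! ### Abelian groups with α > 1/2 -/

namespace CyclicRatio

section Totient

/-- For n > 2 the totient is even, hence 2. Totients of divisors of n then divide 2, which excludes
primes above 3 and the divisors 8, 9 and 12. -/
theorem dvd_of_totient_lt_four {n : ℕ} (hn : n ≠ 0) (h : n.totient < 4) : n ∣ 4 ∨ n ∣ 6 := by
  rcases Nat.lt_or_ge 2 n with h2 | h2
  swap
  · left; interval_cases n <;> simp_all
  have hφ : n.totient = 2 := by
    have h1 := Nat.totient_even h2
    have h3 : 0 < n.totient := Nat.totient_pos.2 (by omega)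
    obtain ⟨k, hk⟩ := h1
    omega
  have hd : ∀ m, m ∣ n → m.totient ∣ 2 := fun m hm => hφ ▸ Nat.totient_dvd_of_dvd hm
  have hp : ∀ p, p.Prime → p ∣ n → p = 2 ∨ p = 3 := by
    intro p pp hpn
    have h1 := Nat.le_of_dvd (by norm_num) (hd p hpn)
    rw [Nat.totient_prime pp] at h1
    have := pp.two_le
    omega
  have h8 : ¬ 8 ∣ n := fun h => absurd (hd 8 h) (by decide)
  have h12 : ¬ 12 ∣ n := fun h => absurd (hd 12 h) (by decide)
  have h9 : ¬ 9 ∣ n := fun h => absurd (hd 9 h) (by decide)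
  by_cases h4 : 4 ∣ n
  · left
    obtain ⟨k, rfl⟩ := h4
    by_cases hk : k = 1
    · simp [hk]
    obtain ⟨p, pp, q, rfl⟩ := Nat.exists_prime_and_dvd hk
    rcases hp p pp (dvd_mul_of_dvd_right (dvd_mul_right p q) 4) with rfl | rfl
    · exact absurd ⟨q, by ring⟩ h8
    · exact absurd ⟨q, by ring⟩ h12
  · right
    rw [Nat.dvd_iff_prime_pow_dvd_dvd]
    intro p k pp hpk
    rcases k with - | - | k
    · simp
    · rcases hp p pp (by simpa using hpk) with rfl | rfl <;> norm_num
    · have h1 : p ^ 2 ∣ n := (pow_dvd_pow p (by omega)).trans hpk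
      rcases hp p pp ((dvd_pow_self p two_ne_zero).trans h1) with rfl | rfl
      · exact absurd h1 h4
      · exact absurd h1 h9

open scoped Classical in
theorem inv_totient_le {G : Type*} [Group G] [Finite G] (g : G) :
    ((orderOf g).totient : ℚ)⁻¹ ≤ 1 / 2 + (if g * g = 1 then 1 / 2 else 0) -
      (if g ^ 4 ≠ 1 ∧ g ^ 6 ≠ 1 then 1 / 4 else 0) := by
  have hpos : 0 < (orderOf g).totient := Nat.totient_pos.2 (orderOf_pos g)
  by_cases h1 : g * g = 1
  · have h4 : g ^ 4 = 1 := by rw [show 4 = 2 * 2 from rfl, pow_mul, pow_two g, h1, one_pow]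
    rw [(totient_le_one_iff_mul_self g).2 h1]
    rw [if_pos h1, if_neg fun h => h.1 h4]; norm_num
  · have h2 : (orderOf g).totient ≠ 1 := fun h => h1 ((totient_le_one_iff_mul_self g).1 h)
    by_cases hq : g ^ 4 ≠ 1 ∧ g ^ 6 ≠ 1
    · have h4 : 4 ≤ (orderOf g).totient := by
        by_contra! h
        rcases dvd_of_totient_lt_four (orderOf_pos g).ne' h with h | h
        · exact hq.1 (orderOf_dvd_iff_pow_eq_one.1 h)
        · exact hq.2 (orderOf_dvd_iff_pow_eq_one.1 h)
      rw [if_neg h1, if_pos hq]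
      calc ((orderOf g).totient : ℚ)⁻¹ ≤ (4 : ℚ)⁻¹ :=
            inv_anti₀ (by norm_num) (by exact_mod_cast h4)
        _ ≤ _ := by norm_num
    · rw [if_neg h1, if_neg hq]
      calc ((orderOf g).totient : ℚ)⁻¹ ≤ (2 : ℚ)⁻¹ :=
            inv_anti₀ (by norm_num) (by exact_mod_cast (by omega : 2 ≤ (orderOf g).totient))
        _ ≤ _ := by norm_num

/-- A finite commutative group with more than half as many cyclic subgroups as elements has
exponent dividing `4` or `6`. -/
theorem pow_four_or_pow_six {A : Type*} [CommGroup A] [Finite A] (h : 1 / 2 < alpha A) :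
    (∀ a : A, a ^ 4 = 1) ∨ ∀ a : A, a ^ 6 = 1 := by
  classical
  have : Fintype A := Fintype.ofFinite A
  by_contra! hc
  obtain ⟨⟨a, ha⟩, b, hb⟩ := hc
  -- If neither a nor b serves, then a⁶ = 1 and b⁴ = 1, and a * b does.
  obtain ⟨q, hq4, hq6⟩ : ∃ q : A, q ^ 4 ≠ 1 ∧ q ^ 6 ≠ 1 := by
    by_cases ha6 : a ^ 6 = 1
    · by_cases hb4 : b ^ 4 = 1
      · exact ⟨a * b, by rwa [mul_pow, hb4, mul_one], by rwa [mul_pow, ha6, one_mul]⟩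
      · exact ⟨b, hb4, hb⟩
    · exact ⟨a, ha, ha6⟩
  let E := Finset.univ.filter fun a : A => a * a = 1
  let Q := Finset.univ.filter fun a : A => a ^ 4 ≠ 1 ∧ a ^ 6 ≠ 1
  -- The translates qE and q⁻¹E lie in Q and are disjoint because q⁴ ≠ 1. The surplus 1/2 on each
  -- element of E is then cancelled by the loss 1/4 on each element of Q.
  have hEQ : 2 * E.card ≤ Q.card := by
    have hpow : ∀ e ∈ E, e ^ 4 = 1 ∧ e ^ 6 = 1 := fun e he => by
      have he2 : e ^ 2 = 1 := by rw [pow_two]; exact (Finset.mem_filter.1 he).2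
      exact ⟨by rw [show 4 = 2 * 2 from rfl, pow_mul, he2, one_pow],
        by rw [show 6 = 2 * 3 from rfl, pow_mul, he2, one_pow]⟩
    have hdis : Disjoint (E.image (q * ·)) (E.image (q⁻¹ * ·)) := by
      rw [Finset.disjoint_left]
      rintro x hx hx'
      obtain ⟨e, he, rfl⟩ := Finset.mem_image.1 hx
      obtain ⟨e', he', h1⟩ := Finset.mem_image.1 hx'
      have h2 : q ^ 2 * e = e' := by
        rw [pow_two, mul_assoc]
        exact (eq_inv_mul_iff_mul_eq.1 h1.symm)
      have h3 : (q ^ 2 * e) * (q ^ 2 * e) = 1 := by rw [h2]; exact (Finset.mem_filter.1 he').2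
      rw [mul_mul_mul_comm, (Finset.mem_filter.1 he).2, mul_one, ← pow_add] at h3
      exact hq4 h3
    have hsub : E.image (q * ·) ∪ E.image (q⁻¹ * ·) ⊆ Q := by
      intro x hx
      rcases Finset.mem_union.1 hx with hx | hx <;> obtain ⟨e, he, rfl⟩ := Finset.mem_image.1 hx <;>
        obtain ⟨h4, h6⟩ := hpow e he
      · simpa [Q, mul_pow, h4, h6] using ⟨hq4, hq6⟩
      · simpa [Q, mul_pow, h4, h6] using ⟨hq4, hq6⟩
    calc 2 * E.card = (E.image (q * ·) ∪ E.image (q⁻¹ * ·)).card := by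
          rw [Finset.card_union_of_disjoint hdis, Finset.card_image_of_injective _
            (mul_right_injective q), Finset.card_image_of_injective _ (mul_right_injective q⁻¹),
            two_mul]
      _ ≤ Q.card := Finset.card_le_card hsub
  have hsum : ∑ a : A, ((orderOf a).totient : ℚ)⁻¹ ≤
      Fintype.card A / 2 + E.card / 2 - Q.card / 4 := by
    refine (Finset.sum_le_sum fun a _ => inv_totient_le a).trans (le_of_eq ?_)
    rw [Finset.sum_sub_distrib, Finset.sum_add_distrib, ← Finset.sum_filter, ← Finset.sum_filter]
    simp only [Finset.sum_const, nsmul_eq_mul, Finset.card_univ, E, Q]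
    ring
  have hpos : (0 : ℚ) < Fintype.card A := by exact_mod_cast Fintype.card_pos
  rw [alpha_eq_sum, lt_div_iff₀ hpos] at h
  have h2 : (2 * E.card : ℚ) ≤ Q.card := by exact_mod_cast hEQ
  linarith

theorem alpha_eq_of_subgroup {X : Type*} [Group X] [Finite X] {A : Subgroup X}
    (hcard : Nat.card X = 2 * Nat.card A) (h : ∀ x ∉ A, x * x = 1) :
    alpha X = (alpha A + 1) / 2 := by
  classical
  have : Fintype X := Fintype.ofFinite X
  have hpos : (0 : ℚ) < Fintype.card A := by exact_mod_cast Fintype.card_pos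
  rw [Nat.card_eq_fintype_card, Nat.card_eq_fintype_card] at hcard
  have h2 : Fintype.card {x // x ∉ A} = Fintype.card A := by
    have := Fintype.card_subtype_compl (fun x => x ∈ A)
    have h3 : Fintype.card {x // x ∈ A} = Fintype.card A := rfl
    omega
  have h3 : ∑ x : {x // x ∉ A}, ((orderOf (x : X)).totient : ℚ)⁻¹ = Fintype.card A := by
    rw [Finset.sum_congr rfl fun x _ => by
      rw [(totient_le_one_iff_mul_self (x : X)).2 (h x x.2), Nat.cast_one, inv_one],
      Finset.sum_const, Finset.card_univ, h2, nsmul_one]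
  have h4 : ∑ x : {x // x ∈ A}, ((orderOf (x : X)).totient : ℚ)⁻¹ =
      ∑ a : A, ((orderOf a).totient : ℚ)⁻¹ :=
    Finset.sum_congr rfl fun a _ => by rw [Subgroup.orderOf_coe]
  rw [alpha_eq_sum, alpha_eq_sum, hcard, ← Fintype.sum_subtype_add_sum_subtype (· ∈ A), h3, h4]
  push_cast
  field_simp

end Totient

section Abelian

theorem exists_equiv_of_pow_six {A : Type*} [CommGroup A] [Finite A] (h : ∀ a : A, a ^ 6 = 1) :
    ∃ m n, Nonempty (CPow 2 m × CPow 3 n ≃* A) := by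
  obtain ⟨m, ⟨f⟩⟩ := exists_equiv_cpow (p := 2) (E := (powMonoidHom 2 : A →* A).ker)
    fun e => Subtype.ext e.2
  obtain ⟨n, ⟨g⟩⟩ := exists_equiv_cpow (p := 3) (E := (powMonoidHom 3 : A →* A).ker)
    fun e => Subtype.ext e.2
  refine ⟨m, n, ⟨(MulEquiv.prodCongr f.symm g.symm).trans
    { toFun := fun p => p.1 * p.2
      -- The components multiply back to a because a³ a⁴ = a⁷ = a.
      invFun := fun a => (⟨a ^ 3, ?_⟩, ⟨a ^ 4, ?_⟩)
      left_inv := fun p => ?_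
      right_inv := fun a => ?_
      map_mul' := fun p q => ?_ }⟩⟩
  · change (a ^ 3) ^ 2 = 1
    rw [← pow_mul, h]
  · change (a ^ 4) ^ 3 = 1
    rw [← pow_mul, show 4 * 3 = 6 * 2 from rfl, pow_mul, h, one_pow]
  · have h1 : (p.1 : A) ^ 2 = 1 := p.1.2
    have h2 : (p.2 : A) ^ 3 = 1 := p.2.2
    refine Prod.ext (Subtype.ext ?_) (Subtype.ext ?_)
    · change ((p.1 : A) * p.2) ^ 3 = p.1
      rw [mul_pow, h2, pow_succ, h1, one_mul, mul_one]
    · change ((p.1 : A) * p.2) ^ 4 = p.2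
      rw [mul_pow, pow_succ (p.2 : A), h2, show 4 = 2 * 2 from rfl, pow_mul, h1, one_pow, one_mul,
        one_mul]
  · change a ^ 3 * a ^ 4 = a
    rw [← pow_add, pow_succ, h, one_mul]
  · change ((p.1 : A) * q.1) * (p.2 * q.2) = p.1 * p.2 * (q.1 * q.2)
    exact mul_mul_mul_comm _ _ _ _

theorem exists_equiv_of_pow_four {A : Type*} [CommGroup A] [Finite A] (h : ∀ a : A, a ^ 4 = 1) :
    ∃ m n, Nonempty (CPow 2 m × CPow 4 n ≃* A) := by
  classical
  obtain ⟨ι, _, n, hn, ⟨e⟩⟩ := CommGroup.equiv_prod_multiplicative_zmod_of_finite A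
  have hn4 : ∀ i, n i = 2 ∨ n i = 4 := by
    intro i
    have h1 := h (e.symm (Pi.mulSingle i (Multiplicative.ofAdd 1)))
    rw [← map_pow, MulEquiv.map_eq_one_iff, ← Pi.mulSingle_pow, Pi.mulSingle_eq_one_iff,
      ← ofAdd_nsmul, ofAdd_eq_one, nsmul_one, ZMod.natCast_eq_zero_iff] at h1
    have h2 := Nat.le_of_dvd (by norm_num) h1
    have h3 := hn i
    interval_cases n i <;> simp_all
  have key : ∀ (k : ℕ) (p : ι → Prop) (_ : ∀ i, p i → n i = k),
      Nonempty ((∀ i : {i // p i}, Multiplicative (ZMod (n i))) ≃*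
        CPow k (Fintype.card {i // p i})) :=
    fun k p hp =>
      ⟨(MulEquiv.piCongrRight fun i : {i // p i} =>
          (ZMod.ringEquivCongr (hp i i.2)).toAddEquiv.toMultiplicative).trans
        (MulEquiv.arrowCongr (Fintype.equivFin _) (MulEquiv.refl _))⟩
  obtain ⟨f⟩ := key 2 (fun i => n i = 2) fun _ h => h
  obtain ⟨g⟩ := key 4 (fun i => ¬ n i = 2) fun i h => (hn4 i).resolve_left h
  exact ⟨_, _, ⟨(e.trans (MulEquiv.trans
    { Equiv.piEquivPiSubtypeProd (fun i => n i = 2) fun i => Multiplicative (ZMod (n i)) with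
      map_mul' := fun _ _ => rfl } (MulEquiv.prodCongr f g))).symm⟩⟩

end Abelian
end CyclicRatio

/-! ### Abelian subgroups of index two -/

namespace CyclicRatio

section Semidirect

theorem C_two_eq (s : C 2) : s = 1 ∨ s = Multiplicative.ofAdd 1 := by
  decide +revert

theorem involutionHom_gen {M : Type*} [Group M] (g : M) (hg : g * g = 1) :
    involutionHom g hg (Multiplicative.ofAdd 1) = g :=
  if_neg (c := Multiplicative.ofAdd (1 : ZMod 2) = 1) (t := 1) (by decide)

/-- A group with a subgroup `A` of index two and an involution outside `A` is a direct product of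
a group and a semidirect product when `A` decomposes accordingly. -/
theorem exists_equiv_prod_semidirect {X E M : Type*} [Group X] [Group E] [Group M]
    {A : Subgroup X} (f : E × M ≃* A) {φ : MulAut M} (hφ : φ * φ = 1) {t : X} (ht : t * t = 1)
    (htA : t ∉ A) (hA : ∀ x ∉ A, x * t ∈ A)
    (hE : ∀ z, t * (f (z, 1) : X) = (f (z, 1) : X) * t)
    (hM : ∀ a, t * (f (1, a) : X) * t = f (1, φ a)) :
    Nonempty (X ≃* E × (M ⋊[involutionHom φ hφ] C 2)) := by
  let j : M →* X := A.subtype.comp (f.toMonoidHom.comp (MonoidHom.inr E M))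
  let k : E →* X := A.subtype.comp (f.toMonoidHom.comp (MonoidHom.inl E M))
  let s : C 2 →* X := involutionHom t ht
  have hs : s (Multiplicative.ofAdd 1) = t := involutionHom_gen t ht
  let l : M ⋊[involutionHom φ hφ] C 2 →* X := SemidirectProduct.lift j s fun c => by
    ext a
    rcases C_two_eq c with rfl | rfl
    · simp
    · change j (involutionHom φ hφ (Multiplicative.ofAdd 1) a) =
        s (Multiplicative.ofAdd 1) * j a * (s (Multiplicative.ofAdd 1))⁻¹
      rw [involutionHom_gen, hs, inv_eq_of_mul_eq_one_left ht]
      exact (hM a).symm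
  have hkj : ∀ z a, k z * j a = f (z, a) := fun z a => by
    change (f (z, 1) : X) * f (1, a) = f (z, a)
    rw [← Subgroup.coe_mul, ← map_mul, Prod.mk_mul_mk, mul_one, one_mul]
  have hjk : ∀ z a, j a * k z = f (z, a) := fun z a => by
    change (f (1, a) : X) * f (z, 1) = f (z, a)
    rw [← Subgroup.coe_mul, ← map_mul, Prod.mk_mul_mk, mul_one, one_mul]
  have hl : ∀ x, l x = j x.left * s x.right := fun x => rfl
  have hcomm : ∀ z x, Commute (k z) (l x) := by
    intro z x
    rw [hl]
    refine Commute.mul_right ((hkj z x.left).trans (hjk z x.left).symm) ?_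
    rcases C_two_eq x.right with h | h <;> rw [h]
    · rw [map_one]; exact Commute.one_right _
    · rw [hs]; exact (hE z).symm
  have hbij : Function.Bijective (k.noncommCoprod l hcomm) := by
    constructor
    · rw [injective_iff_map_eq_one]
      rintro ⟨z, ⟨a, c⟩⟩ h
      have h1 : k z * (j a * s c) = 1 := h
      rw [← mul_assoc, hkj] at h1
      rcases C_two_eq c with rfl | rfl
      · rw [map_one, mul_one] at h1
        have h2 : f (z, a) = 1 := Subtype.ext h1
        rw [MulEquiv.map_eq_one_iff, Prod.mk_eq_one] at h2
        rw [h2.1, h2.2]; rfl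
      · rw [hs] at h1
        exact absurd (eq_inv_of_mul_eq_one_right h1 ▸ inv_mem (f (z, a)).2) htA
    · have hsurj : ∀ y : A, ∃ z a, k z * j a = y := fun y =>
        ⟨(f.symm y).1, (f.symm y).2, by rw [hkj, f.apply_symm_apply]⟩
      intro x
      by_cases hx : x ∈ A
      · obtain ⟨z, a, h⟩ := hsurj ⟨x, hx⟩
        refine ⟨(z, ⟨a, 1⟩), ?_⟩
        change k z * (j a * s 1) = x
        rw [map_one, mul_one, h]
      · obtain ⟨z, a, h⟩ := hsurj ⟨x * t, hA x hx⟩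
        refine ⟨(z, ⟨a, Multiplicative.ofAdd 1⟩), ?_⟩
        change k z * (j a * s (Multiplicative.ofAdd 1)) = x
        rw [hs, ← mul_assoc, h, mul_assoc, ht, mul_one]
  exact ⟨(MulEquiv.ofBijective _ hbij).symm⟩

/-- Shows that a model with parameter 0 is elementary abelian, so that the parameters in the
classification can be taken positive. -/
theorem mul_self_of_subsingleton {E M : Type*} [Group E] [Group M] [Subsingleton M]
    {φ : C 2 →* MulAut M} (hE : ∀ z : E, z * z = 1) (x : E × (M ⋊[φ] C 2)) : x * x = 1 := by
  refine Prod.ext (hE _) (SemidirectProduct.ext (Subsingleton.elim _ _) ?_)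
  have : ∀ s : C 2, s * s = 1 := by decide
  exact this _

theorem exists_equiv_invSemidirect {X M : Type*} [Group X] [CommGroup M] {A : Subgroup X} {m : ℕ}
    (f : CPow 2 m × M ≃* A) {t : X} (ht : t * t = 1) (htA : t ∉ A) (hA : ∀ x ∉ A, x * t ∈ A)
    (hinv : ∀ a ∈ A, t * a * t = a⁻¹) :
    Nonempty (X ≃* CPow 2 m × InvSemidirect M) := by
  refine exists_equiv_prod_semidirect f _ ht htA hA (fun z => ?_) fun a => ?_
  · have h1 : (f (z, 1) : X)⁻¹ = f (z, 1) := by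
      rw [← Subgroup.coe_inv, ← map_inv, Prod.inv_mk, inv_one,
        inv_eq_of_mul_eq_one_left (cpow_two_mul_self z)]
    have h2 := hinv _ (f (z, 1)).2
    rw [h1] at h2
    rw [← eq_mul_inv_iff_mul_eq, inv_eq_of_mul_eq_one_left ht] at h2
    exact h2
  · rw [hinv _ (f (1, a)).2, ← Subgroup.coe_inv, ← map_inv, Prod.inv_mk, inv_one]
    rfl

end Semidirect

section Shear

theorem exists_shear_equiv {W : Type*} [AddCommGroup W] [Module (ZMod 2) W] [Finite W]
    (N : W →ₗ[ZMod 2] W) (hN : ∀ w, N (N w) = 0) :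
    ∃ m r, ∃ f : ((Fin m → ZMod 2) × ((Fin r → ZMod 2) × (Fin r → ZMod 2))) ≃ₗ[ZMod 2] W,
      ∀ z a b, N (f (z, (a, b))) = f (0, (0, a)) := by
  have : Module.Finite (ZMod 2) W := Module.Finite.of_finite
  obtain ⟨U, hU⟩ := exists_isCompl (LinearMap.ker N)
  obtain ⟨P, hP⟩ := exists_isCompl (LinearMap.range N)
  -- Since N² = 0, the image lies in the kernel, and Z complements it there. So W = Z ⊕ U ⊕ N(U),
  -- with N mapping U isomorphically onto N(U).
  let Z := P ⊓ LinearMap.ker N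
  let bZ := Module.finBasis (ZMod 2) Z
  let bU := Module.finBasis (ZMod 2) U
  let iZ : (Fin _ → ZMod 2) →ₗ[ZMod 2] W := Z.subtype ∘ₗ bZ.equivFun.symm.toLinearMap
  let iU : (Fin _ → ZMod 2) →ₗ[ZMod 2] W := U.subtype ∘ₗ bU.equivFun.symm.toLinearMap
  let F := iZ.coprod (iU.coprod (N ∘ₗ iU))
  have hF : ∀ z a b, F (z, (a, b)) = iZ z + (iU a + N (iU b)) := fun z a b => by
    simp [F, LinearMap.coprod_apply]
  have hNZ : ∀ z, N (iZ z) = 0 := fun z => (bZ.equivFun.symm z).2.2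
  have hNF : ∀ z a b, N (F (z, (a, b))) = N (iU a) := fun z a b => by
    rw [hF, map_add, map_add, hNZ, hN, zero_add, add_zero]
  have hU0 : ∀ a, N (iU a) = 0 → a = 0 := fun a ha => by
    have h1 : iU a = 0 := Submodule.disjoint_def.1 hU.disjoint _ ha (bU.equivFun.symm a).2
    exact bU.equivFun.symm.map_eq_zero_iff.1 (Subtype.ext h1)
  have hUs : ∀ w, ∃ a, N (iU a) = N w := fun w => by
    obtain ⟨k, hk, c, hc, rfl⟩ := Submodule.mem_sup.1 (hU.sup_eq_top ▸ Submodule.mem_top : w ∈ _)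
    refine ⟨bU.equivFun ⟨c, hc⟩, ?_⟩
    rw [map_add, LinearMap.mem_ker.1 hk, zero_add]
    simp [iU]
  have hbij : Function.Bijective F := by
    constructor
    · rw [injective_iff_map_eq_zero]
      rintro ⟨z, a, b⟩ h
      have ha : a = 0 := hU0 a (by rw [← hNF z a b, h, map_zero])
      rw [hF, ha, map_zero, zero_add] at h
      have h1 : iZ z = 0 := Submodule.disjoint_def.1 hP.disjoint _
        (eq_neg_of_add_eq_zero_left h ▸ neg_mem ⟨_, rfl⟩) (bZ.equivFun.symm z).2.1
      have hz : z = 0 := bZ.equivFun.symm.map_eq_zero_iff.1 (Subtype.ext h1)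
      rw [h1, zero_add] at h
      rw [ha, hz, hU0 b h]; rfl
    · intro w
      obtain ⟨a, ha⟩ := hUs w
      have hk : N (w - iU a) = 0 := by rw [map_sub, ha, sub_self]
      obtain ⟨_, ⟨w', rfl⟩, p, hp, h1⟩ := Submodule.mem_sup.1
        (hP.sup_eq_top ▸ Submodule.mem_top : w - iU a ∈ _)
      obtain ⟨b, hb⟩ := hUs w'
      have hpZ : N p = 0 := by rw [← h1, map_add, hN, zero_add] at hk; exact hk
      refine ⟨(bZ.equivFun ⟨p, hp, hpZ⟩, (a, b)), ?_⟩
      have h2 : iZ (bZ.equivFun ⟨p, hp, hpZ⟩) = p := by simp [iZ]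
      rw [hF, h2, hb, ← sub_add_cancel w (iU a), ← h1]
      abel
  refine ⟨_, _, LinearEquiv.ofBijective F hbij, fun z a b => ?_⟩
  change N (F _) = F _
  rw [hNF, hF, map_zero, map_zero, zero_add, zero_add]

/-- Over 𝔽_2 the map ν is conjugation by t plus the identity, so ν² = 0 because t² = 1. The normal
form of ν exhibits t as a shear. -/
theorem exists_equiv_shearSemidirect {X : Type*} [Group X] [Finite X] {A : Subgroup X}
    (hA2 : ∀ a ∈ A, a * a = 1) {t : X} (ht : t * t = 1) (htA : t ∉ A)
    (hA : ∀ x ∉ A, x * t ∈ A) (htt : ∀ a ∈ A, t * a * t ∈ A) :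
    ∃ m r, Nonempty (X ≃* CPow 2 m × ShearSemidirect r) := by
  have hsq : ∀ a : A, a * a = 1 := fun a => Subtype.ext (hA2 a a.2)
  let _ : CommGroup A := commGroupOfSq hsq
  let _ : Module (ZMod 2) (Additive A) := AddCommGroup.zmodModule (n := 2) fun x => by
    rw [two_nsmul]; exact hsq x
  let ν : A →* A :=
    { toFun := fun a => ⟨t * a * t, htt a a.2⟩ * a
      map_one' := Subtype.ext (by simp [ht])
      map_mul' := fun a b => by
        rw [mul_mul_mul_comm]
        exact congrArg (· * (a * b)) (Subtype.ext (conj_mul_of_sq ht (a : X) b)) }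
  have hν : ∀ a, ν (ν a) = 1 := fun a => by
    have h1 : (⟨t * ν a * t, htt _ (ν a).2⟩ : A) = a * ⟨t * a * t, htt a a.2⟩ := by
      refine Subtype.ext ?_
      change t * (t * a * t * a) * t = a * (t * a * t)
      rw [conj_mul_of_sq ht]
      have h2 : t * (t * a * t) * t = (t * t) * a * (t * t) := by group
      rw [h2, ht, one_mul, mul_one]
    change (⟨t * ν a * t, htt _ (ν a).2⟩ : A) * ((⟨t * a * t, htt a a.2⟩ : A) * a) = 1
    rw [h1, mul_comm _ a, hsq]
  obtain ⟨m, r, f, hf⟩ := exists_shear_equiv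
    (AddMonoidHom.toZModLinearMap 2 (MonoidHom.toAdditive ν)) hν
  let g : CPow 2 m × V r ≃* A :=
    { toFun := fun p => (f (fun i => (p.1 i).toAdd, p.2.toAdd)).toMul
      invFun := fun a => (fun i => Multiplicative.ofAdd ((f.symm (Additive.ofMul a)).1 i),
        Multiplicative.ofAdd (f.symm (Additive.ofMul a)).2)
      left_inv := fun p => by simp
      right_inv := fun a => f.apply_symm_apply (Additive.ofMul a)
      map_mul' := fun p q => f.map_add (fun i => (p.1 i).toAdd, p.2.toAdd)
        (fun i => (q.1 i).toAdd, q.2.toAdd) }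
  have hg : ∀ z x, ν (g (z, x)) = g (1, Multiplicative.ofAdd (0, x.toAdd.1)) := fun z x =>
    hf (fun i => (z i).toAdd) x.toAdd.1 x.toAdd.2
  have hconj : ∀ z x, t * (g (z, x) : X) * t =
      g (z, Multiplicative.ofAdd (0, x.toAdd.1) * x) := fun z x => by
    have h1 : t * (g (z, x) : X) * t * g (z, x) = ν (g (z, x)) := rfl
    rw [← eq_mul_inv_iff_mul_eq, inv_eq_of_mul_eq_one_left (hA2 _ (g (z, x)).2), hg,
      ← Subgroup.coe_mul, ← map_mul, Prod.mk_mul_mk, one_mul] at h1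
    exact h1
  refine ⟨m, r, exists_equiv_prod_semidirect g _ ht htA hA (fun z => ?_) fun x => ?_⟩
  · have h1 := hconj z 1
    rw [← eq_mul_inv_iff_mul_eq, inv_eq_of_mul_eq_one_left ht] at h1
    exact h1
  · rw [hconj]
    congr 3
    refine Multiplicative.toAdd.injective (Prod.ext ?_ rfl)
    exact zero_add _

end Shear

section IndexTwo

variable {X : Type*} [Group X] [Finite X]

/-- The elements of a commutative subgroup which are sent to their inverse by conjugation with an
element squaring to `1`. -/
def invertedIn (A : Subgroup X) (hcomm : ∀ a ∈ A, ∀ b ∈ A, a * b = b * a) {t : X}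
    (ht : t * t = 1) : Subgroup X where
  carrier := {a | a ∈ A ∧ t * a * t = a⁻¹}
  one_mem' := ⟨A.one_mem, by simp [ht]⟩
  mul_mem' := fun {a b} ha hb => ⟨A.mul_mem ha.1 hb.1, by
    rw [conj_mul_of_sq ht, ha.2, hb.2, ← mul_inv_rev, hcomm b hb.1 a ha.1]⟩
  inv_mem' := fun {a} ha => ⟨A.inv_mem ha.1, by rw [conj_inv_of_sq ht, ha.2]⟩

/-- Solutions of g² = 1 inside A form the subgroup S, and g ↦ g * t sends those outside A into the
subgroup B inverted by t. If both were proper in A, there would be at most |A| = |X|/2 solutions. -/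
theorem index_two_dichotomy {A : Subgroup X} (hcomm : ∀ a ∈ A, ∀ b ∈ A, a * b = b * a)
    (hX : Nat.card X < 2 * numInvol X) (hcard : Nat.card X = 2 * Nat.card A) {t : X}
    (ht : t * t = 1) (hA : ∀ x ∉ A, x * t ∈ A) :
    (∀ a ∈ A, a * a = 1) ∨ ∀ a ∈ A, t * a * t = a⁻¹ := by
  by_contra! hc
  obtain ⟨⟨a, haA, ha⟩, b, hbA, hb⟩ := hc
  let S := invertedIn A hcomm (one_mul (1 : X))
  let B := invertedIn A hcomm ht
  have hS : 2 * Nat.card S ≤ Nat.card A := two_mul_card_le_of_mem (fun _ h => h.1) haA fun h => by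
    have h1 := h.2
    rw [one_mul, mul_one] at h1
    exact ha (mul_eq_one_iff_eq_inv.2 h1)
  have hB : 2 * Nat.card B ≤ Nat.card A := two_mul_card_le_of_mem (fun _ h => h.1) hbA fun h =>
    hb h.2
  have hI : numInvol X ≤ Nat.card S + Nat.card B := by
    classical
    rw [← Nat.card_sum, numInvol]
    have hmem : ∀ g : {g : X // g * g = 1}, g.1 ∈ A → g.1 ∈ S := fun g hg =>
      ⟨hg, by rw [one_mul, mul_one]; exact mul_eq_one_iff_eq_inv.1 g.2⟩
    have hmem' : ∀ g : {g : X // g * g = 1}, g.1 ∉ A → g.1 * t ∈ B := fun g hg =>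
      ⟨hA _ hg, by
        rw [mul_inv_rev, inv_eq_of_mul_eq_one_left ht, inv_eq_of_mul_eq_one_left g.2, mul_assoc,
          mul_assoc, ht, mul_one]⟩
    refine Nat.card_le_card_of_injective (β := S ⊕ B) (fun g => if h : g.1 ∈ A
      then Sum.inl ⟨g.1, hmem g h⟩ else Sum.inr ⟨g.1 * t, hmem' g h⟩) fun g g' h => ?_
    dsimp only at h
    split_ifs at h
    · exact Subtype.ext (by simpa using h)
    · exact Subtype.ext (by simpa using h)
  omega

/-- Inside an abelian subgroup the solutions of x² = 1 form a subgroup; containing more than half of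
X, it is X. -/
theorem mul_self_of_involutions_mem {A : Subgroup X} (hcomm : ∀ a ∈ A, ∀ b ∈ A, a * b = b * a)
    (hX : Nat.card X < 2 * numInvol X) (h : ∀ x : X, x * x = 1 → x ∈ A) (x : X) : x * x = 1 := by
  let S := invertedIn A hcomm (one_mul (1 : X))
  by_contra hx
  have hxS : x ∉ S := fun h => by
    have h1 := h.2
    rw [one_mul, mul_one] at h1
    exact hx (mul_eq_one_iff_eq_inv.2 h1)
  have h1 := two_mul_card_le_of_mem (B := S) (M := ⊤) le_top (Subgroup.mem_top x) hxS
  rw [Subgroup.card_top] at h1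
  have h2 : numInvol X ≤ Nat.card S := by
    refine Nat.card_le_card_of_injective (β := S) (fun g => ⟨g.1, h g.1 g.2, ?_⟩) fun g g' h => ?_
    · rw [one_mul, mul_one]; exact mul_eq_one_iff_eq_inv.1 g.2
    · exact Subtype.ext (congrArg (fun s : S => (s : X)) h)
  omega

theorem equiv_of_comm_subgroup {A : Subgroup X} (hcomm : ∀ a ∈ A, ∀ b ∈ A, a * b = b * a)
    (hcard : Nat.card X ≤ 2 * Nat.card A) (hα : 3 / 4 < alpha X) :
    (∀ x : X, x * x = 1) ∨
      (∃ m r, 1 ≤ r ∧ Nonempty (X ≃* CPow 2 m × ShearSemidirect r)) ∨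
      (∃ m n, 1 ≤ n ∧ Nonempty (X ≃* CPow 2 m × InvSemidirect (CPow 3 n))) ∨
      ∃ m n, 1 ≤ n ∧ Nonempty (X ≃* CPow 2 m × InvSemidirect (CPow 4 n)) := by
  have hX := card_lt_two_mul_numInvol hα
  by_cases hinA : ∀ x : X, x * x = 1 → x ∈ A
  · exact Or.inl (mul_self_of_involutions_mem hcomm hX hinA)
  push Not at hinA
  obtain ⟨t, ht, htA⟩ := hinA
  have hcard' : Nat.card X = 2 * Nat.card A := by
    have := two_mul_card_le_of_mem (B := A) (M := ⊤) le_top (Subgroup.mem_top t) htA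
    rw [Subgroup.card_top] at this
    omega
  have hpos : 0 < Nat.card A := Nat.card_pos
  have hA : ∀ x ∉ A, x * t ∈ A := fun x hx => mul_mem_of_card_lt (M := ⊤) le_top
    (by rw [Subgroup.card_top]; omega) (Subgroup.mem_top x) (Subgroup.mem_top t) hx htA
  by_cases hsq : ∀ x : X, x * x = 1
  · exact Or.inl hsq
  right
  rcases index_two_dichotomy hcomm hX hcard' ht hA with h | h
  · left
    have htt : ∀ a ∈ A, t * a * t ∈ A := fun a ha =>
      hA _ fun h1 => htA ((A.mul_mem_cancel_right ha).1 h1)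
    obtain ⟨m, r, ⟨e⟩⟩ := exists_equiv_shearSemidirect h ht htA hA htt
    refine ⟨m, r, Nat.one_le_iff_ne_zero.2 ?_, ⟨e⟩⟩
    rintro rfl
    refine hsq fun x => e.injective ?_
    rw [map_mul, map_one, mul_self_of_subsingleton cpow_two_mul_self]
  · right
    have hinv : ∀ x ∉ A, x * x = 1 := fun x hx => by
      have h1 := h _ (hA x hx)
      rw [mul_inv_rev, inv_eq_of_mul_eq_one_left ht, mul_assoc, mul_assoc, ht, mul_one] at h1
      exact mul_eq_one_iff_eq_inv.2 (mul_left_cancel h1)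
    -- All elements outside A are involutions, so the hypothesis becomes α(A) > 1/2.
    rw [alpha_eq_of_subgroup hcard' hinv] at hα
    let _ : CommGroup A := { (inferInstance : Group A) with
      mul_comm := fun a b => Subtype.ext (hcomm a a.2 b b.2) }
    rcases pow_four_or_pow_six (A := A) (by linarith) with hp | hp
    · right
      obtain ⟨m, n, ⟨f⟩⟩ := exists_equiv_of_pow_four hp
      obtain ⟨e⟩ := exists_equiv_invSemidirect f ht htA hA h
      refine ⟨m, n, Nat.one_le_iff_ne_zero.2 ?_, ⟨e⟩⟩
      rintro rfl
      refine hsq fun x => e.injective ?_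
      rw [map_mul, map_one, mul_self_of_subsingleton cpow_two_mul_self]
    · left
      obtain ⟨m, n, ⟨f⟩⟩ := exists_equiv_of_pow_six hp
      obtain ⟨e⟩ := exists_equiv_invSemidirect f ht htA hA h
      refine ⟨m, n, Nat.one_le_iff_ne_zero.2 ?_, ⟨e⟩⟩
      rintro rfl
      refine hsq fun x => e.injective ?_
      rw [map_mul, map_one, mul_self_of_subsingleton cpow_two_mul_self]

end IndexTwo
end CyclicRatio

/-! ### Semidirect models: no factor C_2, and the values of α -/

namespace CyclicRatio

open scoped commutatorElement

section NoFactor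

theorem commutator_le_of_isCompl {G : Type*} [Group G] {H K : Subgroup G} [K.Normal]
    (hHK : IsCompl H K) (hcomm : ∀ a ∈ H, ∀ b ∈ H, a * b = b * a) : commutator G ≤ K := by
  rw [commutator_def, Subgroup.commutator_le]
  have hH : ∀ g : G, ∃ h ∈ H, (QuotientGroup.mk h : G ⧸ K) = QuotientGroup.mk g := by
    intro g
    obtain ⟨h, hh, k, hk, rfl⟩ := Subgroup.mem_sup_of_normal_right.1
      (hHK.sup_eq_top ▸ Subgroup.mem_top g)
    exact ⟨h, hh, QuotientGroup.eq.2 (by rwa [inv_mul_cancel_left])⟩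
  intro g₁ _ g₂ _
  obtain ⟨h₁, hh₁, e₁⟩ := hH g₁
  obtain ⟨h₂, hh₂, e₂⟩ := hH g₂
  have h : (QuotientGroup.mk' K) ⁅g₁, g₂⁆ = (QuotientGroup.mk' K) ⁅h₁, h₂⁆ := by
    rw [map_commutatorElement, map_commutatorElement]
    exact congrArg₂ _ e₁.symm e₂.symm
  rw [commutatorElement_eq_one_iff_mul_comm.2 (hcomm h₁ hh₁ h₂ hh₂), map_one] at h
  exact (QuotientGroup.eq_one_iff _).1 h

/-- A group whose central involutions lie in the commutator subgroup has no direct factor of order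
two. -/
theorem not_hasC2Factor {G : Type*} [Group G]
    (h : ∀ z ∈ Subgroup.center G, z * z = 1 → z ∈ commutator G) : ¬ HasC2Factor G := by
  rintro ⟨H, K, hH, hK, hHK, ⟨e⟩⟩
  have he : ∀ a : H, a = 1 ∨ a = e.symm (Multiplicative.ofAdd 1) := fun a => by
    rcases C_two_eq (e a) with h1 | h1
    · exact Or.inl (e.map_eq_one_iff.1 h1)
    · exact Or.inr (e.eq_symm_apply.2 h1)
  set z := e.symm (Multiplicative.ofAdd 1) with hz
  have hz1 : z ≠ 1 := fun h1 => by
    rw [hz, MulEquiv.map_eq_one_iff] at h1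
    exact absurd h1 (by decide)
  have hzz : z * z = 1 := by
    rw [hz, ← map_mul, MulEquiv.map_eq_one_iff]; decide
  have hcomm : ∀ a ∈ H, ∀ b ∈ H, a * b = b * a := fun a ha b hb => by
    have : ∀ s t : C 2, s * t = t * s := fun s t => mul_comm s t
    have h1 : (⟨a, ha⟩ : H) * ⟨b, hb⟩ = ⟨b, hb⟩ * ⟨a, ha⟩ := e.injective (by
      rw [map_mul, map_mul, this])
    exact congrArg Subtype.val h1
  have hcent : (z : G) ∈ Subgroup.center G := Subgroup.mem_center_iff.2 fun g => by
    rcases he ⟨g * z * g⁻¹, hH.conj_mem _ z.2 g⟩ with h1 | h1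
    · have h2 : g * z * g⁻¹ = 1 := congrArg Subtype.val h1
      rw [mul_inv_eq_one, mul_eq_left] at h2
      exact absurd (Subtype.ext h2) hz1
    · exact mul_inv_eq_iff_eq_mul.1 (congrArg Subtype.val h1)
  -- The generator of a normal subgroup of order two is central. It would lie in the commutator
  -- subgroup, hence in K, since G/K is a copy of the abelian group H.
  have hzK := commutator_le_of_isCompl hHK hcomm (h z hcent (congrArg Subtype.val hzz))
  have : (z : G) ∈ H ⊓ K := ⟨z.2, hzK⟩
  rw [hHK.inf_eq_bot, Subgroup.mem_bot] at this
  exact hz1 (Subtype.ext this)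

theorem HasC2Factor.map {G G' : Type*} [Group G] [Group G'] (e : G ≃* G') (h : HasC2Factor G) :
    HasC2Factor G' := by
  obtain ⟨H, K, hH, hK, hHK, ⟨f⟩⟩ := h
  exact ⟨H.map e.toMonoidHom, K.map e.toMonoidHom, hH.map _ e.surjective, hK.map _ e.surjective,
    e.mapSubgroup.isCompl hHK, ⟨(e.subgroupMap H).symm.trans f⟩⟩

end NoFactor

section SemidirectModels

variable {M : Type*} [CommGroup M]

/-- As φ is nontrivial, the center lies in M and is fixed by φ; and φ b * b⁻¹ is the commutator of
the generator of C_2 with b. -/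
theorem semidirect_not_hasC2Factor {φ : MulAut M} (hφ : φ * φ = 1) (hne : ∃ w, φ w ≠ w)
    (h : ∀ a, φ a = a → a * a = 1 → ∃ b, φ b * b⁻¹ = a) :
    ¬ HasC2Factor (M ⋊[involutionHom φ hφ] C 2) := by
  refine not_hasC2Factor ?_
  rintro ⟨a, c⟩ hc hsq
  rw [Subgroup.mem_center_iff] at hc
  rcases C_two_eq c with rfl | rfl
  · have h1 := congrArg SemidirectProduct.left (hc (SemidirectProduct.inr (Multiplicative.ofAdd 1)))
    rw [SemidirectProduct.mul_left, SemidirectProduct.mul_left, SemidirectProduct.left_inr,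
      SemidirectProduct.right_inr, involutionHom_gen, one_mul, map_one, mul_one] at h1
    have h2 := congrArg SemidirectProduct.left hsq
    rw [SemidirectProduct.mul_left, map_one] at h2
    obtain ⟨b, rfl⟩ := h a h1 h2
    have h3 : (⟨φ b * b⁻¹, 1⟩ : M ⋊[involutionHom φ hφ] C 2) =
        ⁅SemidirectProduct.inr (φ := involutionHom φ hφ) (Multiplicative.ofAdd 1),
          SemidirectProduct.inl (φ := involutionHom φ hφ) b⁆ := by
      have h4 := SemidirectProduct.inl_aut (φ := involutionHom φ hφ) (Multiplicative.ofAdd 1) b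
      rw [involutionHom_gen, map_inv] at h4
      rw [commutatorElement_def, ← h4, ← map_inv, ← map_mul]
      rfl
    rw [h3]
    exact Subgroup.commutator_mem_commutator (Subgroup.mem_top _) (Subgroup.mem_top _)
  · obtain ⟨w, hw⟩ := hne
    have h1 := congrArg SemidirectProduct.left (hc (SemidirectProduct.inl w))
    rw [SemidirectProduct.mul_left, SemidirectProduct.mul_left, SemidirectProduct.left_inl,
      SemidirectProduct.right_inl, involutionHom_gen, map_one, mul_comm] at h1
    exact absurd (mul_left_cancel h1).symm hw

theorem alpha_invSemidirect [Finite M] : alpha (InvSemidirect M) = (alpha M + 1) / 2 := by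
  have : Finite (InvSemidirect M) := Finite.of_equiv _ SemidirectProduct.equivProd.symm
  let i : M →* InvSemidirect M := SemidirectProduct.inl
  have hi : Function.Injective i := SemidirectProduct.inl_injective
  rw [alpha_congr (MonoidHom.ofInjective hi)]
  refine alpha_eq_of_subgroup ?_ ?_
  · rw [Nat.card_congr SemidirectProduct.equivProd, Nat.card_prod,
      Nat.card_congr (MonoidHom.ofInjective hi).symm.toEquiv, mul_comm]
    congr 1
    exact Nat.card_zmod 2
  · rintro ⟨a, c⟩ h
    rcases C_two_eq c with rfl | rfl
    · exact absurd ⟨a, rfl⟩ h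
    · have hg : Multiplicative.ofAdd (1 : ZMod 2) * Multiplicative.ofAdd 1 = 1 := by decide
      refine SemidirectProduct.ext ?_ hg
      rw [SemidirectProduct.mul_left, involutionHom_gen]
      exact mul_inv_cancel a

theorem numInvol_pi (G : Type*) [Group G] (n : ℕ) : numInvol (Fin n → G) = numInvol G ^ n := by
  have e : {g : Fin n → G // g * g = 1} ≃ (Fin n → {x : G // x * x = 1}) :=
    (Equiv.subtypeEquivRight fun g => funext_iff).trans
      (Equiv.subtypePiEquivPi (p := fun _ x => x * x = 1))
  rw [numInvol, Nat.card_congr e, Nat.card_fun, Nat.card_fin, numInvol]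

theorem numInvol_prod (G : Type*) (H : Type*) [Group G] [Group H] :
    numInvol (G × H) = numInvol G * numInvol H := by
  have e : {g : G × H // g * g = 1} ≃ {x : G // x * x = 1} × {x : H // x * x = 1} :=
    (Equiv.subtypeEquivRight fun g => Prod.ext_iff).trans
      (Equiv.subtypeProdEquivProd (p := fun x => x * x = 1) (q := fun x => x * x = 1))
  rw [numInvol, Nat.card_congr e, Nat.card_prod, numInvol, numInvol]

theorem card_cpow (k n : ℕ) : Nat.card (CPow k n) = k ^ n := by
  rw [Nat.card_fun, Nat.card_fin]
  exact congrArg (· ^ n) (Nat.card_zmod k)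

theorem numInvol_C_three : numInvol (C 3) = 1 := by
  rw [numInvol_eq]; decide

theorem numInvol_C_four : numInvol (C 4) = 2 := by
  rw [numInvol_eq]; decide

theorem alpha_inv_cpow_three (n : ℕ) :
    alpha (InvSemidirect (CPow 3 n)) = (3 * 3 ^ n + 1) / (4 * 3 ^ n) := by
  rw [alpha_invSemidirect, alpha_eq_of_orderOf, card_cpow, numInvol_pi, numInvol_C_three]
  · push_cast
    field_simp
    ring
  · refine fun g => Or.inr (orderOf_dvd_of_pow_eq_one (funext fun i => ?_))
    have : ∀ x : C 3, x ^ 6 = 1 := by decide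
    exact this _

theorem alpha_inv_cpow_four (n : ℕ) :
    alpha (InvSemidirect (CPow 4 n)) = (3 * 2 ^ n + 1) / (4 * 2 ^ n) := by
  rw [alpha_invSemidirect, alpha_eq_of_orderOf, card_cpow, numInvol_pi, numInvol_C_four]
  · push_cast
    rw [show (4 : ℚ) = 2 * 2 by norm_num, mul_pow]
    field_simp
    ring
  · refine fun g => Or.inl (orderOf_dvd_of_pow_eq_one (funext fun i => ?_))
    have : ∀ x : C 4, x ^ 4 = 1 := by decide
    exact this _

/-- For inversion the commutators φ b * b⁻¹ are the squares b⁻², so it suffices that involutions of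
M are squares. -/
theorem inv_not_hasC2Factor (hne : ∃ w : M, w⁻¹ ≠ w)
    (h : ∀ a : M, a * a = 1 → ∃ b, b * b = a) : ¬ HasC2Factor (InvSemidirect M) := by
  refine semidirect_not_hasC2Factor _ hne fun a _ ha => ?_
  obtain ⟨b, rfl⟩ := h a ha
  refine ⟨b⁻¹, ?_⟩
  change b⁻¹⁻¹ * b⁻¹⁻¹ = b * b
  rw [inv_inv]

theorem inv_cpow_three_not_hasC2Factor {n : ℕ} (hn : 1 ≤ n) :
    ¬ HasC2Factor (InvSemidirect (CPow 3 n)) := by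
  refine inv_not_hasC2Factor ⟨fun _ => Multiplicative.ofAdd 1, fun h => ?_⟩ fun a ha => ⟨1, ?_⟩
  · exact absurd (congrFun h ⟨0, hn⟩) (by decide : (Multiplicative.ofAdd (1 : ZMod 3))⁻¹ ≠ _)
  · have : ∀ x : C 3, x * x = 1 → 1 * 1 = x := by decide
    exact funext fun i => this _ (congrFun ha i)

theorem inv_cpow_four_not_hasC2Factor {n : ℕ} (hn : 1 ≤ n) :
    ¬ HasC2Factor (InvSemidirect (CPow 4 n)) := by
  refine inv_not_hasC2Factor ⟨fun _ => Multiplicative.ofAdd 1, fun h => ?_⟩ fun a ha => ?_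
  · exact absurd (congrFun h ⟨0, hn⟩) (by decide : (Multiplicative.ofAdd (1 : ZMod 4))⁻¹ ≠ _)
  · have : ∀ x : C 4, x * x = 1 → ∃ y, y * y = x := by decide
    choose b hb using fun i => this _ (congrFun ha i)
    exact ⟨b, funext hb⟩

theorem shear_mul_eq {r : ℕ} (v : V r) : v * shear r v = Multiplicative.ofAdd (0, v.toAdd.1) := by
  refine Multiplicative.toAdd.injective (Prod.ext (funext fun i => ?_) (funext fun i => ?_))
  · exact CharTwo.add_self_eq_zero (v.toAdd.1 i)
  · change v.toAdd.2 i + (v.toAdd.1 i + v.toAdd.2 i) = v.toAdd.1 i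
    rw [add_left_comm, CharTwo.add_self_eq_zero, add_zero]

theorem V_mul_self {r : ℕ} (v : V r) : v * v = 1 :=
  Multiplicative.toAdd.injective (Prod.ext (funext fun _ => CharTwo.add_self_eq_zero _)
    (funext fun _ => CharTwo.add_self_eq_zero _))

theorem shear_not_hasC2Factor {r : ℕ} (hr : 1 ≤ r) : ¬ HasC2Factor (ShearSemidirect r) := by
  refine semidirect_not_hasC2Factor _ ⟨V.x ⟨0, hr⟩, fun h => ?_⟩ fun a ha _ => ?_
  · rw [shear_x, mul_eq_left] at h
    have h1 := congrFun (congrArg (fun v : V r => v.toAdd.2) h) ⟨0, hr⟩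
    simp [V.y] at h1
  · have h0 : a.toAdd.1 = 0 := by
      have h1 := shear_mul_eq a
      rw [ha, V_mul_self] at h1
      exact (congrArg (fun v : V r => v.toAdd.2) h1).symm
    refine ⟨Multiplicative.ofAdd (a.toAdd.2, 0), ?_⟩
    rw [inv_eq_of_mul_eq_one_left (V_mul_self _), mul_comm, shear_mul_eq]
    exact Multiplicative.toAdd.injective (Prod.ext h0.symm rfl)

theorem shear_mul_self_eq {r : ℕ} (v : V r) (c : C 2) :
    (⟨v, c⟩ * ⟨v, c⟩ : ShearSemidirect r) =
      ⟨if c = 1 then 1 else Multiplicative.ofAdd (0, v.toAdd.1), 1⟩ := by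
  rcases C_two_eq c with rfl | rfl
  · rw [if_pos rfl]
    refine SemidirectProduct.ext ?_ rfl
    rw [SemidirectProduct.mul_left, map_one]
    exact V_mul_self v
  · have hg : Multiplicative.ofAdd (1 : ZMod 2) * Multiplicative.ofAdd 1 = 1 := by decide
    rw [if_neg (by decide)]
    refine SemidirectProduct.ext ?_ hg
    rw [SemidirectProduct.mul_left, involutionHom_gen]
    exact shear_mul_eq v

theorem alpha_shear (r : ℕ) : alpha (ShearSemidirect r) = (3 * 2 ^ r + 1) / (4 * 2 ^ r) := by
  have : Finite (ShearSemidirect r) := Finite.of_equiv _ SemidirectProduct.equivProd.symm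
  have hfun : Nat.card (Fin r → ZMod 2) = 2 ^ r := by
    rw [Nat.card_fun, Nat.card_fin, Nat.card_zmod]
  have hV : Nat.card (V r) = 2 ^ r * 2 ^ r := by
    rw [← hfun, ← Nat.card_prod]; rfl
  have hcard : Nat.card (ShearSemidirect r) = 2 ^ r * 2 ^ r * 2 := by
    rw [Nat.card_congr SemidirectProduct.equivProd, Nat.card_prod, hV]
    exact congrArg _ (Nat.card_zmod 2)
  -- All of V counts, and in the other coset exactly the v c with v in the span of the y_i.
  have hI : numInvol (ShearSemidirect r) = 2 ^ r * 2 ^ r + 2 ^ r := by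
    rw [← hV, ← hfun, ← Nat.card_sum]
    let f : V r ⊕ (Fin r → ZMod 2) → {g : ShearSemidirect r // g * g = 1} := fun s =>
      s.elim (fun v => ⟨⟨v, 1⟩, by rw [shear_mul_self_eq, if_pos rfl]; rfl⟩)
        fun b => ⟨⟨Multiplicative.ofAdd (0, b), Multiplicative.ofAdd 1⟩, by
          rw [shear_mul_self_eq, if_neg (by decide)]; rfl⟩
    refine (Nat.card_eq_of_bijective f ⟨?_, ?_⟩).symm
    · rintro (v | b) (v' | b') h
      · exact congrArg (fun g => Sum.inl g.1.left) h
      · exact absurd (congrArg (fun g => g.1.right) h)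
          (by decide : (1 : C 2) ≠ Multiplicative.ofAdd 1)
      · exact absurd (congrArg (fun g => g.1.right) h)
          (by decide : Multiplicative.ofAdd 1 ≠ (1 : C 2))
      · exact congrArg (fun g => Sum.inr g.1.left.toAdd.2) h
    · rintro ⟨⟨v, c⟩, hg⟩
      rcases C_two_eq c with rfl | rfl
      · exact ⟨Sum.inl v, rfl⟩
      · rw [shear_mul_self_eq, if_neg (by decide)] at hg
        have h0 : v.toAdd.1 = 0 := congrArg (fun g => g.left.toAdd.2) hg
        refine ⟨Sum.inr v.toAdd.2, Subtype.ext (SemidirectProduct.ext ?_ rfl)⟩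
        exact Multiplicative.toAdd.injective (Prod.ext h0.symm rfl)
  rw [alpha_eq_of_orderOf, hcard, hI]
  · push_cast
    field_simp
    ring
  · rintro ⟨v, c⟩
    refine Or.inl (orderOf_dvd_of_pow_eq_one ?_)
    rw [show 4 = 2 * 2 from rfl, pow_mul, pow_two, pow_two, shear_mul_self_eq, shear_mul_self_eq,
      if_pos rfl]
    rfl

end SemidirectModels
end CyclicRatio

/-! ### Dihedral models: no factor C_2, and the values of α -/

namespace CyclicRatio

open scoped commutatorElement

section DihedralModels

theorem D8.pow_four (x : D8) : x ^ 4 = 1 := by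
  decide +revert

theorem numInvol_D8 : numInvol D8 = 6 := by
  rw [numInvol_eq]; decide

theorem card_D8 : Nat.card D8 = 8 := by
  rw [Nat.card_eq_fintype_card]; rfl

theorem D8.center_eq (z : D8) (hz : z ∈ Subgroup.center D8) : z = 1 ∨ z = .r 2 :=
  D8.eq_of_central z fun y => by rw [← Subgroup.mem_center_iff.1 hz y]; group

theorem D8.exists_commutator (z : D8) (hz : z ∈ Subgroup.center D8) : ∃ x y : D8, ⁅x, y⁆ = z := by
  rcases D8.center_eq z hz with rfl | rfl
  · exact ⟨1, 1, by decide⟩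
  · exact ⟨.r 1, .sr 0, by decide⟩

theorem D8.mul_self_mem_center (x : D8) : x * x ∈ Subgroup.center D8 := by
  rw [Subgroup.mem_center_iff]; decide +revert

theorem alpha_D8_prod : alpha (D8 × D8) = 25 / 32 := by
  rw [alpha_eq_of_orderOf, Nat.card_prod, numInvol_prod, numInvol_D8, card_D8]
  · norm_num
  · exact fun g => Or.inl (orderOf_dvd_of_pow_eq_one
      (Prod.ext (D8.pow_four g.1) (D8.pow_four g.2)))

theorem D8_prod_not_hasC2Factor : ¬ HasC2Factor (D8 × D8) := by
  refine not_hasC2Factor ?_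
  rintro ⟨x, y⟩ h _
  rw [Subgroup.mem_center_iff] at h
  obtain ⟨a, b, hab⟩ := D8.exists_commutator x
    (Subgroup.mem_center_iff.2 fun g => congrArg Prod.fst (h (g, 1)))
  obtain ⟨c, d, hcd⟩ := D8.exists_commutator y
    (Subgroup.mem_center_iff.2 fun g => congrArg Prod.snd (h (1, g)))
  have h1 : (x, y) = ⁅(a, c), (b, d)⁆ := Prod.ext hab.symm hcd.symm
  rw [h1]
  exact Subgroup.commutator_mem_commutator (Subgroup.mem_top _) (Subgroup.mem_top _)

end DihedralModels

section CentralProduct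

open scoped IsMulCommutative

variable {r : ℕ}

theorem mem_centralN {a : Fin r → D8} (z : Fin r → Subgroup.center D8) (h : ∀ i, (z i : D8) = a i) :
    a ∈ centralN r ↔ ∏ i, z i = 1 := by
  refine ⟨?_, fun h1 => ⟨z, h, h1⟩⟩
  rintro ⟨w, hw, hw1⟩
  obtain rfl : w = z := funext fun i => Subtype.ext ((hw i).trans (h i).symm)
  exact hw1

theorem mulSingle_mem_centralN {i : Fin r} {c : D8} (h : Pi.mulSingle i c ∈ centralN r) :
    c = 1 := by
  obtain ⟨z, hz, hz1⟩ := h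
  have h1 : ∏ j, z j = z i := Fintype.prod_eq_single i fun j hj =>
    Subtype.ext (by rw [hz, Pi.mulSingle_eq_of_ne hj]; rfl)
  rw [h1] at hz1
  have h2 := hz i
  rw [hz1, Pi.mulSingle_eq_same] at h2
  exact h2.symm

theorem commutator_mulSingle (a : Fin r → D8) (i : Fin r) (y : D8) :
    ⁅a, (Pi.mulSingle i y : Fin r → D8)⁆ = Pi.mulSingle i ⁅a i, y⁆ := by
  ext1 j
  simp only [commutatorElement_def]
  by_cases hj : j = i
  · subst hj; simp
  · simp [hj]

/-- A central element has a representative with central coordinates. Modulo `centralN r` these can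
be collected in one coordinate, where each central element of D_8 is a commutator. -/
theorem centralProduct_not_hasC2Factor (hr : 1 ≤ r) : ¬ HasC2Factor (CentralProductD8 r) := by
  refine not_hasC2Factor fun g hg _ => ?_
  obtain ⟨a, rfl⟩ := QuotientGroup.mk_surjective g
  have ha : ∀ i, a i ∈ Subgroup.center D8 := fun i => Subgroup.mem_center_iff.2 fun y => by
    have h1 : (QuotientGroup.mk' (centralN r)) ⁅a, (Pi.mulSingle i y : Fin r → D8)⁆ = 1 := by
      rw [map_commutatorElement, commutatorElement_eq_one_iff_mul_comm]
      exact (Subgroup.mem_center_iff.1 hg _).symm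
    rw [commutator_mulSingle] at h1
    have h2 := mulSingle_mem_centralN ((QuotientGroup.eq_one_iff _).1 h1)
    exact (commutatorElement_eq_one_iff_mul_comm.1 h2).symm
  let z : Fin r → Subgroup.center D8 := fun i => ⟨a i, ha i⟩
  let w := ∏ i, z i
  let i₀ : Fin r := ⟨0, hr⟩
  obtain ⟨x, y, hxy⟩ := D8.exists_commutator w w.2
  have h1 : (QuotientGroup.mk a : CentralProductD8 r) =
      (QuotientGroup.mk' (centralN r)) (Pi.mulSingle i₀ (w : D8)) := by
    refine QuotientGroup.eq.2 ((mem_centralN (fun i => (z i)⁻¹ *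
      (Pi.mulSingle i₀ w : Fin r → Subgroup.center D8) i)
      fun i => ?_).2 ?_)
    · by_cases hi : i = i₀
      · subst hi; simp [z]
      · simp [hi, z]
    · rw [Finset.prod_mul_distrib, Finset.prod_inv_distrib, Finset.prod_pi_mulSingle',
        if_pos (Finset.mem_univ _)]
      exact inv_mul_cancel w
  have h2 : (Pi.mulSingle i₀ (w : D8) : Fin r → D8) =
      ⁅(Pi.mulSingle i₀ x : Fin r → D8), (Pi.mulSingle i₀ y : Fin r → D8)⁆ := by
    rw [commutator_mulSingle, Pi.mulSingle_eq_same, hxy]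
  rw [h1, h2, map_commutatorElement]
  exact Subgroup.commutator_mem_commutator (Subgroup.mem_top _) (Subgroup.mem_top _)

/-- The faithful character of the centre of the dihedral group of order `8`. -/
def centerSign : Subgroup.center D8 →* ℤ where
  toFun z := if (z : D8) = 1 then 1 else -1
  map_one' := if_pos rfl
  map_mul' z w := by
    have h1 : (DihedralGroup.r 2 : D8) * .r 2 = 1 := by decide
    have h2 : (DihedralGroup.r 2 : D8) ≠ 1 := by decide
    rw [Subgroup.coe_mul]
    rcases D8.center_eq z z.2 with hz | hz <;> rcases D8.center_eq w w.2 with hw | hw <;>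
      rw [hz, hw] <;> simp [h1, h2]

theorem centerSign_eq_one_iff (z : Subgroup.center D8) : centerSign z = 1 ↔ z = 1 := by
  change (if (z : D8) = 1 then (1 : ℤ) else -1) = 1 ↔ _
  rw [← OneMemClass.coe_eq_one]
  split_ifs with h <;> simp [h]

/-- The sign of an element of the dihedral group of order `8`: `-1` on elements of order `4`. -/
def D8.sign (x : D8) : ℤ := if x * x = 1 then 1 else -1

open scoped Classical in
-- Squares in D_8 are central and nontrivial exactly on elements of order 4, so the product of the
-- signs is the faithful character of the center evaluated at the product of the squares.
theorem prod_sign (a : Fin r → D8) :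
    ∏ i, D8.sign (a i) = if a * a ∈ centralN r then 1 else -1 := by
  let z : Fin r → Subgroup.center D8 := fun i => ⟨a i * a i, D8.mul_self_mem_center _⟩
  have h1 : centerSign (∏ i, z i) = ∏ i, D8.sign (a i) := map_prod centerSign z Finset.univ
  have h0 : a * a ∈ centralN r ↔ ∏ i, z i = 1 := mem_centralN z fun _ => rfl
  rw [← h1, if_congr h0 rfl rfl]
  split_ifs with h
  · rw [h, map_one]
  · have h2 := mt (centerSign_eq_one_iff _).1 h
    change (if _ then (1 : ℤ) else -1) ≠ 1 at h2
    change (if _ then (1 : ℤ) else -1) = -1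
    split_ifs at h2 ⊢ with h3
    · exact absurd rfl h2
    · rfl

/-- The sum of the product signs over all a factors as (6 - 2)^r = 4^r; by `prod_sign` it is also
twice the desired number minus 8^r. -/
theorem two_mul_card_mul_self_mem (r : ℕ) :
    2 * Nat.card {a : Fin r → D8 // a * a ∈ centralN r} = 8 ^ r + 4 ^ r := by
  classical
  have h1 : ∑ a : Fin r → D8, ∏ i, D8.sign (a i) = 4 ^ r := by
    have h2 : ∑ x : D8, D8.sign x = 4 := by decide
    rw [← Fintype.piFinset_univ, ← Finset.prod_univ_sum, h2]
    simp
  have hcard : Fintype.card (Fin r → D8) = 8 ^ r := by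
    rw [← Nat.card_eq_fintype_card, Nat.card_fun, card_D8, Nat.card_fin]
  have h3 : ∀ a : Fin r → D8, ∏ i, D8.sign (a i) =
      2 * (if a * a ∈ centralN r then 1 else 0) - 1 := fun a => by
    rw [prod_sign]; split_ifs <;> rfl
  rw [Finset.sum_congr rfl fun a _ => h3 a, Finset.sum_sub_distrib, ← Finset.mul_sum,
    Finset.sum_boole, Finset.sum_const, Finset.card_univ, hcard, nsmul_one] at h1
  rw [Nat.card_eq_fintype_card, Fintype.card_subtype]
  have h4 : (2 * (Finset.univ.filter fun a : Fin r → D8 => a * a ∈ centralN r).card : ℤ) =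
      8 ^ r + 4 ^ r := by
    rw [← h1]; push_cast; ring
  exact_mod_cast h4

theorem alpha_centralProduct (r : ℕ) :
    alpha (CentralProductD8 r) = (3 * 2 ^ r + 1) / (4 * 2 ^ r) := by
  have hcard : Nat.card (centralN r) * Nat.card (CentralProductD8 r) = 8 ^ r := by
    rw [mul_comm, ← Subgroup.card_eq_card_quotient_mul_card_subgroup, Nat.card_fun, card_D8,
      Nat.card_fin]
  -- Solutions in the quotient are counted through their preimages, so the order of `centralN r`
  -- cancels and need not be computed.
  have hI : 2 * (Nat.card (centralN r) * numInvol (CentralProductD8 r)) = 8 ^ r + 4 ^ r := by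
    rw [← two_mul_card_mul_self_mem, numInvol]
    congr 1
    refine (QuotientGroup.card_preimage_mk (centralN r)
      {g : CentralProductD8 r | g * g = 1}).symm.trans ?_
    exact Nat.card_congr (Equiv.subtypeEquivRight fun a => QuotientGroup.eq_one_iff (a * a))
  rw [alpha_eq_of_orderOf]
  · have hN : (Nat.card (centralN r) : ℚ) ≠ 0 := by exact_mod_cast Nat.card_pos.ne'
    have hQ : (Nat.card (CentralProductD8 r) : ℚ) ≠ 0 := by exact_mod_cast Nat.card_pos.ne'
    have h1 : (Nat.card (centralN r) * Nat.card (CentralProductD8 r) : ℚ) = 8 ^ r := by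
      exact_mod_cast hcard
    have h2 : (2 * (Nat.card (centralN r) * numInvol (CentralProductD8 r)) : ℚ) =
        8 ^ r + 4 ^ r := by exact_mod_cast hI
    have h3 : ((Nat.card (CentralProductD8 r) + numInvol (CentralProductD8 r)) /
        (2 * Nat.card (CentralProductD8 r)) : ℚ) = (3 * 8 ^ r + 4 ^ r) / (4 * 8 ^ r) := by
      rw [← mul_div_mul_left _ (2 * Nat.card (CentralProductD8 r) : ℚ) hN,
        ← mul_div_mul_left _ _ (two_ne_zero (α := ℚ))]
      congr 1
      · linear_combination 2 * h1 + h2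
      · linear_combination 4 * h1
    rw [h3, show (8 : ℚ) = 2 * 4 by norm_num, mul_pow]
    field_simp
  · intro g
    obtain ⟨a, rfl⟩ := QuotientGroup.mk_surjective g
    refine Or.inl (orderOf_dvd_of_pow_eq_one ?_)
    rw [← QuotientGroup.mk_pow, show a ^ 4 = 1 from funext fun i => D8.pow_four (a i)]
    rfl

end CentralProduct
end CyclicRatio
-- Assembly of the classification
namespace CyclicRatio

section Classification

theorem DihedralFamily.mul_self_of_zero {X : Type*} [Group X] {d e v : Fin 0 → X}
    (F : DihedralFamily d e v) (x : X) : x * x = 1 :=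
  F.center_sq x (F.gen (Subgroup.center X) le_rfl (fun i => i.elim0) ▸ Subgroup.mem_top x)

/-- A group in which more than three quarters of the possible cyclic subgroups occur is, up to a
direct power of the group of order two, one of the model groups. -/
theorem exists_equiv_model {X : Type*} [Group X] [Finite X] (hX : 3 / 4 < alpha X) :
    (∀ x : X, x * x = 1) ∨
      (∃ m n, 1 ≤ n ∧ Nonempty (X ≃* CPow 2 m × InvSemidirect (CPow 3 n))) ∨
      (∃ m n, 1 ≤ n ∧ Nonempty (X ≃* CPow 2 m × InvSemidirect (CPow 4 n))) ∨
      (∃ m, Nonempty (X ≃* CPow 2 m × (D8 × D8))) ∨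
      (∃ m r, 1 ≤ r ∧ Nonempty (X ≃* CPow 2 m × CentralProductD8 r)) ∨
      ∃ m r, 1 ≤ r ∧ Nonempty (X ≃* CPow 2 m × ShearSemidirect r) := by
  rcases exists_abelian_or_family X (card_lt_two_mul_numInvol hX) with
    ⟨A, hA, hcard⟩ | ⟨v, r, d, e, F⟩ | ⟨d, e, v, F, hv⟩
  · rcases equiv_of_comm_subgroup hA hcard hX with h | h | h | h
    · exact Or.inl h
    · exact Or.inr (Or.inr (Or.inr (Or.inr (Or.inr h))))
    · exact Or.inr (Or.inl h)
    · exact Or.inr (Or.inr (Or.inl h))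
  · rcases r with - | r
    · exact Or.inl F.mul_self_of_zero
    · obtain ⟨m, h⟩ := F.exists_equiv_centralProduct 0
      exact Or.inr (Or.inr (Or.inr (Or.inr (Or.inl ⟨m, r + 1, by omega, h⟩))))
  · exact Or.inr (Or.inr (Or.inr (Or.inl (F.exists_equiv_prod hv))))

/-- Transfer of a decomposition to a copy of the factor in another universe. -/
theorem transfer_to_ulift {X : Type u} {M : Type} [Group X] [Finite X] [Group M] {m : ℕ}
    (e : X ≃* CPow 2 m × M) (hM : ¬ HasC2Factor M) :
    Nonempty (X ≃* CPow 2 m × ULift.{u} M) ∧ alpha X = alpha (ULift.{u} M) ∧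
      ¬ HasC2Factor (ULift.{u} M) ∧ Nonempty (ULift.{u} M ≃* M) ∧
      alpha (ULift.{u} M) = alpha M := by
  have : Finite (CPow 2 m × M) := Finite.of_equiv X e.toEquiv
  have : Finite M := Finite.of_surjective (Prod.snd : CPow 2 m × M → M) Prod.snd_surjective
  have hα : alpha (ULift.{u} M) = alpha M := alpha_congr MulEquiv.ulift
  refine ⟨⟨e.trans (MulEquiv.prodCongr (MulEquiv.refl _) MulEquiv.ulift.symm)⟩, ?_,
    fun h => hM (h.map MulEquiv.ulift), ⟨MulEquiv.ulift⟩, hα⟩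
  rw [hα, alpha_congr e, alpha_prod_of_sq cpow_two_mul_self]

end Classification
end CyclicRatio

theorem mainTheorem2 {X : Type u} [Group X] [Finite X] (hX : 3 / 4 < CyclicRatio.alpha X) :
    ∃ (m : ℕ) (G : Type u) (_ : Group G),
      Nonempty (X ≃* CyclicRatio.CPow 2 m × G) ∧
      CyclicRatio.alpha X = CyclicRatio.alpha G ∧
      ¬ CyclicRatio.HasC2Factor G ∧
      ((Subsingleton G ∧ CyclicRatio.alpha X = 1) ∨
        (∃ n : ℕ, 1 ≤ n ∧
          ((Nonempty (G ≃* CyclicRatio.InvSemidirect (CyclicRatio.CPow 3 n)) ∧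
              CyclicRatio.alpha G = (3 * 3 ^ n + 1) / (4 * 3 ^ n)) ∨
            (Nonempty (G ≃* CyclicRatio.InvSemidirect (CyclicRatio.CPow 4 n)) ∧
              CyclicRatio.alpha G = (3 * 2 ^ n + 1) / (4 * 2 ^ n)))) ∨
        (Nonempty (G ≃* CyclicRatio.D8 × CyclicRatio.D8) ∧
          CyclicRatio.alpha G = 25 / 32) ∨
        (∃ r : ℕ, 1 ≤ r ∧ Nonempty (G ≃* CyclicRatio.CentralProductD8 r) ∧
          CyclicRatio.alpha G = (3 * 2 ^ r + 1) / (4 * 2 ^ r)) ∨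
        (∃ r : ℕ, 1 ≤ r ∧ Nonempty (G ≃* CyclicRatio.ShearSemidirect r) ∧
          CyclicRatio.alpha G = (3 * 2 ^ r + 1) / (4 * 2 ^ r))) := by
  open CyclicRatio in
  rcases exists_equiv_model hX with h | ⟨m, n, hn, ⟨e⟩⟩ | ⟨m, n, hn, ⟨e⟩⟩ | ⟨m, ⟨e⟩⟩ |
    ⟨m, r, hr, ⟨e⟩⟩ | ⟨m, r, hr, ⟨e⟩⟩
  · obtain ⟨m, ⟨e⟩⟩ := exists_equiv_cpow_two h
    have hα := alpha_eq_one_of_sq h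
    refine ⟨m, PUnit, inferInstance, ⟨e.trans MulEquiv.prodUnique.symm⟩, ?_, ?_,
      Or.inl ⟨inferInstance, hα⟩⟩
    · rw [hα, alpha_eq_one_of_sq fun _ => Subsingleton.elim _ _]
    · exact not_hasC2Factor fun z _ _ => Subsingleton.elim 1 z ▸ one_mem _
  · obtain ⟨h1, h2, h3, h4, h5⟩ := transfer_to_ulift e (inv_cpow_three_not_hasC2Factor hn)
    exact ⟨m, _, _, h1, h2, h3, Or.inr (Or.inl ⟨n, hn, Or.inl
      ⟨h4, h5.trans (alpha_inv_cpow_three n)⟩⟩)⟩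
  · obtain ⟨h1, h2, h3, h4, h5⟩ := transfer_to_ulift e (inv_cpow_four_not_hasC2Factor hn)
    exact ⟨m, _, _, h1, h2, h3, Or.inr (Or.inl ⟨n, hn, Or.inr
      ⟨h4, h5.trans (alpha_inv_cpow_four n)⟩⟩)⟩
  · obtain ⟨h1, h2, h3, h4, h5⟩ := transfer_to_ulift e D8_prod_not_hasC2Factor
    exact ⟨m, _, _, h1, h2, h3, Or.inr (Or.inr (Or.inl ⟨h4, h5.trans alpha_D8_prod⟩))⟩
  · obtain ⟨h1, h2, h3, h4, h5⟩ := transfer_to_ulift e (centralProduct_not_hasC2Factor hr)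
    exact ⟨m, _, _, h1, h2, h3, Or.inr (Or.inr (Or.inr (Or.inl
      ⟨r, hr, h4, h5.trans (alpha_centralProduct r)⟩)))⟩
  · obtain ⟨h1, h2, h3, h4, h5⟩ := transfer_to_ulift e (shear_not_hasC2Factor hr)
    exact ⟨m, _, _, h1, h2, h3, Or.inr (Or.inr (Or.inr (Or.inr
      ⟨r, hr, h4, h5.trans (alpha_shear r)⟩)))⟩
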